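/- **Second-order consistency of the two-kernel extrapolation scheme.** Let $n\ge 0$ and work in $\mathbb R^{d}=\mathbb R^n\times\mathbb R$, $d=n+1$, with points $(x,z)$. For $t>0$ let $$G_t(x,z)=(4\pi t)^{-d/2}\exp\Big(-\frac{|x|^2+z^2}{4t}\Big).$$ One step of size $t$ of the scheme maps a set $\Sigma\subset\mathbb R^d$ first to $\bar\Sigma_t=\{G_{t/2}*\mathbf 1_{\Sigma}\ge \tfrac12\}$ and then to $$\Sigma^1_t=\Big\{\frac{\sqrt2\,G_{t/2}*\mathbf 1_{\bar\Sigma_t}-G_t*\mathbf 1_{\Sigma}}{\sqrt2-1}\ \ge\ \tfrac12\Big\}.$$ Let $f:\mathbb R^n\to\mathbb R$ be $C^\infty$ with $f(0)=0$ and $\nabla f(0)=0$, and apply one step to $\Sigma=\{(x,z): z\le f(x)\}$. (a) There is a function $t\mapsto z(t)$ such that, for all sufficiently small $t>0$, the part of the $z$-axis in $\Sigma^1_t$ is exactly the half-line $\{(0,s):s\le z(t)\}$, the boundary $\partial\Sigma^1_t$ meets the $z$-axis only at $(0,z(t))$, and, as $t\to0^+$, $$z(t)=t\,\Delta f(0)+t^2\Big[\tfrac12\Delta^2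 f(0)-\operatorname{tr}\big((D^2f(0))^3\big)\Big]+O(t^3).$$ (b) Let $U\subset\mathbb R^n$ be an open neighbourhood of $0$, $T>0$, and let $u$ be $C^\infty$ on $U\times[0,T)$ (up to $t=0$) with $u(\cdot,0)=f$ on $U$, such that the graph of $u(\cdot,t)$ moves by mean curvature, i.e. on $U\times(0,T)$ $$u_t=\frac{1}{1+|\nabla u|^2}\sum_{i,j=1}^n\big((1+|\nabla u|^2)\delta_{ij}-u_iu_j\big)u_{ij}.$$ Then $u(0,t)$ has the same expansion as $z(t)$ in (a), so that $z(t)-u(0,t)=O(t^3)$ as $t\to0^+$. (c) In particular, in dimension $d=3$ ($n=2$), with all derivatives of $f$ evaluated at the origin, $$z(t)=t\,[f_{xx}+f_{yy}]+t^2\Big[\tfrac12(f_{xxxx}+2f_{xxyy}+f_{yyyy})-(f_{xx}^3+3f_{xx}f_{xy}^2+3f_{yy}f_{xy}^2+f_{yy}^3)\Big]+O(t^3),$$ and this is, up to $O(t^3)$, also the value $u(0,0,t)$ for every smooth local solution $u$, with $u(\cdot,\cdot,0)=f$, of $$u_t=\frac{u_{xx}(1+u_y^2)-2u_xu_yu_{xy}+u_{yy}(1+u_x^2)}{1+u_x^2+u_y^2}.$$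 -/

import Mathlib

open MeasureTheory Set Filter Asymptotics
open scoped Topology ContDiff Convolution Laplacian

noncomputable section

namespace TwoKernel

/-- The horizontal space `ℝⁿ` over which interfaces are graphs. The ambient space is
`ℝⁿ × ℝ`, of dimension `d = n + 1`, with its Lebesgue measure (the product measure). -/
abbrev Base (n : ℕ) : Type := EuclideanSpace ℝ (Fin n)

/-- The partial derivative `∂ᵢ f`. -/
def pd {n : ℕ} (i : Fin n) (f : Base n → ℝ) : Base n → ℝ :=
  fun x => fderiv ℝ f x (EuclideanSpace.single i 1)

/-- The Hessian matrix of `f` at `x`, of second partial derivatives. -/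
def hessian {n : ℕ} (f : Base n → ℝ) (x : Base n) : Matrix (Fin n) (Fin n) ℝ :=
  Matrix.of fun i j => pd i (pd j f) x

/-- The Gaussian kernel `G_t(p) = (4πt)^(-d/2) exp(-|p|²/(4t))` on `ℝⁿ × ℝ`, `d = n + 1`,
where `|(x, z)|² = |x|² + z²` is the Euclidean length. -/
def gaussian (n : ℕ) (t : ℝ) (p : Base n × ℝ) : ℝ :=
  (4 * Real.pi * t) ^ (-((n : ℝ) + 1) / 2) * Real.exp (-(‖p.1‖ ^ 2 + p.2 ^ 2) / (4 * t))

/-- `(G_t * 1_A)(p)`. -/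
def heat {n : ℕ} (t : ℝ) (A : Set (Base n × ℝ)) : Base n × ℝ → ℝ :=
  gaussian n t ⋆[ContinuousLinearMap.mul ℝ ℝ, volume] A.indicator (fun _ => (1 : ℝ))

/-- One step of the original threshold dynamics: `{p : (G_t * 1_A)(p) ≥ 1/2}`. -/
def mboStep {n : ℕ} (t : ℝ) (A : Set (Base n × ℝ)) : Set (Base n × ℝ) :=
  {p | heat t A p ≥ 1 / 2}

/-- One step, of size `t`, of the natural two-kernel extrapolation: with the half step
`B = {p : (G_{t/2} * 1_A)(p) ≥ 1/2}`, the new set is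
`{p : (√2 (G_{t/2} * 1_B)(p) - (G_t * 1_A)(p)) / (√2 - 1) ≥ 1/2}`. -/
def twoKernelStep {n : ℕ} (t : ℝ) (A : Set (Base n × ℝ)) : Set (Base n × ℝ) :=
  {p | (√2 * heat (t / 2) (mboStep (t / 2) A) p - heat t A p) / (√2 - 1) ≥ 1 / 2}

/-- The region `{(x, z) : z ≤ f x}` below the graph of `f`. -/
def subgraph {n : ℕ} (f : Base n → ℝ) : Set (Base n × ℝ) := {p | p.2 ≤ f p.1}

/-- The interface `∂A` meets the `z`-axis exactly at the height `z`, and the part of the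
`z`-axis in `A` is the half-line below that height. -/
def CrossesAxisAt {n : ℕ} (A : Set (Base n × ℝ)) (z : ℝ) : Prop :=
  (∀ s : ℝ, ((0 : Base n), s) ∈ A ↔ s ≤ z) ∧
    ∀ s : ℝ, ((0 : Base n), s) ∈ frontier A ↔ s = z

/-- The right-hand side of motion by mean curvature for graphs over `ℝⁿ`,
`(∑ᵢⱼ ((1 + |∇g|²) δᵢⱼ - gᵢ gⱼ) gᵢⱼ) / (1 + |∇g|²)`. -/
def curvatureSpeed {n : ℕ} (g : Base n → ℝ) (x : Base n) : ℝ :=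
  (∑ i, ∑ j, ((1 + ∑ k, pd k g x ^ 2) * (if i = j then 1 else 0) - pd i g x * pd j g x) *
      pd i (pd j g) x) / (1 + ∑ k, pd k g x ^ 2)

/-- The same for `n = 2`, written out:
`(f_xx (1 + f_y²) - 2 f_x f_y f_xy + f_yy (1 + f_x²)) / (1 + f_x² + f_y²)`. -/
def curvatureSpeed₂ (g : Base 2 → ℝ) (x : Base 2) : ℝ :=
  (pd 0 (pd 0 g) x * (1 + pd 1 g x ^ 2) - 2 * pd 0 g x * pd 1 g x * pd 0 (pd 1 g) x
      + pd 1 (pd 1 g) x * (1 + pd 0 g x ^ 2)) / (1 + pd 0 g x ^ 2 + pd 1 g x ^ 2)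

/-- `u` is smooth on `U × [0, T)` (up to the initial time), equals `f` at time `0`, and solves
`∂ₜ u = speed(u(·, t))` on `U × (0, T)`. -/
structure IsSmoothEvolution {n : ℕ} (speed : (Base n → ℝ) → Base n → ℝ)
    (f : Base n → ℝ) (U : Set (Base n)) (T : ℝ) (u : Base n → ℝ → ℝ) : Prop where
  smooth : ContDiffOn ℝ ∞ (fun q : Base n × ℝ => u q.1 q.2) (U ×ˢ Ico 0 T)
  initial : ∀ x ∈ U, u x 0 = f x
  equation : ∀ x ∈ U, ∀ t ∈ Ioo 0 T, HasDerivAt (u x) (speed (fun y => u y t) x) t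

end TwoKernel

end

/-! Write `a = √(2τ)` and `p(w) = ∫₀ʷ exp(-u²/2) du`, and let `ξ`, `η` be independent standard
Gaussian vectors. Integrating the kernel first in the vertical variable turns the convolution of a
subgraph `{z ≤ φ}` into `1/2 + (2π)^(-1/2) E p((φ(x + aξ) - s)/a)`; the mean is `erfMean` and the
identity is `heat_subgraph`. It is continuous and strictly decreasing in `s`, so the half step is
again a subgraph, of a continuous `ψ` with `E p((f(x + εη) - ψ(x))/ε) = 0`, where `ε = √t`. The
final set is given by the sign of `√2 E p((ψ(x + εξ) - s)/ε) - E p((f(x + √2 εξ) - s)/(√2 ε))`.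

Near the origin all heights are `O(ε²)`, so the arguments of `p` are `O(ε)` and `p(w) = w - w³/6 +
O(w⁵)` suffices. Let `A` be the Hessian at `0`, `q(ξ) = (⟪Aξ, ξ⟫ - tr A)/2`, `M = E f(√2 εξ)` and `H
= E ψ(εξ)`. To leading order the three quantities that get cubed are `f(εξ + εη) - ψ(εξ) ≈ ε² (⟪ξ,
Aη⟫ + q(η))`, `ψ(εξ) - z ≈ ε² q(ξ)`, `f(√2 εξ) - z ≈ 2 ε² q(ξ)`, with third moments `4 tr A³`, `tr
A³` and `8 tr A³` times `ε⁶`, by Gaussian integration by parts. Averaging the first equation over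
`ξ` and using that `ξ + η` has the law of `√2 ξ` gives `M - H = (2/3) ε⁴ tr A³ + O(ε⁶)`. The second
equation, multiplied by `√2 ε`, gives `z = 2H - M - (1/3) ε⁴ tr A³ + (2/3) ε⁴ tr A³ + O(ε⁶) = M - ε⁴
tr A³ + O(ε⁶)`. The heat expansion `M = ε² Δf(0) + (ε⁴/2) Δ²f(0) + O(ε⁶)` finishes the computation.

Two points need care. The cubes must be known up to `O(ε⁸)`, one order better than Taylor's formula
gives directly: the corrections of relative order `ε` are odd under `ξ ↦ -ξ`, and the odd part
enters a third moment only quadratically (`abs_integral_pow_three_sub_le`). And `f` may grow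
arbitrarily: it is replaced by a cutoff `F`, and boundedness of `p` together with Gaussian moments
makes the difference smaller than any power of `ε`. Existence and uniqueness of the crossing come
from comparison with a flat interface: the profile `√2 p(σ) - p(σ/√2)` is bounded away from zero for
`|σ| ≥ 1.15`, and the slope is controlled for `|σ| ≤ 1.15`.

For the flow, `uₜ = Δu - ∑ uᵢ uⱼ uᵢⱼ/(1 + |∇u|²)`. At a critical point the nonlinear term and its
time derivative vanish, since two of its factors do, and its Laplacian is `2 tr (D²f)³`. Hence `uₜ =
Δf` and `uₜₜ = Δ²f - 2 tr (D²f)³` at the origin at time zero, and Taylor's formula in time gives the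
same expansion. -/

namespace TwoKernel

open ProbabilityTheory
open scoped RealInnerProductSpace

set_option linter.unusedSectionVars false

/-! ### The standard Gaussian measure: density, semigroup property, integration by parts. -/

section GaussianMeasure

variable {E : Type*} [NormedAddCommGroup E] [InnerProductSpace ℝ E] [FiniteDimensional ℝ E]
  [MeasurableSpace E] [BorelSpace E]

/-- The density of the standard Gaussian measure. -/
noncomputable def stdDensity (E : Type*) [NormedAddCommGroup E] [InnerProductSpace ℝ E] (x : E) :
    ℝ :=
  (2 * Real.pi) ^ (-(Module.finrank ℝ E : ℝ) / 2) * Real.exp (-‖x‖ ^ 2 / 2)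

lemma stdDensity_pos (x : E) : 0 < stdDensity E x := by unfold stdDensity; positivity

lemma contDiff_stdDensity : ContDiff ℝ ∞ (stdDensity E) := by
  unfold stdDensity
  have : ContDiff ℝ ∞ fun x : E => ‖x‖ ^ 2 := contDiff_norm_sq ℝ
  fun_prop

/-- The Fourier transform of the density. At `t = 0` it gives the normalisation; for general `t` it
identifies the density with the measure through characteristic functions. -/
lemma integral_stdDensity_mul_cexp (t : E) :
    ∫ x, (stdDensity E x : ℂ) * Complex.exp (⟪x, t⟫ * Complex.I) = Complex.exp (-‖t‖ ^ 2 / 2) := by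
  have h := GaussianFourier.integral_cexp_neg_mul_sq_norm_add (V := E) (b := (1 / 2 : ℂ))
    (by norm_num) Complex.I t
  have h2 : ∀ x : E, (stdDensity E x : ℂ) * Complex.exp (⟪x, t⟫ * Complex.I) =
      (((2 * Real.pi) ^ (-(Module.finrank ℝ E : ℝ) / 2) : ℝ) : ℂ) *
      Complex.exp (-(1 / 2 : ℂ) * ‖x‖ ^ 2 + Complex.I * ⟪t, x⟫) := by
    intro x
    rw [Complex.exp_add, stdDensity, real_inner_comm]
    push_cast
    rw [mul_assoc]
    congr 2
    · congr 1; ring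
    · congr 1; ring
  simp_rw [h2]
  rw [integral_const_mul, h, ← mul_assoc]
  have h3 : (((2 * Real.pi) ^ (-(Module.finrank ℝ E : ℝ) / 2) : ℝ) : ℂ) *
      ((Real.pi : ℂ) / (1 / 2)) ^ (Module.finrank ℝ E / 2 : ℂ) = 1 := by
    have : ((Real.pi : ℂ) / (1 / 2)) ^ (Module.finrank ℝ E / 2 : ℂ) =
        (((2 * Real.pi) ^ ((Module.finrank ℝ E : ℝ) / 2) : ℝ) : ℂ) := by
      rw [Complex.ofReal_cpow (by positivity)]
      push_cast
      congr 1
      ring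
    rw [this, ← Complex.ofReal_mul, ← Real.rpow_add (by positivity), neg_div, neg_add_cancel]
    simp
  rw [h3, one_mul]
  congr 1
  rw [Complex.I_sq]
  ring

lemma integrable_stdDensity : Integrable (stdDensity E) := by
  have h := integral_stdDensity_mul_cexp (0 : E)
  -- A function that is not integrable has Bochner integral `0`, whereas the Fourier transform at
  -- `0` is `1`.
  by_contra hn
  have : ∫ x, (stdDensity E x : ℂ) = 1 := by simpa using h
  rw [integral_complex_ofReal, integral_undef hn] at this
  simp at this

lemma stdGaussian_eq_withDensity :
    stdGaussian E = volume.withDensity fun x => ENNReal.ofReal (stdDensity E x) := by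
  have : IsFiniteMeasure (volume.withDensity fun x => ENNReal.ofReal (stdDensity E x)) :=
    isFiniteMeasure_withDensity_ofReal integrable_stdDensity.2
  apply Measure.ext_of_charFun
  ext t
  rw [charFun_stdGaussian, charFun_apply,
    integral_withDensity_eq_integral_toReal_smul
      (by exact contDiff_stdDensity.continuous.measurable.ennreal_ofReal)
      (by simp), ← integral_stdDensity_mul_cexp]
  refine integral_congr_ae (ae_of_all _ fun x => ?_)
  simp [ENNReal.toReal_ofReal (stdDensity_pos x).le]

lemma integral_stdGaussian (g : E → ℝ) :
    ∫ x, g x ∂(stdGaussian E) = ∫ x, stdDensity E x * g x := by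
  rw [stdGaussian_eq_withDensity, integral_withDensity_eq_integral_toReal_smul
      (by exact contDiff_stdDensity.continuous.measurable.ennreal_ofReal)
      (by simp)]
  refine integral_congr_ae (ae_of_all _ fun x => ?_)
  simp [ENNReal.toReal_ofReal (stdDensity_pos x).le]

lemma integrable_stdGaussian_iff (g : E → ℝ) :
    Integrable g (stdGaussian E) ↔ Integrable fun x => stdDensity E x * g x := by
  rw [stdGaussian_eq_withDensity, integrable_withDensity_iff_integrable_smul']
  · refine integrable_congr (ae_of_all _ fun x => ?_)
    simp [ENNReal.toReal_ofReal (stdDensity_pos x).le]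
  · exact contDiff_stdDensity.continuous.measurable.ennreal_ofReal
  · simp

lemma integrable_one_add_norm_pow (m : ℕ) :
    Integrable (fun x : E => (1 + ‖x‖) ^ m) (stdGaussian E) := by
  have h : MemLp (fun x : E => 1 + ‖x‖) m (stdGaussian E) :=
    (memLp_const (1 : ℝ)).add (IsGaussian.memLp_id _ _ (by simp)).norm
  have h2 := h.integrable_norm_pow'
  refine h2.congr (ae_of_all _ fun x => ?_)
  simp only [Real.norm_eq_abs]
  rw [abs_of_nonneg (by positivity)]

lemma integrable_of_polynomial_bound {g : E → ℝ} (hg : AEStronglyMeasurable g (stdGaussian E))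
    {C : ℝ} {m : ℕ} (h : ∀ x, |g x| ≤ C * (1 + ‖x‖) ^ m) : Integrable g (stdGaussian E) :=
  ((integrable_one_add_norm_pow m).const_mul C).mono' hg (ae_of_all _ h)

/-- The symmetry behind every parity argument below. -/
lemma measurePreserving_neg_stdGaussian :
    MeasurePreserving (fun x : E => -x) (stdGaussian E) (stdGaussian E) :=
  ⟨measurable_neg, stdGaussian_map (LinearIsometryEquiv.neg ℝ (E := E))⟩

lemma integral_stdGaussian_neg (g : E → ℝ) :
    ∫ x, g (-x) ∂(stdGaussian E) = ∫ x, g x ∂(stdGaussian E) :=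
  measurePreserving_neg_stdGaussian.integral_comp
    (Homeomorph.neg E).measurableEmbedding g

/-- Both sides have characteristic function `exp(-‖t‖²)`. -/
lemma map_add_stdGaussian_prod :
    ((stdGaussian E).prod (stdGaussian E)).map (fun q : E × E => q.1 + q.2) =
      (stdGaussian E).map (fun x : E => √2 • x) := by
  change (stdGaussian E) ∗ (stdGaussian E) = _
  have : IsFiniteMeasure ((stdGaussian E).map (fun x : E => √2 • x)) :=
    Measure.isFiniteMeasure_map _ _
  apply Measure.ext_of_charFun
  ext t
  rw [charFun_conv, charFun_map_smul, charFun_stdGaussian, charFun_stdGaussian, ← Complex.exp_add,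
    norm_smul]
  congr 1
  have : (((√2 : ℝ) : ℂ)) ^ 2 = 2 := by norm_cast; norm_num
  simp only [Real.norm_eq_abs, abs_of_nonneg (Real.sqrt_nonneg 2)]
  push_cast
  rw [mul_pow, this]
  ring

/-- The semigroup property: a sum of two independent standard Gaussian vectors is `√2` times one. -/
lemma integral_prod_stdGaussian_add {g : E → ℝ} (hg : Continuous g) :
    ∫ q : E × E, g (q.1 + q.2) ∂((stdGaussian E).prod (stdGaussian E)) =
      ∫ x, g (√2 • x) ∂(stdGaussian E) := by
  rw [← integral_map (φ := fun q : E × E => q.1 + q.2) (by fun_prop) hg.aestronglyMeasurable,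
    map_add_stdGaussian_prod, integral_map (by fun_prop) hg.aestronglyMeasurable]

lemma fderiv_stdDensity (x v : E) : fderiv ℝ (stdDensity E) x v = -⟪v, x⟫ * stdDensity E x := by
  have h1 : HasFDerivAt (fun x : E => ‖x‖ ^ 2) (2 • innerSL ℝ x) x :=
    (hasStrictFDerivAt_norm_sq x).hasFDerivAt
  have h2 : HasFDerivAt (fun x : E => -‖x‖ ^ 2 / 2) (-(1 / 2 : ℝ) • (2 • innerSL ℝ x)) x := by
    convert! (h1.const_mul (-(1 / 2 : ℝ))) using 1
    ext y; ring
  have h3 := (h2.exp.const_mul ((2 * Real.pi) ^ (-(Module.finrank ℝ E : ℝ) / 2)))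
  have h4 : HasFDerivAt (stdDensity E) _ x := h3
  rw [h4.fderiv, stdDensity]
  simp only [_root_.smul_apply, innerSL_apply_apply, smul_eq_mul, nsmul_eq_mul]
  rw [real_inner_comm]
  push_cast
  ring

/-- Gaussian integration by parts. -/
lemma integral_inner_mul_stdGaussian {g : E → ℝ} (hg : ContDiff ℝ 1 g) {C : ℝ} {m : ℕ}
    (h0 : ∀ x, |g x| ≤ C * (1 + ‖x‖) ^ m) (h1 : ∀ x, ‖fderiv ℝ g x‖ ≤ C * (1 + ‖x‖) ^ m) (v : E) :
    ∫ x, ⟪v, x⟫ * g x ∂(stdGaussian E) = ∫ x, fderiv ℝ g x v ∂(stdGaussian E) := by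
  have hgc := hg.continuous
  have hfc : Continuous fun x => fderiv ℝ g x v :=
    (hg.continuous_fderiv (by simp)).clm_apply continuous_const
  have i0 : Integrable g (stdGaussian E) :=
    integrable_of_polynomial_bound hgc.aestronglyMeasurable h0
  have i1 : Integrable (fun x => fderiv ℝ g x v) (stdGaussian E) := by
    refine integrable_of_polynomial_bound (C := C * ‖v‖) (m := m) hfc.aestronglyMeasurable fun x => ?_
    calc |fderiv ℝ g x v| ≤ ‖fderiv ℝ g x‖ * ‖v‖ := (fderiv ℝ g x).le_opNorm v
      _ ≤ C * (1 + ‖x‖) ^ m * ‖v‖ := by gcongr; exact h1 x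
      _ = _ := by ring
  have i2 : Integrable (fun x => ⟪v, x⟫ * g x) (stdGaussian E) := by
    refine integrable_of_polynomial_bound (C := C * ‖v‖) (m := m + 1)
      (by fun_prop) fun x => ?_
    rw [abs_mul]
    have hx : ‖x‖ ≤ 1 + ‖x‖ := by linarith
    calc |⟪v, x⟫| * |g x| ≤ (‖v‖ * ‖x‖) * (C * (1 + ‖x‖) ^ m) := by
          gcongr
          · exact abs_real_inner_le_norm v x
          · exact h0 x
      _ ≤ (‖v‖ * (1 + ‖x‖)) * (C * (1 + ‖x‖) ^ m) := by
          have := (abs_nonneg _).trans (h0 x)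
          gcongr
      _ = _ := by ring
  rw [integral_stdGaussian, integral_stdGaussian]
  rw [integrable_stdGaussian_iff] at i0 i1 i2
  rw [integral_mul_fderiv_eq_neg_fderiv_mul_of_integrable]
  · rw [← integral_neg]
    refine integral_congr_ae (ae_of_all _ fun x => ?_)
    simp only [fderiv_stdDensity]
    ring
  · refine i2.neg.congr (ae_of_all _ fun x => ?_)
    simp only [fderiv_stdDensity, Pi.neg_apply]
    ring
  · exact i1
  · exact i0
  · exact fun x _ => contDiff_stdDensity.differentiable (by simp) x
  · exact fun x _ => hg.differentiable (by simp) x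

end GaussianMeasure

end TwoKernel

namespace TwoKernel

open ProbabilityTheory
open scoped RealInnerProductSpace

set_option linter.unusedSectionVars false

/-! ### Third moments of Gaussian quadratic forms. -/

section QuadraticForm

variable {E : Type*} [NormedAddCommGroup E] [InnerProductSpace ℝ E] [FiniteDimensional ℝ E]
  [MeasurableSpace E] [BorelSpace E]

/-- Gaussian integration by parts against a quadratic form. -/
lemma integral_quadratic_mul_stdGaussian {g : E → ℝ} (hg : ContDiff ℝ 1 g) {C : ℝ} {m : ℕ}
    (h0 : ∀ x, |g x| ≤ C * (1 + ‖x‖) ^ m) (h1 : ∀ x, ‖fderiv ℝ g x‖ ≤ C * (1 + ‖x‖) ^ m)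
    (B : E →L[ℝ] E) :
    ∫ x, ⟪B x, x⟫ * g x ∂(stdGaussian E) =
      LinearMap.trace ℝ E B * ∫ x, g x ∂(stdGaussian E) +
        ∫ x, fderiv ℝ g x (B x) ∂(stdGaussian E) := by
  set b := stdOrthonormalBasis ℝ E
  have hC : ∀ x : E, 0 ≤ C * (1 + ‖x‖) ^ m := fun x => (abs_nonneg _).trans (h0 x)
  have hC0 : 0 ≤ C := by simpa using hC 0
  have hfc : Continuous (fderiv ℝ g) := hg.continuous_fderiv (by simp)
  have hgc := hg.continuous
  have hBx : ∀ x : E, ‖B x‖ ≤ ‖B‖ * (1 + ‖x‖) := fun x =>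
    (B.le_opNorm x).trans (by gcongr; linarith)
  have ig : Integrable g (stdGaussian E) :=
    integrable_of_polynomial_bound hgc.aestronglyMeasurable h0
  have hone : ∀ x : E, (1:ℝ) ≤ 1 + ‖x‖ := fun x => by linarith [norm_nonneg x]
  -- one coordinate
  have key : ∀ i, ∫ x, ⟪b i, x⟫ * (⟪b i, B x⟫ * g x) ∂(stdGaussian E) =
      ∫ x, (⟪b i, B (b i)⟫ * g x + ⟪b i, B x⟫ * fderiv ℝ g x (b i)) ∂(stdGaussian E) := by
    intro i
    have hl : ∀ x, HasFDerivAt (fun x => ⟪b i, B x⟫) ((innerSL ℝ (b i)).comp B) x := fun x =>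
      ((innerSL ℝ (b i)).comp B).hasFDerivAt
    have hd : ∀ x, HasFDerivAt (fun x => ⟪b i, B x⟫ * g x)
        (⟪b i, B x⟫ • fderiv ℝ g x + g x • ((innerSL ℝ (b i)).comp B)) x := fun x =>
      (hl x).mul (hg.differentiable (by simp) x).hasFDerivAt
    have hcd : ContDiff ℝ 1 fun x => ⟪b i, B x⟫ * g x :=
      (contDiff_const.inner ℝ B.contDiff).mul hg
    have hib : ∀ x, |⟪b i, B x⟫| ≤ ‖B‖ * (1 + ‖x‖) := fun x => by
      refine (abs_real_inner_le_norm _ _).trans ?_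
      simpa using hBx x
    rw [integral_inner_mul_stdGaussian hcd (C := 2 * (‖B‖ * C)) (m := m + 1)]
    · refine integral_congr_ae (ae_of_all _ fun x => ?_)
      simp only [(hd x).fderiv]
      simp only [_root_.add_apply, _root_.smul_apply, ContinuousLinearMap.comp_apply,
        innerSL_apply_apply, smul_eq_mul]
      ring
    · intro x
      rw [abs_mul]
      calc _ ≤ (‖B‖ * (1 + ‖x‖)) * (C * (1 + ‖x‖) ^ m) := by gcongr; exacts [hib x, h0 x]
        _ = 1 * (‖B‖ * C) * (1 + ‖x‖) ^ (m + 1) := by ring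
        _ ≤ _ := by gcongr; norm_num
    · intro x
      rw [(hd x).fderiv]
      have hn : ‖(innerSL ℝ (b i)).comp B‖ ≤ ‖B‖ := by
        refine (ContinuousLinearMap.opNorm_comp_le _ _).trans ?_
        simp
      calc _ ≤ |⟪b i, B x⟫| * ‖fderiv ℝ g x‖ + |g x| * ‖(innerSL ℝ (b i)).comp B‖ := by
            refine (norm_add_le _ _).trans ?_
            rw [norm_smul, norm_smul, Real.norm_eq_abs, Real.norm_eq_abs]
        _ ≤ (‖B‖ * (1 + ‖x‖)) * (C * (1 + ‖x‖) ^ m) + (C * (1 + ‖x‖) ^ m) * (‖B‖ * (1 + ‖x‖)) := by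
            have := hC x
            gcongr
            · exact hib x
            · exact h1 x
            · exact h0 x
            · refine hn.trans ?_
              nlinarith [norm_nonneg B, norm_nonneg x]
        _ = _ := by ring
  have int1 : ∀ i, Integrable (fun x => ⟪b i, x⟫ * (⟪b i, B x⟫ * g x)) (stdGaussian E) := by
    intro i
    refine integrable_of_polynomial_bound (C := ‖B‖ * C) (m := m + 2) (by fun_prop) fun x => ?_
    rw [abs_mul, abs_mul]
    calc _ ≤ (1 * (1 + ‖x‖)) * ((1 * (‖B‖ * (1 + ‖x‖))) * (C * (1 + ‖x‖) ^ m)) := by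
          gcongr
          · refine (abs_real_inner_le_norm _ _).trans ?_
            simp
          · refine (abs_real_inner_le_norm _ _).trans ?_
            simpa using hBx x
          · exact h0 x
      _ = _ := by ring
  have int2 : ∀ i, Integrable (fun x => ⟪b i, B x⟫ * fderiv ℝ g x (b i)) (stdGaussian E) := by
    intro i
    refine integrable_of_polynomial_bound (C := ‖B‖ * C) (m := m + 1) (by fun_prop) fun x => ?_
    rw [abs_mul]
    calc _ ≤ (1 * (‖B‖ * (1 + ‖x‖))) * ((C * (1 + ‖x‖) ^ m) * 1) := by
          gcongr
          · refine (abs_real_inner_le_norm _ _).trans ?_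
            simpa using hBx x
          · refine ((fderiv ℝ g x).le_opNorm _).trans ?_
            simpa using h1 x
      _ = _ := by ring
  have hsum : ∀ x y : E, ⟪y, x⟫ = ∑ i, ⟪b i, x⟫ * ⟪b i, y⟫ := by
    intro x y
    rw [← b.sum_inner_mul_inner y x]
    refine Finset.sum_congr rfl fun i _ => ?_
    rw [real_inner_comm y (b i)]; ring
  calc ∫ x, ⟪B x, x⟫ * g x ∂(stdGaussian E)
      = ∑ i, ∫ x, ⟪b i, x⟫ * (⟪b i, B x⟫ * g x) ∂(stdGaussian E) := by
        rw [← integral_finsetSum _ fun i _ => int1 i]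
        refine integral_congr_ae (ae_of_all _ fun x => ?_)
        simp only [hsum x (B x), Finset.sum_mul]
        exact Finset.sum_congr rfl fun i _ => by ring
    _ = ∑ i, (⟪b i, B (b i)⟫ * ∫ x, g x ∂(stdGaussian E) +
          ∫ x, ⟪b i, B x⟫ * fderiv ℝ g x (b i) ∂(stdGaussian E)) := by
        refine Finset.sum_congr rfl fun i _ => ?_
        rw [key i, integral_add (ig.const_mul _) (int2 i), integral_const_mul]
    _ = _ := by
        rw [Finset.sum_add_distrib, ← Finset.sum_mul, ← integral_finsetSum _ fun i _ => int2 i]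
        congr 1
        · rw [LinearMap.trace_eq_sum_inner _ b]; rfl
        · refine integral_congr_ae (ae_of_all _ fun x => ?_)
          simp only
          conv_rhs => rw [← b.sum_repr' (B x), map_sum]
          simp

/-- The centred quadratic form `(⟪A x, x⟫ - tr A) / 2`. -/
noncomputable def centredForm (A : E →L[ℝ] E) (x : E) : ℝ :=
  (⟪A x, x⟫ - LinearMap.trace ℝ E A) / 2

@[fun_prop]
lemma contDiff_centredForm (A : E →L[ℝ] E) : ContDiff ℝ ∞ (centredForm A) := by
  exact ((A.contDiff.inner ℝ contDiff_id).sub contDiff_const).div_const 2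

lemma continuous_centredForm (A : E →L[ℝ] E) : Continuous (centredForm A) :=
  (contDiff_centredForm A).continuous

lemma exists_centredForm_bound (A : E →L[ℝ] E) :
    ∃ C, 0 ≤ C ∧ ∀ x, |centredForm A x| ≤ C * (1 + ‖x‖) ^ 2 := by
  refine ⟨‖A‖ + |LinearMap.trace ℝ E A|, by positivity, fun x => ?_⟩
  have h1 : |⟪A x, x⟫| ≤ ‖A‖ * ‖x‖ ^ 2 := by
    refine (abs_real_inner_le_norm _ _).trans ?_
    rw [pow_two, ← mul_assoc]
    gcongr
    exact A.le_opNorm x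
  have h2 : ‖x‖ ^ 2 ≤ (1 + ‖x‖) ^ 2 := by gcongr; linarith
  have h3 : 1 ≤ (1 + ‖x‖) ^ 2 := one_le_pow₀ (by linarith [norm_nonneg x])
  unfold centredForm
  rw [abs_div, abs_two]
  have := abs_sub (⟪A x, x⟫) (LinearMap.trace ℝ E A)
  have h4 : ‖A‖ * ‖x‖ ^ 2 ≤ ‖A‖ * (1 + ‖x‖) ^ 2 := by gcongr
  have h5 := le_mul_of_one_le_right (abs_nonneg (LinearMap.trace ℝ E A)) h3
  rw [add_mul]
  have : 0 ≤ ‖A‖ * (1 + ‖x‖) ^ 2 := by positivity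
  linarith [abs_nonneg (LinearMap.trace ℝ E A)]

lemma hasFDerivAt_centredForm {A : E →L[ℝ] E} (hA : ∀ x y, ⟪A x, y⟫ = ⟪x, A y⟫) (x : E) :
    HasFDerivAt (centredForm A) (innerSL ℝ (A x)) x := by
  have h := ((A.hasFDerivAt (x := x)).inner ℝ (hasFDerivAt_id x))
  have h2 := (h.sub_const (LinearMap.trace ℝ E A)).mul_const (1 / 2 : ℝ)
  have h3 : HasFDerivAt (centredForm A) _ x := h2.congr_of_eventuallyEq
    (Eventually.of_forall fun y => by simp [centredForm, div_eq_mul_inv])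
  convert! h3 using 1
  ext v
  simp only [innerSL_apply_apply, _root_.smul_apply, ContinuousLinearMap.comp_apply,
    ContinuousLinearMap.prod_apply, fderivInnerCLM_apply, smul_eq_mul,
    ContinuousLinearMap.id_apply, id]
  rw [hA v x, real_inner_comm v (A x)]
  ring

/-- The trace term in the integration by parts is exactly what the centring removes, so only the
derivative of `g` survives. -/
lemma integral_centredForm_mul {A : E →L[ℝ] E} {g : E → ℝ} (hg : ContDiff ℝ 1 g) {C : ℝ} {m : ℕ}
    (h0 : ∀ x, |g x| ≤ C * (1 + ‖x‖) ^ m) (h1 : ∀ x, ‖fderiv ℝ g x‖ ≤ C * (1 + ‖x‖) ^ m) :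
    ∫ x, centredForm A x * g x ∂(stdGaussian E) =
      1 / 2 * ∫ x, fderiv ℝ g x (A x) ∂(stdGaussian E) := by
  have ig : Integrable g (stdGaussian E) :=
    integrable_of_polynomial_bound hg.continuous.aestronglyMeasurable h0
  have ig2 : Integrable (fun x => ⟪A x, x⟫ * g x) (stdGaussian E) := by
    have hgc := hg.continuous
    refine integrable_of_polynomial_bound (C := ‖A‖ * C) (m := m + 2) (by fun_prop) fun x => ?_
    rw [abs_mul]
    have h2 := (abs_nonneg _).trans (h0 x)
    calc _ ≤ (‖A‖ * (1 + ‖x‖) ^ 2) * (C * (1 + ‖x‖) ^ m) := by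
          gcongr
          · refine (abs_real_inner_le_norm _ _).trans ?_
            rw [pow_two, ← mul_assoc]
            gcongr
            · exact (A.le_opNorm x).trans (by gcongr; linarith)
            · linarith
          · exact h0 x
      _ = _ := by ring
  have h := integral_quadratic_mul_stdGaussian hg h0 h1 A
  have h2 : ∀ x, centredForm A x * g x =
      1 / 2 * (⟪A x, x⟫ * g x) - 1 / 2 * (LinearMap.trace ℝ E A * g x) := by
    intro x; unfold centredForm; ring
  simp_rw [h2]
  rw [integral_sub (ig2.const_mul _) ((ig.const_mul _).const_mul _), integral_const_mul,
    integral_const_mul, integral_const_mul, h]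
  ring

lemma integral_centredForm (A : E →L[ℝ] E) : ∫ x, centredForm A x ∂(stdGaussian E) = 0 := by
  have := integral_centredForm_mul (A := A) (g := fun _ => 1) contDiff_const (C := 1) (m := 0)
    (by simp) (by simp)
  simpa using this

lemma exists_polynomial_bound_innerSL (A : E →L[ℝ] E) (x : E) : ‖innerSL ℝ (A x)‖ ≤ ‖A‖ * ‖x‖ := by
  rw [innerSL_apply_norm]; exact A.le_opNorm x

/-- Integrating by parts replaces `‖Ax‖²` by half its derivative along `Ax`, which is `⟪A³x, x⟫` by
symmetry; the mean of that form is its trace. -/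
lemma integral_centredForm_mul_norm_sq {A : E →L[ℝ] E} (hA : ∀ x y, ⟪A x, y⟫ = ⟪x, A y⟫) :
    ∫ x, centredForm A x * ‖A x‖ ^ 2 ∂(stdGaussian E) =
      LinearMap.trace ℝ E (A * A * A : E →L[ℝ] E) := by
  have hd : ∀ x, HasFDerivAt (fun x => ‖A x‖ ^ 2) ((2 • innerSL ℝ (A x)).comp A) x := fun x =>
    ((hasStrictFDerivAt_norm_sq (A x)).hasFDerivAt).comp x A.hasFDerivAt
  have hc : ContDiff ℝ 1 fun x => ‖A x‖ ^ 2 := A.contDiff.norm_sq ℝ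
  have hbd : ∀ x : E, ‖A‖ * ‖x‖ ≤ ‖A‖ * (1 + ‖x‖) := fun x => by gcongr; linarith
  have h1 : ∀ x : E, 1 ≤ 1 + ‖x‖ := fun x => by linarith [norm_nonneg x]
  rw [integral_centredForm_mul hc (C := 2 * (‖A‖ * ‖A‖)) (m := 2)]
  · have h2 : ∀ x, fderiv ℝ (fun x => ‖A x‖ ^ 2) x (A x) = 2 * (⟪(A * A * A) x, x⟫ * 1) := by
      intro x
      rw [(hd x).fderiv]
      simp only [ContinuousLinearMap.comp_apply, _root_.smul_apply, innerSL_apply_apply,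
        nsmul_eq_mul, mul_apply_eq_comp]
      rw [hA (A (A x)) x, real_inner_comm]
      simp
    simp_rw [h2]
    rw [integral_const_mul, integral_quadratic_mul_stdGaussian (g := fun _ => 1) contDiff_const
      (C := 1) (m := 0) (by simp) (by simp)]
    simp
  · intro x
    rw [abs_of_nonneg (by positivity)]
    calc ‖A x‖ ^ 2 ≤ (‖A‖ * (1 + ‖x‖)) ^ 2 := by
          gcongr; exact (A.le_opNorm x).trans (hbd x)
      _ = 1 * (‖A‖ * ‖A‖) * (1 + ‖x‖) ^ 2 := by ring
      _ ≤ _ := by gcongr; norm_num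
  · intro x
    rw [(hd x).fderiv]
    calc _ ≤ ‖2 • innerSL ℝ (A x)‖ * ‖A‖ := ContinuousLinearMap.opNorm_comp_le _ _
      _ ≤ (2 * (‖A‖ * (1 + ‖x‖))) * ‖A‖ := by
          gcongr
          refine (norm_nsmul_le).trans ?_
          push_cast
          gcongr
          exact (exists_polynomial_bound_innerSL A x).trans (hbd x)
      _ = 2 * (‖A‖ * ‖A‖) * (1 + ‖x‖) := by ring
      _ ≤ _ := by
        gcongr
        exact le_self_pow₀ (h1 x) (by norm_num)

/-- Peel off one factor by integration by parts: the gradient of the form is `Ax`, so `E q³ = E q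
‖Ax‖²`, which is the preceding moment. -/
lemma integral_centredForm_pow_three {A : E →L[ℝ] E} (hA : ∀ x y, ⟪A x, y⟫ = ⟪x, A y⟫) :
    ∫ x, centredForm A x ^ 3 ∂(stdGaussian E) = LinearMap.trace ℝ E (A * A * A : E →L[ℝ] E) := by
  obtain ⟨C, hC, hb⟩ := exists_centredForm_bound A
  have hd : ∀ x, HasFDerivAt (fun x => centredForm A x ^ 2)
      ((2 * centredForm A x) • innerSL ℝ (A x)) x := fun x => by
    simpa using (hasFDerivAt_centredForm hA x).pow 2
  have hc : ContDiff ℝ 1 fun x => centredForm A x ^ 2 :=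
    ((contDiff_centredForm A).of_le (by exact_mod_cast le_top)).pow 2
  rw [← integral_centredForm_mul_norm_sq hA]
  calc ∫ x, centredForm A x ^ 3 ∂(stdGaussian E)
      = ∫ x, centredForm A x * centredForm A x ^ 2 ∂(stdGaussian E) := by
        congr 1; ext x; ring
    _ = 1 / 2 * ∫ x, fderiv ℝ (fun x => centredForm A x ^ 2) x (A x) ∂(stdGaussian E) := by
        refine integral_centredForm_mul hc (C := C ^ 2 + 2 * C * ‖A‖) (m := 4) ?_ ?_
        · intro x
          rw [abs_pow]
          calc _ ≤ (C * (1 + ‖x‖) ^ 2) ^ 2 := by gcongr; exact hb x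
            _ = C ^ 2 * (1 + ‖x‖) ^ 4 := by ring
            _ ≤ _ := by gcongr; simp; positivity
        · intro x
          rw [(hd x).fderiv, norm_smul, Real.norm_eq_abs, abs_mul, abs_two]
          have h1 : 1 ≤ 1 + ‖x‖ := by linarith [norm_nonneg x]
          calc _ ≤ (2 * (C * (1 + ‖x‖) ^ 2)) * (‖A‖ * (1 + ‖x‖) ^ 2) := by
                gcongr
                · exact hb x
                · refine (exists_polynomial_bound_innerSL A x).trans ?_
                  gcongr
                  nlinarith [norm_nonneg x]
            _ = (2 * C * ‖A‖) * (1 + ‖x‖) ^ 4 := by ring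
            _ ≤ _ := by gcongr; simp; positivity
    _ = _ := by
        rw [← integral_const_mul]
        congr 1; ext x
        rw [(hd x).fderiv]
        simp only [_root_.smul_apply, innerSL_apply_apply, smul_eq_mul, real_inner_self_eq_norm_sq]
        ring

lemma integral_inner_stdGaussian (a : E) : ∫ x, ⟪x, a⟫ ∂(stdGaussian E) = 0 := by
  have := integral_stdGaussian_neg (fun x : E => ⟪x, a⟫)
  simp only [inner_neg_left, integral_neg] at this
  linarith

lemma integral_inner_pow_three_stdGaussian (a : E) : ∫ x, ⟪x, a⟫ ^ 3 ∂(stdGaussian E) = 0 := by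
  have := integral_stdGaussian_neg (fun x : E => ⟪x, a⟫ ^ 3)
  simp only [inner_neg_left, Odd.neg_pow (show Odd 3 by decide), integral_neg] at this
  linarith

lemma integral_inner_sq_stdGaussian (a : E) : ∫ x, ⟪x, a⟫ ^ 2 ∂(stdGaussian E) = ‖a‖ ^ 2 := by
  have h := integral_inner_mul_stdGaussian (E := E) (g := fun x => ⟪a, x⟫)
    (contDiff_const.inner ℝ contDiff_id) (C := ‖a‖) (m := 1) ?_ ?_ a
  · have h2 : ∀ x, fderiv ℝ (fun x => ⟪a, x⟫) x a = ‖a‖ ^ 2 := fun x => by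
      have : HasFDerivAt (fun x => ⟪a, x⟫) (innerSL ℝ a) x := (innerSL ℝ a).hasFDerivAt
      rw [this.fderiv]; simp
    simp_rw [h2] at h
    rw [integral_const] at h
    simp only [probReal_univ, one_smul] at h
    rw [← h]
    congr 1; ext x; rw [real_inner_comm]; ring
  · intro x
    refine (abs_real_inner_le_norm _ _).trans ?_
    gcongr; simp
  · intro x
    have : HasFDerivAt (fun x => ⟪a, x⟫) (innerSL ℝ a) x := (innerSL ℝ a).hasFDerivAt
    rw [this.fderiv, innerSL_apply_norm]
    nlinarith [norm_nonneg x, norm_nonneg a]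

/-- The third moment of `⟪ξ, A η⟫ + (⟪A η, η⟫ - tr A) / 2` for independent `ξ`, `η`. -/
lemma integral_prod_pow_three {A : E →L[ℝ] E} (hA : ∀ x y, ⟪A x, y⟫ = ⟪x, A y⟫) :
    ∫ r : E × E, (⟪r.1, A r.2⟫ + centredForm A r.2) ^ 3 ∂((stdGaussian E).prod (stdGaussian E)) =
      4 * LinearMap.trace ℝ E (A * A * A : E →L[ℝ] E) := by
  obtain ⟨C, hC, hb⟩ := exists_centredForm_bound A
  have hq := continuous_centredForm A
  have hpi : ∀ m : ℕ, Integrable (fun r : E × E => (1 + ‖r.1‖) ^ m * (1 + ‖r.2‖) ^ m)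
      ((stdGaussian E).prod (stdGaussian E)) := fun m =>
    (integrable_one_add_norm_pow m).mul_prod (integrable_one_add_norm_pow m)
  have hint : Integrable (fun r : E × E => (⟪r.1, A r.2⟫ + centredForm A r.2) ^ 3)
      ((stdGaussian E).prod (stdGaussian E)) := by
    refine ((hpi 6).const_mul ((‖A‖ + C) ^ 3)).mono' (by fun_prop) (ae_of_all _ fun r => ?_)
    have hx : 1 ≤ 1 + ‖r.1‖ := by linarith [norm_nonneg r.1]
    have hy : 1 ≤ 1 + ‖r.2‖ := by linarith [norm_nonneg r.2]
    rw [Real.norm_eq_abs, abs_pow]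
    have h1 : |⟪r.1, A r.2⟫ + centredForm A r.2| ≤
        (‖A‖ + C) * ((1 + ‖r.1‖) ^ 2 * (1 + ‖r.2‖) ^ 2) := by
      refine (abs_add_le _ _).trans ?_
      rw [add_mul]
      gcongr
      · refine (abs_real_inner_le_norm _ _).trans ?_
        calc ‖r.1‖ * ‖A r.2‖ ≤ (1 + ‖r.1‖) ^ 2 * (‖A‖ * (1 + ‖r.2‖) ^ 2) := by
              gcongr
              · nlinarith [norm_nonneg r.1]
              · refine (A.le_opNorm _).trans ?_
                gcongr
                nlinarith [norm_nonneg r.2]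
          _ = _ := by ring
      · refine (hb r.2).trans ?_
        gcongr
        exact le_mul_of_one_le_left (by positivity) (one_le_pow₀ hx)
    calc _ ≤ ((‖A‖ + C) * ((1 + ‖r.1‖) ^ 2 * (1 + ‖r.2‖) ^ 2)) ^ 3 := by gcongr
      _ = _ := by ring
  rw [integral_prod_symm _ hint]
  -- For fixed `y` the variable `⟪x, A y⟫` is centred with variance `‖A y‖²` and zero third moment.
  -- The two remaining terms contribute `tr A³` and `3 tr A³`, hence the factor `4`.
  have inner_eq : ∀ y : E, ∫ x, (⟪x, A y⟫ + centredForm A y) ^ 3 ∂(stdGaussian E) =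
      centredForm A y ^ 3 + 3 * (centredForm A y * ‖A y‖ ^ 2) := by
    intro y
    have hi : ∀ k : ℕ, Integrable (fun x => ⟪x, A y⟫ ^ k) (stdGaussian E) := fun k => by
      refine integrable_of_polynomial_bound (C := ‖A y‖ ^ k) (m := k) (by fun_prop) fun x => ?_
      rw [abs_pow, ← mul_pow]
      gcongr
      refine (abs_real_inner_le_norm _ _).trans ?_
      nlinarith [norm_nonneg x, norm_nonneg (A y)]
    have h3 : ∀ x, (⟪x, A y⟫ + centredForm A y) ^ 3 = ⟪x, A y⟫ ^ 3 +
        3 * centredForm A y * ⟪x, A y⟫ ^ 2 + 3 * centredForm A y ^ 2 * ⟪x, A y⟫ +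
        centredForm A y ^ 3 := fun x => by ring
    have i1 : Integrable (fun x => ⟪x, A y⟫) (stdGaussian E) := by simpa using hi 1
    simp_rw [h3]
    rw [integral_add (by exact ((hi 3).add ((hi 2).const_mul _)).add (i1.const_mul _))
        (integrable_const _),
      integral_add (by exact (hi 3).add ((hi 2).const_mul _)) (i1.const_mul _),
      integral_add (hi 3) ((hi 2).const_mul _), integral_const_mul, integral_const_mul,
      integral_inner_pow_three_stdGaussian, integral_inner_sq_stdGaussian,
      integral_inner_stdGaussian]
    simp
    ring
  simp_rw [inner_eq]
  have j1 : Integrable (fun y => centredForm A y ^ 3) (stdGaussian E) := by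
    refine integrable_of_polynomial_bound (C := C ^ 3) (m := 6) (by fun_prop) fun x => ?_
    rw [abs_pow]
    calc _ ≤ (C * (1 + ‖x‖) ^ 2) ^ 3 := by gcongr; exact hb x
      _ = _ := by ring
  have j2 : Integrable (fun y => centredForm A y * ‖A y‖ ^ 2) (stdGaussian E) := by
    refine integrable_of_polynomial_bound (C := C * ‖A‖ ^ 2) (m := 4) (by fun_prop) fun x => ?_
    rw [abs_mul, abs_of_nonneg (sq_nonneg ‖A x‖)]
    calc _ ≤ (C * (1 + ‖x‖) ^ 2) * (‖A‖ * (1 + ‖x‖)) ^ 2 := by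
          gcongr
          · exact hb x
          · exact (A.le_opNorm x).trans (by gcongr; linarith)
      _ = _ := by ring
  rw [integral_add j1 (j2.const_mul _), integral_const_mul, integral_centredForm_pow_three hA,
    integral_centredForm_mul_norm_sq hA]
  ring

end QuadraticForm

end TwoKernel

namespace TwoKernel

/-! ### The error function `p`: Lipschitz bounds, cubic expansion, numerical bounds. -/

section GaussPrimitive

/-- The primitive `∫₀ʷ exp (-u² / 2) du`. -/
noncomputable def gaussPrimitive (w : ℝ) : ℝ := ∫ u in (0 : ℝ)..w, Real.exp (-u ^ 2 / 2)

lemma hasDerivAt_gaussPrimitive (w : ℝ) :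
    HasDerivAt gaussPrimitive (Real.exp (-w ^ 2 / 2)) w := by
  have hc : Continuous fun u : ℝ => Real.exp (-u ^ 2 / 2) := by fun_prop
  exact intervalIntegral.integral_hasDerivAt_right (hc.intervalIntegrable _ _)
    (hc.stronglyMeasurableAtFilter _ _) hc.continuousAt

lemma differentiable_gaussPrimitive : Differentiable ℝ gaussPrimitive := fun w =>
  (hasDerivAt_gaussPrimitive w).differentiableAt

@[fun_prop]
lemma continuous_gaussPrimitive : Continuous gaussPrimitive :=
  differentiable_gaussPrimitive.continuous

@[simp] lemma gaussPrimitive_zero : gaussPrimitive 0 = 0 := by simp [gaussPrimitive]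

lemma gaussPrimitive_neg (w : ℝ) : gaussPrimitive (-w) = -gaussPrimitive w := by
  unfold gaussPrimitive
  have h := intervalIntegral.integral_comp_neg (a := 0) (b := w)
    (f := fun u : ℝ => Real.exp (-u ^ 2 / 2))
  simp only [neg_sq, neg_zero] at h
  rw [h, intervalIntegral.integral_symm]

lemma strictMono_gaussPrimitive : StrictMono gaussPrimitive :=
  strictMono_of_deriv_pos fun w => by
    rw [(hasDerivAt_gaussPrimitive w).deriv]; positivity

lemma gaussPrimitive_sub_le {a b : ℝ} (hab : a ≤ b) :
    gaussPrimitive b - gaussPrimitive a ≤ b - a := by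
  have h := Convex.image_sub_le_mul_sub_of_deriv_le (D := univ) convex_univ
    continuous_gaussPrimitive.continuousOn differentiable_gaussPrimitive.differentiableOn
    (C := 1) (fun w _ => by
      rw [(hasDerivAt_gaussPrimitive w).deriv]
      exact Real.exp_le_one_iff.2 (by nlinarith [sq_nonneg w])) a trivial b trivial hab
  linarith

lemma abs_gaussPrimitive_sub_le (a b : ℝ) :
    |gaussPrimitive a - gaussPrimitive b| ≤ |a - b| := by
  rcases le_total a b with h | h
  · rw [abs_sub_comm, abs_sub_comm a b,
      abs_of_nonneg (sub_nonneg.2 (strictMono_gaussPrimitive.monotone h)),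
      abs_of_nonneg (sub_nonneg.2 h)]
    exact gaussPrimitive_sub_le h
  · rw [abs_of_nonneg (sub_nonneg.2 (strictMono_gaussPrimitive.monotone h)),
      abs_of_nonneg (sub_nonneg.2 h)]
    exact gaussPrimitive_sub_le h

lemma le_gaussPrimitive_sub {R a b : ℝ} (hab : a ≤ b) (ha : -R ≤ a) (hb : b ≤ R) :
    Real.exp (-R ^ 2 / 2) * (b - a) ≤ gaussPrimitive b - gaussPrimitive a := by
  refine Convex.mul_sub_le_image_sub_of_le_deriv (D := Icc (-R) R) (convex_Icc _ _)
    continuous_gaussPrimitive.continuousOn differentiable_gaussPrimitive.differentiableOn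
    (fun w hw => ?_) a ⟨ha, by linarith⟩ b ⟨by linarith, hb⟩ hab
  rw [interior_Icc] at hw
  rw [(hasDerivAt_gaussPrimitive w).deriv]
  have := sq_le_sq' hw.1.le hw.2.le
  exact Real.exp_le_exp.2 (by linarith)

lemma sub_le_gaussPrimitive {w : ℝ} (hw : 0 ≤ w) : w - w ^ 3 / 6 ≤ gaussPrimitive w := by
  have : ∫ u in (0 : ℝ)..w, (1 - u ^ 2 / 2) = w - w ^ 3 / 6 := by
    rw [intervalIntegral.integral_sub (by simp) (by
      exact Continuous.intervalIntegrable (by fun_prop) _ _), intervalIntegral.integral_div]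
    simp [integral_pow]; ring
  rw [← this]
  refine intervalIntegral.integral_mono_on hw (Continuous.intervalIntegrable (by fun_prop) _ _)
    (Continuous.intervalIntegrable (by fun_prop) _ _) fun u _ => ?_
  have := Real.add_one_le_exp (-u ^ 2 / 2)
  linarith

lemma gaussPrimitive_le {w : ℝ} (hw : 0 ≤ w) :
    gaussPrimitive w ≤ w - w ^ 3 / 6 + w ^ 5 / 40 := by
  have : ∫ u in (0 : ℝ)..w, (1 - u ^ 2 / 2 + u ^ 4 / 8) = w - w ^ 3 / 6 + w ^ 5 / 40 := by
    rw [intervalIntegral.integral_add (Continuous.intervalIntegrable (by fun_prop) _ _)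
      (Continuous.intervalIntegrable (by fun_prop) _ _),
      intervalIntegral.integral_sub (by simp) (by
      exact Continuous.intervalIntegrable (by fun_prop) _ _), intervalIntegral.integral_div,
      intervalIntegral.integral_div]
    simp [integral_pow]; ring
  rw [← this]
  refine intervalIntegral.integral_mono_on hw (Continuous.intervalIntegrable (by fun_prop) _ _)
    (Continuous.intervalIntegrable (by fun_prop) _ _) fun u _ => ?_
  have h := Real.quadratic_le_exp_of_nonneg (x := u ^ 2 / 2) (by positivity)
  have h2 : Real.exp (-u ^ 2 / 2) * Real.exp (u ^ 2 / 2) = 1 := by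
    rw [← Real.exp_add]; simp [neg_div]
  have h3 := Real.exp_pos (-u ^ 2 / 2)
  -- With `v = u²/2`, the upper bound `exp(-v) ≤ 1 - v + v²/2` follows from `exp v ≥ 1 + v + v²/2`,
  -- because `(1 - v + v²/2)(1 + v + v²/2) = 1 + v⁴/4`.
  have h4 : 1 ≤ (1 - u ^ 2 / 2 + u ^ 4 / 8) * Real.exp (u ^ 2 / 2) := by
    have h5 : 0 ≤ 1 - u ^ 2 / 2 + u ^ 4 / 8 := by nlinarith [sq_nonneg (u ^ 2 - 2)]
    have h6 := mul_le_mul_of_nonneg_left h h5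
    refine le_trans ?_ h6
    nlinarith [pow_nonneg (sq_nonneg u) 4, sq_nonneg (u ^ 4)]
  have h7 := mul_le_mul_of_nonneg_left h4 h3.le
  calc Real.exp (-u ^ 2 / 2) = Real.exp (-u ^ 2 / 2) * 1 := (mul_one _).symm
    _ ≤ _ := h7
    _ = (1 - u ^ 2 / 2 + u ^ 4 / 8) * (Real.exp (-u ^ 2 / 2) * Real.exp (u ^ 2 / 2)) := by ring
    _ = _ := by rw [h2, mul_one]

lemma abs_gaussPrimitive_sub_cubic_le (w : ℝ) :
    |gaussPrimitive w - (w - w ^ 3 / 6)| ≤ |w| ^ 5 / 40 := by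
  have pos : ∀ v : ℝ, 0 ≤ v → |gaussPrimitive v - (v - v ^ 3 / 6)| ≤ |v| ^ 5 / 40 := by
    intro v hv
    have h1 := sub_le_gaussPrimitive hv
    have h2 := gaussPrimitive_le hv
    rw [abs_of_nonneg (by linarith), abs_of_nonneg hv]
    linarith
  rcases le_total 0 w with h | h
  · exact pos w h
  · have := pos (-w) (by linarith)
    rw [gaussPrimitive_neg, abs_neg, ← abs_neg] at this
    convert! this using 2
    ring

lemma integrable_exp_neg_sq_half : Integrable fun u : ℝ => Real.exp (-u ^ 2 / 2) := by
  have := integrable_exp_neg_mul_sq (b := 1 / 2) (by norm_num)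
  refine this.congr (ae_of_all _ fun u => ?_)
  simp only
  congr 1; ring

lemma integral_Ioi_exp_neg_sq_half :
    ∫ u in Ioi (0 : ℝ), Real.exp (-u ^ 2 / 2) = √(2 * Real.pi) / 2 := by
  have := integral_gaussian_Ioi (1 / 2)
  rw [show Real.pi / (1 / 2) = 2 * Real.pi by ring] at this
  rw [← this]
  congr 1; ext u; congr 1; ring

lemma integral_Ioi_exp_neg_sq (a : ℝ) :
    ∫ u in Ioi (-a), Real.exp (-u ^ 2 / 2) = √(2 * Real.pi) / 2 + gaussPrimitive a := by
  have h := intervalIntegral.integral_Ioi_sub_Ioi' (a := -a) (b := 0) (μ := volume)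
    (f := fun u : ℝ => Real.exp (-u ^ 2 / 2)) integrable_exp_neg_sq_half.integrableOn
    integrable_exp_neg_sq_half.integrableOn
  rw [integral_Ioi_exp_neg_sq_half, intervalIntegral.integral_symm] at h
  have : gaussPrimitive (-a) = ∫ u in (0 : ℝ)..(-a), Real.exp (-u ^ 2 / 2) := rfl
  rw [← this, gaussPrimitive_neg] at h
  linarith

/-- Half the total mass plus `p(a)` is the integral of a positive function over `(-a, ∞)`; apply
this at `w` and `-w`. -/
lemma abs_gaussPrimitive_le (w : ℝ) : |gaussPrimitive w| ≤ √(2 * Real.pi) / 2 := by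
  have h : ∀ a, 0 ≤ √(2 * Real.pi) / 2 + gaussPrimitive a := fun a => by
    rw [← integral_Ioi_exp_neg_sq]
    exact setIntegral_nonneg measurableSet_Ioi fun u _ => (Real.exp_pos _).le
  rw [abs_le]
  have h1 := h w
  have h2 := h (-w)
  rw [gaussPrimitive_neg] at h2
  constructor <;> linarith

lemma sqrt_two_pi_half_lt : √(2 * Real.pi) / 2 < 1.2535 := by
  have : √(2 * Real.pi) < 2.507 := by
    rw [Real.sqrt_lt' (by norm_num)]
    nlinarith [Real.pi_lt_d4]
  linarith

lemma abs_gaussPrimitive_le_two (w : ℝ) : |gaussPrimitive w| ≤ 2 := by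
  linarith [abs_gaussPrimitive_le w, sqrt_two_pi_half_lt]

lemma tendsto_gaussPrimitive_atTop :
    Tendsto gaussPrimitive atTop (𝓝 (√(2 * Real.pi) / 2)) := by
  rw [← integral_Ioi_exp_neg_sq_half]
  exact intervalIntegral_tendsto_integral_Ioi 0 integrable_exp_neg_sq_half.integrableOn tendsto_id

lemma tendsto_gaussPrimitive_atBot :
    Tendsto gaussPrimitive atBot (𝓝 (-(√(2 * Real.pi) / 2))) := by
  have := (tendsto_gaussPrimitive_atTop.comp tendsto_neg_atBot_atTop).neg
  refine this.congr fun w => ?_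
  simp [gaussPrimitive_neg]

lemma sqrt_two_bounds : (1.4142 : ℝ) < √2 ∧ √2 < 1.4143 := by
  constructor
  · exact Real.lt_sqrt_of_sq_lt (by norm_num)
  · rw [Real.sqrt_lt' (by norm_num)]; norm_num

/-- The profile `√2 p(σ) - p(σ/√2)` is bounded below away from the transition region. -/
lemma le_profile {σ : ℝ} (hσ : 1.15 ≤ σ) :
    0.01 ≤ √2 * gaussPrimitive σ - gaussPrimitive (σ / √2) := by
  -- Monotonicity and the cubic lower bound at `1.15`. The subtracted term is bounded only by its
  -- limit `√(2π)/2 < 1.2535`, and `1.4142 · 0.896 > 1.2535 + 0.01`.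
  have h1 : (0.896 : ℝ) ≤ gaussPrimitive σ := by
    refine le_trans ?_ (strictMono_gaussPrimitive.monotone hσ)
    refine le_trans ?_ (sub_le_gaussPrimitive (by norm_num))
    norm_num
  have h2 := (le_abs_self _).trans (abs_gaussPrimitive_le (σ / √2))
  have h3 := sqrt_two_pi_half_lt
  have h4 := sqrt_two_bounds.1
  nlinarith

end GaussPrimitive

end TwoKernel

namespace TwoKernel

open ProbabilityTheory
open scoped RealInnerProductSpace

/-! ### Convolutions of subgraphs as Gaussian means, and the sets produced by the scheme. -/

section Heat

variable {n : ℕ}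

/-- The Gaussian average of `p((φ(x + a ξ) - s) / a)`, where `p` is `gaussPrimitive`. It is the
convolution of the subgraph of `φ` with the heat kernel of variance `a²`, up to normalisation. -/
noncomputable def erfMean (φ : Base n → ℝ) (a : ℝ) (x : Base n) (s : ℝ) : ℝ :=
  ∫ ξ, gaussPrimitive ((φ (x + a • ξ) - s) / a) ∂(stdGaussian (Base n))

/-- The heat kernel at time `τ` has variance `2τ = a²` in each coordinate. Splitting off the
vertical factor prepares Fubini. -/
lemma gaussian_eq {τ a : ℝ} (ha : 0 < a) (haτ : a ^ 2 = 2 * τ) (y : Base n) (v : ℝ) :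
    gaussian n τ (y, v) = (a ^ n)⁻¹ * stdDensity (Base n) (a⁻¹ • y) *
      (a⁻¹ * (√(2 * Real.pi))⁻¹ * Real.exp (-(v / a) ^ 2 / 2)) := by
  have h4 : 4 * Real.pi * τ = (2 * Real.pi) * a ^ 2 := by rw [haτ]; ring
  have hτ : 0 < τ := by nlinarith [sq_pos_of_pos ha]
  unfold gaussian stdDensity
  rw [h4, Real.mul_rpow (by positivity) (by positivity)]
  have e1 : (2 * Real.pi) ^ (-((n : ℝ) + 1) / 2) =
      (2 * Real.pi) ^ (-(Module.finrank ℝ (Base n) : ℝ) / 2) * (√(2 * Real.pi))⁻¹ := by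
    rw [Real.sqrt_eq_rpow, ← Real.rpow_neg (by positivity), ← Real.rpow_add (by positivity)]
    congr 1
    simp
    ring
  have e2 : (a ^ 2) ^ (-((n : ℝ) + 1) / 2) = (a ^ n)⁻¹ * a⁻¹ := by
    rw [← Real.rpow_natCast a 2, ← Real.rpow_mul ha.le, ← Real.rpow_natCast a n,
      ← Real.rpow_neg ha.le, ← Real.rpow_neg_one a, ← Real.rpow_add ha]
    congr 1
    push_cast
    ring
  have e3 : Real.exp (-(‖y‖ ^ 2 + v ^ 2) / (4 * τ)) =
      Real.exp (-‖a⁻¹ • y‖ ^ 2 / 2) * Real.exp (-(v / a) ^ 2 / 2) := by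
    rw [← Real.exp_add, norm_smul, Real.norm_eq_abs, abs_of_pos (by positivity)]
    congr 1
    have : τ = a ^ 2 / 2 := by linarith
    rw [this]
    field_simp
    ring
  rw [e1, e2, e3]
  ring

lemma integrable_gaussian {τ : ℝ} (hτ : 0 < τ) :
    Integrable (gaussian n τ) ((volume : Measure (Base n)).prod (volume : Measure ℝ)) := by
  have ha : 0 < √(2 * τ) := by positivity
  have haτ : √(2 * τ) ^ 2 = 2 * τ := Real.sq_sqrt (by positivity)
  have h1 : Integrable fun y : Base n => (√(2 * τ) ^ n)⁻¹ * stdDensity (Base n) ((√(2 * τ))⁻¹ • y) :=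
    (integrable_stdDensity.comp_smul (inv_ne_zero ha.ne')).const_mul _
  have h2 : Integrable fun v : ℝ => ((√(2 * τ))⁻¹ * (√(2 * Real.pi))⁻¹ *
      Real.exp (-(v / √(2 * τ)) ^ 2 / 2)) :=
    (integrable_exp_neg_sq_half.comp_div ha.ne').const_mul _
  refine (h1.mul_prod h2).congr (ae_of_all _ fun q => ?_)
  exact (gaussian_eq ha haτ q.1 q.2).symm

lemma measurableSet_subgraph {φ : Base n → ℝ} (hφ : Continuous φ) : MeasurableSet (subgraph φ) :=
  measurableSet_le measurable_snd (hφ.measurable.comp measurable_fst)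

/-- Vertical fibres of a subgraph are half-lines, so the vertical integral is a Gaussian tail, that
is `1/2` plus a multiple of `p`. Rescaling the horizontal variable by `a` leaves the standard
Gaussian mean. -/
lemma heat_subgraph {φ : Base n → ℝ} (hφ : Continuous φ) {τ a : ℝ} (ha : 0 < a)
    (haτ : a ^ 2 = 2 * τ) (x : Base n) (s : ℝ) :
    heat τ (subgraph φ) (x, s) = 1 / 2 + (√(2 * Real.pi))⁻¹ * erfMean φ a x s := by
  have hτ : 0 < τ := by nlinarith [sq_pos_of_pos ha]
  have hpi : 0 < √(2 * Real.pi) := by positivity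
  have hint : Integrable (fun q : Base n × ℝ => gaussian n τ q *
      (subgraph φ).indicator (fun _ => (1 : ℝ)) ((x, s) - q))
      ((volume : Measure (Base n)).prod (volume : Measure ℝ)) := by
    refine (integrable_gaussian hτ).mul_bdd (c := 1) ?_ (ae_of_all _ fun q => ?_)
    · exact ((measurable_const.indicator (measurableSet_subgraph hφ)).comp
        (measurable_const.sub measurable_id)).aestronglyMeasurable
    · refine (norm_indicator_le_norm_self _ _).trans ?_
      simp
  have inner_eq : ∀ y : Base n, ∫ v : ℝ, (a⁻¹ * (√(2 * Real.pi))⁻¹ * Real.exp (-(v / a) ^ 2 / 2)) *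
      (subgraph φ).indicator (fun _ => (1 : ℝ)) ((x, s) - (y, v)) =
      1 / 2 + (√(2 * Real.pi))⁻¹ * gaussPrimitive ((φ (x - y) - s) / a) := by
    intro y
    have h1 : ∀ v : ℝ, (a⁻¹ * (√(2 * Real.pi))⁻¹ * Real.exp (-(v / a) ^ 2 / 2)) *
        (subgraph φ).indicator (fun _ => (1 : ℝ)) ((x, s) - (y, v)) =
        a⁻¹ * (√(2 * Real.pi))⁻¹ * (Ici (-((φ (x - y) - s) / a))).indicator
          (fun u => Real.exp (-u ^ 2 / 2)) (v / a) := by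
      intro v
      by_cases hv : s - v ≤ φ (x - y)
      · rw [indicator_of_mem (by exact hv), indicator_of_mem, mul_one]
        rw [mem_Ici, ← neg_div, div_le_div_iff_of_pos_right ha]
        linarith
      · rw [indicator_of_notMem (by exact hv), indicator_of_notMem, mul_zero, mul_zero]
        rw [mem_Ici, ← neg_div, div_le_div_iff_of_pos_right ha]
        intro h; exact hv (by linarith)
    simp_rw [h1]
    rw [integral_const_mul, Measure.integral_comp_div (fun u => (Ici (-((φ (x - y) - s) / a))).indicator
          (fun u => Real.exp (-u ^ 2 / 2)) u), integral_indicator measurableSet_Ici,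
      integral_Ici_eq_integral_Ioi, integral_Ioi_exp_neg_sq, abs_of_pos ha, smul_eq_mul]
    field_simp
  have hcont : Continuous fun y : Base n =>
      1 / 2 + (√(2 * Real.pi))⁻¹ * gaussPrimitive ((φ (x - y) - s) / a) := by fun_prop
  calc heat τ (subgraph φ) (x, s)
      = ∫ q : Base n × ℝ, gaussian n τ q * (subgraph φ).indicator (fun _ => (1 : ℝ)) ((x, s) - q)
          ∂((volume : Measure (Base n)).prod (volume : Measure ℝ)) := rfl
    _ = ∫ y : Base n, (a ^ n)⁻¹ * (stdDensity (Base n) (a⁻¹ • y) *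
          (1 / 2 + (√(2 * Real.pi))⁻¹ * gaussPrimitive ((φ (x - a • a⁻¹ • y) - s) / a))) := by
        rw [integral_prod _ hint]
        refine integral_congr_ae (ae_of_all _ fun y => ?_)
        simp only
        rw [smul_inv_smul₀ ha.ne', ← inner_eq y, ← mul_assoc, ← integral_const_mul]
        refine integral_congr_ae (ae_of_all _ fun v => ?_)
        simp only
        rw [gaussian_eq ha haτ]
        ring
    _ = ∫ y : Base n, stdDensity (Base n) y *
          (1 / 2 + (√(2 * Real.pi))⁻¹ * gaussPrimitive ((φ (x - a • y) - s) / a)) := by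
        rw [integral_const_mul, Measure.integral_comp_inv_smul volume (fun y => stdDensity (Base n) y *
          (1 / 2 + (√(2 * Real.pi))⁻¹ * gaussPrimitive ((φ (x - a • y) - s) / a))) a]
        simp only [finrank_euclideanSpace, Fintype.card_fin, smul_eq_mul]
        rw [abs_of_pos (by positivity), ← mul_assoc, inv_mul_cancel₀ (by positivity), one_mul]
    _ = _ := by
        rw [← integral_stdGaussian, ← integral_stdGaussian_neg]
        simp only [smul_neg, sub_neg_eq_add]
        have hb : Integrable (fun ξ => gaussPrimitive ((φ (x + a • ξ) - s) / a))
            (stdGaussian (Base n)) :=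
          integrable_of_polynomial_bound (C := 2) (m := 0) (by fun_prop) fun ξ => by
            simpa using abs_gaussPrimitive_le_two _
        rw [integral_add (integrable_const _) (hb.const_mul _), integral_const_mul, erfMean]
        simp

variable {φ : Base n → ℝ} {a : ℝ}

lemma integrable_erfMean (hφ : Continuous φ) (x : Base n) (s : ℝ) :
    Integrable (fun ξ => gaussPrimitive ((φ (x + a • ξ) - s) / a)) (stdGaussian (Base n)) :=
  integrable_of_polynomial_bound (C := 2) (m := 0) (by fun_prop) fun ξ => by
    simpa using abs_gaussPrimitive_le_two _

lemma continuous_erfMean (hφ : Continuous φ) :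
    Continuous fun q : Base n × ℝ => erfMean φ a q.1 q.2 := by
  unfold erfMean
  refine continuous_of_dominated (bound := fun _ => 2) (fun q => by fun_prop)
    (fun q => ae_of_all _ fun ξ => abs_gaussPrimitive_le_two _) (integrable_const _)
    (ae_of_all _ fun ξ => by fun_prop)

/-- The integrand decreases strictly at every point; a positive function has positive mean because
its support is the whole space. -/
lemma erfMean_strictAnti (hφ : Continuous φ) (ha : 0 < a) (x : Base n) :
    StrictAnti (erfMean φ a x) := by
  intro s s' hs
  rw [← sub_pos, erfMean, erfMean, ← integral_sub (integrable_erfMean hφ x s)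
    (integrable_erfMean hφ x s')]
  have hpos : ∀ ξ : Base n, 0 < gaussPrimitive ((φ (x + a • ξ) - s) / a) -
      gaussPrimitive ((φ (x + a • ξ) - s') / a) := fun ξ =>
    sub_pos.2 (strictMono_gaussPrimitive (by gcongr))
  rw [integral_pos_iff_support_of_nonneg (fun ξ => (hpos ξ).le)
    ((integrable_erfMean hφ x s).sub (integrable_erfMean hφ x s'))]
  have : (Function.support fun ξ : Base n => gaussPrimitive ((φ (x + a • ξ) - s) / a) -
      gaussPrimitive ((φ (x + a • ξ) - s') / a)) = univ :=
    eq_univ_of_forall fun ξ => (hpos ξ).ne'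
  rw [this]
  simp

lemma tendsto_erfMean_atTop (hφ : Continuous φ) (ha : 0 < a) (x : Base n) :
    Tendsto (erfMean φ a x) atTop (𝓝 (-(√(2 * Real.pi) / 2))) := by
  have : -(√(2 * Real.pi) / 2) = ∫ _ξ, -(√(2 * Real.pi) / 2) ∂(stdGaussian (Base n)) := by simp
  rw [this]
  refine tendsto_integral_filter_of_dominated_convergence (fun _ => 2)
    (Eventually.of_forall fun s => by fun_prop)
    (Eventually.of_forall fun s => ae_of_all _ fun ξ => abs_gaussPrimitive_le_two _)
    (integrable_const _) (ae_of_all _ fun ξ => tendsto_gaussPrimitive_atBot.comp ?_)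
  exact (tendsto_atBot_add_const_left _ _ tendsto_neg_atTop_atBot).atBot_div_const ha

lemma tendsto_erfMean_atBot (hφ : Continuous φ) (ha : 0 < a) (x : Base n) :
    Tendsto (erfMean φ a x) atBot (𝓝 (√(2 * Real.pi) / 2)) := by
  have : √(2 * Real.pi) / 2 = ∫ _ξ, √(2 * Real.pi) / 2 ∂(stdGaussian (Base n)) := by simp
  rw [this]
  refine tendsto_integral_filter_of_dominated_convergence (fun _ => 2)
    (Eventually.of_forall fun s => by fun_prop)
    (Eventually.of_forall fun s => ae_of_all _ fun ξ => abs_gaussPrimitive_le_two _)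
    (integrable_const _) (ae_of_all _ fun ξ => tendsto_gaussPrimitive_atTop.comp ?_)
  exact (tendsto_atTop_add_const_left _ _ tendsto_neg_atBot_atTop).atTop_div_const ha

/-- The convolution of a subgraph has a graph as its level set. -/
lemma exists_level_height (hφ : Continuous φ) (ha : 0 < a) :
    ∃ ψ : Base n → ℝ, Continuous ψ ∧ (∀ x, erfMean φ a x (ψ x) = 0) ∧
      ∀ x s, 0 ≤ erfMean φ a x s ↔ s ≤ ψ x := by
  have hc : ∀ x, Continuous fun s => erfMean φ a x s := fun x => by
    have h := (continuous_erfMean (a := a) hφ).comp (by fun_prop : Continuous fun s : ℝ => (x, s))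
    simpa only [Function.comp_def] using h
  have hπ : 0 < √(2 * Real.pi) / 2 := by positivity
  have hex : ∀ x, ∃ s, erfMean φ a x s = 0 := fun x => by
    obtain ⟨s, hs⟩ := ((tendsto_erfMean_atTop hφ ha x).eventually_lt_const
      (show -(√(2 * Real.pi) / 2) < 0 by linarith)).exists
    obtain ⟨s', hs'⟩ := ((tendsto_erfMean_atBot hφ ha x).eventually_const_lt hπ).exists
    exact mem_range_of_exists_le_of_exists_ge (hc x) ⟨s, le_of_lt hs⟩ ⟨s', le_of_lt hs'⟩
  choose ψ hψ using hex
  have hle : ∀ x s, 0 ≤ erfMean φ a x s ↔ s ≤ ψ x := fun x s => by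
    have := (erfMean_strictAnti hφ ha x).le_iff_ge (a := ψ x) (b := s)
    rwa [hψ x] at this
  have hlt : ∀ x s, 0 < erfMean φ a x s ↔ s < ψ x := fun x s => by
    have := (erfMean_strictAnti hφ ha x).lt_iff_gt (a := ψ x) (b := s)
    rwa [hψ x] at this
  have hcs : ∀ s, Continuous fun y => erfMean φ a y s := fun s => by
    have h := (continuous_erfMean (a := a) hφ).comp
      (by fun_prop : Continuous fun y : Base n => (y, s))
    simpa only [Function.comp_def] using h
  -- Continuity of the height needs no implicit function theorem: `{ψ > s}` and `{ψ < s}` are the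
  -- sets where the continuous function `erfMean φ a · s` is positive and negative.
  have hlow : LowerSemicontinuous ψ := by
    rw [lowerSemicontinuous_iff_isOpen_preimage]
    intro s
    have : ψ ⁻¹' Ioi s = {y | 0 < erfMean φ a y s} := by ext y; exact (hlt y s).symm
    exact this ▸ isOpen_lt continuous_const (hcs s)
  have hup : UpperSemicontinuous ψ := by
    rw [upperSemicontinuous_iff_isOpen_preimage]
    intro s
    have : ψ ⁻¹' Iio s = {y | erfMean φ a y s < 0} := by
      ext y
      change ψ y < s ↔ erfMean φ a y s < 0
      rw [← not_le, ← hle, not_le]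
    exact this ▸ isOpen_lt (hcs s) continuous_const
  exact ⟨ψ, continuous_iff_lower_upperSemicontinuous.2 ⟨hlow, hup⟩, hψ, hle⟩

lemma mboStep_subgraph {φ ψ : Base n → ℝ} (hφ : Continuous φ) {τ a : ℝ} (ha : 0 < a)
    (haτ : a ^ 2 = 2 * τ) (hψ : ∀ x s, 0 ≤ erfMean φ a x s ↔ s ≤ ψ x) :
    mboStep τ (subgraph φ) = subgraph ψ := by
  ext ⟨x, s⟩
  have hpi : 0 < (√(2 * Real.pi))⁻¹ := by positivity
  change heat τ (subgraph φ) (x, s) ≥ 1 / 2 ↔ s ≤ ψ x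
  rw [heat_subgraph hφ ha haτ, ← hψ, ge_iff_le, le_add_iff_nonneg_right,
    mul_nonneg_iff_of_pos_left hpi]

/-- Membership in the second step of the scheme, through the height `ψ` of the first. -/
lemma mem_twoKernelStep_subgraph {φ ψ : Base n → ℝ} (hφ : Continuous φ) (hψc : Continuous ψ)
    {t : ℝ} (ht : 0 < t) (hψ : ∀ x s, 0 ≤ erfMean φ √t x s ↔ s ≤ ψ x) (x : Base n) (s : ℝ) :
    (x, s) ∈ twoKernelStep t (subgraph φ) ↔
      0 ≤ √2 * erfMean ψ √t x s - erfMean φ (√2 * √t) x s := by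
  have hst : 0 < √t := Real.sqrt_pos.2 ht
  have h1 : √t ^ 2 = 2 * (t / 2) := by rw [Real.sq_sqrt ht.le]; ring
  have h2 : (√2 * √t) ^ 2 = 2 * t := by
    rw [mul_pow, Real.sq_sqrt ht.le, Real.sq_sqrt (by norm_num)]
  have hpi : 0 < (√(2 * Real.pi))⁻¹ := by positivity
  have h21 : 0 < √2 - 1 := by linarith [sqrt_two_bounds.1]
  change (√2 * heat (t / 2) (mboStep (t / 2) (subgraph φ)) (x, s) - heat t (subgraph φ) (x, s)) /
    (√2 - 1) ≥ 1 / 2 ↔ _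
  rw [mboStep_subgraph hφ hst h1 hψ, heat_subgraph hψc hst h1,
    heat_subgraph hφ (by positivity) h2, ge_iff_le, le_div_iff₀ h21,
    ← mul_nonneg_iff_of_pos_left hpi]
  constructor <;> intro h <;> linarith

/-- A sign change of a continuous function along the axis places the interface. -/
lemma crossesAxisAt_of_sign {A : Set (Base n × ℝ)} {g : Base n × ℝ → ℝ} (hg : Continuous g)
    (hA : ∀ q, q ∈ A ↔ 0 ≤ g q) {z : ℝ} (hz : g (0, z) = 0) (hlt : ∀ s < z, 0 < g (0, s))
    (hgt : ∀ s, z < s → g (0, s) < 0) : CrossesAxisAt A z := by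
  constructor
  · intro s
    rw [hA]
    constructor
    · intro h
      by_contra hs
      exact absurd h (not_le.2 (hgt s (not_le.1 hs)))
    · intro h
      rcases h.lt_or_eq with h | h
      · exact (hlt s h).le
      · rw [h, hz]
  · intro s
    have hAeq : A = g ⁻¹' Ici 0 := by ext q; exact hA q
    constructor
    · intro h
      have h1 := hg.frontier_preimage_subset (Ici 0) (hAeq ▸ h)
      rw [frontier_Ici, mem_preimage, mem_singleton_iff] at h1
      rcases lt_trichotomy s z with h2 | h2 | h2
      · exact absurd h1 (hlt s h2).ne'
      · exact h2
      · exact absurd h1 (hgt s h2).ne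
    · rintro rfl
      -- The crossing point lies in the set, and the axis points just above it lie in the complement
      -- and converge to it.
      rw [frontier_eq_closure_inter_closure]
      refine ⟨subset_closure ((hA _).2 hz.ge), ?_⟩
      have hc : Tendsto (fun r : ℝ => ((0 : Base n), r)) (𝓝[>] s) (𝓝 (0, s)) :=
        ((by fun_prop : Continuous fun r : ℝ => ((0 : Base n), r)).tendsto s).mono_left
          nhdsWithin_le_nhds
      refine mem_closure_of_tendsto hc ?_
      filter_upwards [self_mem_nhdsWithin] with r hr
      rw [mem_compl_iff, hA]
      exact not_le.2 (hgt r hr)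

end Heat

end TwoKernel

namespace TwoKernel

open ProbabilityTheory
open scoped RealInnerProductSpace

/-! ### Taylor estimates separated by parity, and the heat expansion of a Gaussian mean. -/

section Taylor

/-- The mean value inequality on the ball of radius `‖x‖`. Each use gains one order of vanishing,
and iteration replaces Taylor's formula below. -/
lemma norm_le_pow_succ_of_norm_fderiv_le {V W : Type*} [NormedAddCommGroup V] [NormedSpace ℝ V]
    [NormedAddCommGroup W] [NormedSpace ℝ W] {G : V → W} (hG : Differentiable ℝ G) (h0 : G 0 = 0)
    {C : ℝ} {k : ℕ} (hC : 0 ≤ C) (h : ∀ x, ‖fderiv ℝ G x‖ ≤ C * ‖x‖ ^ k) (x : V) :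
    ‖G x‖ ≤ C * ‖x‖ ^ (k + 1) := by
  have := Convex.norm_image_sub_le_of_norm_fderiv_le (s := Metric.closedBall (0 : V) ‖x‖)
    (f := G) (C := C * ‖x‖ ^ k) (x := 0) (y := x) (𝕜 := ℝ) (fun y _ => hG y)
    (fun y hy => (h y).trans (by
      gcongr
      simpa using hy)) (convex_closedBall _ _) (by simp) (by simp)
  rw [h0, sub_zero, sub_zero] at this
  rw [pow_succ, ← mul_assoc]
  exact this

variable {n : ℕ}

lemma contDiff_pd {F : Base n → ℝ} (hF : ContDiff ℝ ∞ F) (i : Fin n) : ContDiff ℝ ∞ (pd i F) :=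
  (hF.fderiv_right (m := ∞) (by simp)).clm_apply contDiff_const

lemma hasCompactSupport_pd {F : Base n → ℝ} (hF : HasCompactSupport F) (i : Fin n) :
    HasCompactSupport (pd i F) := hF.fderiv_apply ℝ _

/-- The sum of the pure second partial derivatives. -/
noncomputable def lap (F : Base n → ℝ) (x : Base n) : ℝ := ∑ i, pd i (pd i F) x

lemma contDiff_lap {F : Base n → ℝ} (hF : ContDiff ℝ ∞ F) : ContDiff ℝ ∞ (lap F) :=
  ContDiff.sum fun i _ => contDiff_pd (contDiff_pd hF i) i

lemma hasCompactSupport_lap {F : Base n → ℝ} (hF : HasCompactSupport F) :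
    HasCompactSupport (lap F) := by
  have h : ∀ s : Finset (Fin n), HasCompactSupport fun x => ∑ i ∈ s, pd i (pd i F) x := by
    intro s
    induction s using Finset.induction_on with
    | empty => exact HasCompactSupport.zero
    | insert i s hi ih =>
      simp_rw [Finset.sum_insert hi]
      exact (hasCompactSupport_pd (hasCompactSupport_pd hF i) i).add ih
  exact h _

lemma exists_bound {V W : Type*} [NormedAddCommGroup V] [NormedAddCommGroup W] {F : V → W}
    (hc : Continuous F)
    (hs : HasCompactSupport F) : ∃ C, 0 ≤ C ∧ ∀ x, ‖F x‖ ≤ C := by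
  obtain ⟨C, hC⟩ := hs.exists_bound_of_continuous hc
  exact ⟨C, (norm_nonneg _).trans (hC 0), hC⟩

lemma sum_coord_mul_pd (F : Base n → ℝ) (x v : Base n) :
    fderiv ℝ F x v = ∑ i, v i * pd i F x := by
  conv_lhs => rw [← (EuclideanSpace.basisFun (Fin n) ℝ).sum_repr v, map_sum]
  simp [pd]

/-- The heat flow: the derivative of a Gaussian mean in the scale. -/
lemma hasDerivAt_integral_scale {F : Base n → ℝ} (hF : ContDiff ℝ ∞ F) (hs : HasCompactSupport F)
    (a : ℝ) :
    HasDerivAt (fun a : ℝ => ∫ ξ, F (a • ξ) ∂(stdGaussian (Base n)))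
      (a * ∫ ξ, lap F (a • ξ) ∂(stdGaussian (Base n))) a := by
  have hF1 : ContDiff ℝ ∞ (fderiv ℝ F) := hF.fderiv_right (by simp)
  have hc := hF.continuous
  have hc1 := hF1.continuous
  obtain ⟨C, hC, hb⟩ := exists_bound hc hs
  obtain ⟨C1, hC1, hb1⟩ := exists_bound hc1 (hs.fderiv ℝ)
  have hd : ∀ (ξ : Base n) (a : ℝ), HasDerivAt (fun a : ℝ => F (a • ξ)) (fderiv ℝ F (a • ξ) ξ) a := by
    intro ξ a
    have h1 := (hF.differentiable (by simp) (a • ξ)).hasFDerivAt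
    have h2 : HasDerivAt (fun a : ℝ => a • ξ) ξ a := by
      simpa using (hasDerivAt_id a).smul_const ξ
    exact h1.comp_hasDerivAt a h2
  have h := hasDerivAt_integral_of_dominated_loc_of_deriv_le (μ := stdGaussian (Base n))
    (F := fun a ξ => F (a • ξ)) (F' := fun a ξ => fderiv ℝ F (a • ξ) ξ) (x₀ := a)
    (s := univ) (bound := fun ξ => C1 * (1 + ‖ξ‖) ^ 1) univ_mem
    (Eventually.of_forall fun a => by fun_prop)
    (integrable_of_polynomial_bound (C := C) (m := 0) (by fun_prop) fun x => by
      simpa using hb (a • x))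
    (by fun_prop)
    (ae_of_all _ fun ξ b _ => by
      refine ((fderiv ℝ F (b • ξ)).le_opNorm ξ).trans ?_
      gcongr
      · exact hb1 _
      · rw [pow_one]; linarith)
    ((integrable_one_add_norm_pow 1).const_mul C1) (ae_of_all _ fun ξ b _ => hd ξ b)
  convert! h.2 using 1
  have hpdc : ∀ i, Continuous (pd i F) := fun i => (contDiff_pd hF i).continuous
  have hppc : ∀ i, Continuous (pd i (pd i F)) := fun i =>
    (contDiff_pd (contDiff_pd hF i) i).continuous
  -- Integration by parts trades the factor `ξ i` for a further derivative and a factor `a`, so the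
  -- radial derivative becomes the Laplacian.
  have hstein : ∀ i, ∫ ξ, ξ i * pd i F (a • ξ) ∂(stdGaussian (Base n)) =
      a * ∫ ξ, pd i (pd i F) (a • ξ) ∂(stdGaussian (Base n)) := by
    intro i
    have hg := contDiff_pd hF i
    obtain ⟨B, hB, hbB⟩ := exists_bound hg.continuous (hasCompactSupport_pd hs i)
    obtain ⟨B1, hB1, hbB1⟩ := exists_bound (hg.fderiv_right (m := ∞) (by simp)).continuous
      ((hasCompactSupport_pd hs i).fderiv ℝ)
    have hfd : ∀ x, HasFDerivAt (fun x => pd i F (a • x)) (a • fderiv ℝ (pd i F) (a • x)) x := by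
      intro x
      have h1 := (hg.differentiable (by simp) (a • x)).hasFDerivAt
      have h2 : HasFDerivAt (fun x : Base n => a • x) (a • ContinuousLinearMap.id ℝ (Base n)) x :=
        (hasFDerivAt_id x).const_smul a
      convert! h1.comp x h2 using 1
      ext v; simp
    have hcd : ContDiff ℝ 1 fun x => pd i F (a • x) :=
      (hg.of_le (by exact_mod_cast le_top)).comp (contDiff_const_smul a)
    have := integral_inner_mul_stdGaussian hcd (C := B + |a| * B1) (m := 0)
      (fun x => by
        have := hbB (a • x)
        rw [Real.norm_eq_abs] at this
        have h3 : 0 ≤ |a| * B1 := by positivity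
        simp only [pow_zero, mul_one]
        linarith)
      (fun x => by
        rw [(hfd x).fderiv, norm_smul, Real.norm_eq_abs]
        have := mul_le_mul_of_nonneg_left (hbB1 (a • x)) (abs_nonneg a)
        simp only [pow_zero, mul_one]
        linarith) (EuclideanSpace.single i (1 : ℝ))
    simp only [EuclideanSpace.inner_single_left, map_one, one_mul] at this
    rw [this, ← integral_const_mul]
    refine integral_congr_ae (ae_of_all _ fun x => ?_)
    simp only [(hfd x).fderiv]
    rfl
  simp_rw [sum_coord_mul_pd F, lap]
  rw [integral_finsetSum, integral_finsetSum, Finset.mul_sum]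
  · exact Finset.sum_congr rfl fun i _ => (hstein i).symm
  · intro i _
    obtain ⟨B, hB, hbB⟩ := exists_bound (hpdc i) (hasCompactSupport_pd hs i)
    refine integrable_of_polynomial_bound (C := B) (m := 1) ?_ fun x => ?_
    · have h1 := hpdc i
      have h2 : Continuous fun x : Base n => x i := by fun_prop
      exact (h2.mul (by fun_prop)).aestronglyMeasurable
    · rw [abs_mul, mul_comm]
      gcongr
      · exact hbB _
      · rw [pow_one, ← Real.norm_eq_abs]
        linarith [PiLp.norm_apply_le x i]
  · intro i _
    obtain ⟨B, hB, hbB⟩ := exists_bound (hppc i)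
      (hasCompactSupport_pd (hasCompactSupport_pd hs i) i)
    have := hppc i
    exact integrable_of_polynomial_bound (C := B) (m := 0) (by fun_prop) fun x => by
      simpa using hbB (a • x)

/-- The mean `m_F(a)` of `F(aξ)` satisfies `m_F' = a m_{ΔF}`. Integrating three times from `a = 0`
produces the coefficients `1/2` and `1/8`, with a remainder controlled by the supremum of `|Δ³F|`.
-/
lemma exists_heat_expansion {F : Base n → ℝ} (hF : ContDiff ℝ ∞ F) (hs : HasCompactSupport F) :
    ∃ C, 0 ≤ C ∧ ∀ a : ℝ, |∫ ξ, F (a • ξ) ∂(stdGaussian (Base n)) -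
      (F 0 + a ^ 2 / 2 * lap F 0 + a ^ 4 / 8 * lap (lap F) 0)| ≤ C * |a| ^ 6 := by
  set γ := stdGaussian (Base n)
  have zero_int : ∀ G : Base n → ℝ, ∫ ξ, G ((0 : ℝ) • ξ) ∂γ = G 0 := fun G => by simp [γ]
  -- One integration: an approximation `P'` of the mean of `ΔG` to order `k` gives an approximation
  -- `P` of the mean of `G` to order `k + 2`, where `P` has derivative `a P'(a)`. One order comes
  -- from the factor `a`, the other from the integration.
  have step : ∀ {G : Base n → ℝ} (_ : ContDiff ℝ ∞ G) (_ : HasCompactSupport G) {P P' : ℝ → ℝ}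
      (_ : ∀ a, HasDerivAt P (a * P' a) a) (_ : P 0 = G 0) {C : ℝ} {k : ℕ} (_ : 0 ≤ C)
      (_ : ∀ a : ℝ, |∫ ξ, lap G (a • ξ) ∂γ - P' a| ≤ C * |a| ^ k) (a : ℝ),
      |∫ ξ, G (a • ξ) ∂γ - P a| ≤ C * |a| ^ (k + 2) := by
    intro G hG hGs P P' hP hP0 C k hC hb a
    have hd : ∀ a, HasDerivAt (fun a : ℝ => ∫ ξ, G (a • ξ) ∂γ - P a)
        (a * ∫ ξ, lap G (a • ξ) ∂γ - a * P' a) a := fun a =>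
      (hasDerivAt_integral_scale hG hGs a).sub (hP a)
    have := norm_le_pow_succ_of_norm_fderiv_le (G := fun a : ℝ => ∫ ξ, G (a • ξ) ∂γ - P a)
      (fun a => (hd a).differentiableAt) (by rw [zero_int, hP0, sub_self]) hC (k := k + 1)
      (fun a => by
        rw [← toSpanSingleton_deriv, ContinuousLinearMap.norm_toSpanSingleton, (hd a).deriv,
          ← mul_sub, norm_mul, Real.norm_eq_abs, Real.norm_eq_abs, pow_succ]
        calc |a| * _ ≤ |a| * (C * |a| ^ k) := by gcongr; exact hb a
          _ = _ := by ring) a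
    simpa using this
  have h1 := contDiff_lap hF
  have s1 := hasCompactSupport_lap hs
  have h2 := contDiff_lap h1
  have s2 := hasCompactSupport_lap s1
  have h3 := contDiff_lap h2
  have s3 := hasCompactSupport_lap s2
  obtain ⟨C, hC, hb⟩ := exists_bound h3.continuous s3
  have b3 : ∀ a : ℝ, |∫ ξ, lap (lap (lap F)) (a • ξ) ∂γ - 0| ≤ C * |a| ^ 0 := by
    intro a
    rw [sub_zero, pow_zero, mul_one]
    have := norm_integral_le_of_norm_le_const (μ := γ)
      (f := fun ξ => lap (lap (lap F)) (a • ξ)) (C := C) (ae_of_all _ fun ξ => hb _)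
    simpa using this
  have b2 := step h2 s2 (P := fun _ => lap (lap F) 0) (P' := fun _ => 0)
    (fun a => by simpa using hasDerivAt_const a (lap (lap F) 0)) rfl hC b3
  have b1 := step h1 s1 (P := fun a => lap F 0 + a ^ 2 / 2 * lap (lap F) 0)
    (P' := fun _ => lap (lap F) 0)
    (fun a => by
      have := (((hasDerivAt_pow 2 a).div_const 2).mul_const (lap (lap F) 0)).const_add (lap F 0)
      convert! this using 1
      push_cast; ring) (by simp) hC b2
  have b0 := step hF hs (P := fun a => F 0 + a ^ 2 / 2 * lap F 0 + a ^ 4 / 8 * lap (lap F) 0)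
    (P' := fun a => lap F 0 + a ^ 2 / 2 * lap (lap F) 0)
    (fun a => by
      have := ((((hasDerivAt_pow 2 a).div_const 2).mul_const (lap F 0)).const_add (F 0)).add
        (((hasDerivAt_pow 4 a).div_const 8).mul_const (lap (lap F) 0))
      convert! this using 1
      push_cast; ring) (by simp) hC b1
  exact ⟨C, hC, b0⟩

/-- The quantitative information on a graph with horizontal tangent at the origin that enters the
expansion of the scheme: `A` is the Hessian at the origin, `L` the differential, and `D₂` the
bi-Laplacian at the origin. -/
structure GraphBounds (F : Base n → ℝ) (A : Base n →L[ℝ] Base n) (C D₂ : ℝ) : Prop where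
  nonneg : 0 ≤ C
  continuous : Continuous F
  symm : ∀ x y, ⟪A x, y⟫ = ⟪x, A y⟫
  even : ∀ x, |F x + F (-x) - ⟪A x, x⟫| ≤ C * ‖x‖ ^ 4
  odd : ∀ x, |F x - F (-x)| ≤ C * ‖x‖ ^ 3
  tangent : ∀ x, ∃ L : Base n →L[ℝ] ℝ, ‖L‖ ≤ C * ‖x‖ ∧ ∀ y, |F (x + y) - F x - L y| ≤ C * ‖y‖ ^ 2
  mean : ∀ a : ℝ, |∫ ξ, F (a • ξ) ∂(stdGaussian (Base n)) -
    (a ^ 2 / 2 * LinearMap.trace ℝ (Base n) A + a ^ 4 / 8 * D₂)| ≤ C * |a| ^ 6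

lemma fderiv_fderiv_single (F : Base n → ℝ) (hF : ContDiff ℝ ∞ F) (i j : Fin n) (x : Base n) :
    fderiv ℝ (fderiv ℝ F) x (EuclideanSpace.single i 1) (EuclideanSpace.single j 1) =
      pd i (pd j F) x := by
  have h1 : HasFDerivAt (fderiv ℝ F) (fderiv ℝ (fderiv ℝ F) x) x :=
    ((hF.fderiv_right (m := ∞) (by simp)).differentiable (by simp) x).hasFDerivAt
  have h2 := h1.clm_apply (hasFDerivAt_const (EuclideanSpace.single j (1 : ℝ)) x)
  have h3 : HasFDerivAt (pd j F) _ x := h2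
  rw [pd, h3.fderiv]
  simp

lemma hasFDerivAt_comp_neg {V W : Type*} [NormedAddCommGroup V] [NormedSpace ℝ V]
    [NormedAddCommGroup W] [NormedSpace ℝ W] {G : V → W} (hG : Differentiable ℝ G) (x : V) :
    HasFDerivAt (fun x => G (-x)) (-(fderiv ℝ G (-x))) x := by
  have h1 := (hG (-x)).hasFDerivAt
  have h2 : HasFDerivAt (fun x : V => -x) (-ContinuousLinearMap.id ℝ V) x :=
    (hasFDerivAt_id x).neg
  convert! h1.comp x h2 using 1
  ext v; simp

lemma norm_add_sub_le_of_fderiv_le {V W : Type*} [NormedAddCommGroup V] [NormedSpace ℝ V]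
    [NormedAddCommGroup W] [NormedSpace ℝ W] {G : V → W} (hG : Differentiable ℝ G)
    {C : ℝ} (hb : ∀ x, ‖fderiv ℝ G x‖ ≤ C) (x y : V) : ‖G (x + y) - G x‖ ≤ C * ‖y‖ := by
  have := Convex.norm_image_sub_le_of_norm_fderiv_le (f := G) (s := univ) (x := x) (y := x + y)
    (fun z _ => hG z) (fun z _ => hb z) convex_univ trivial trivial
  simpa using this

lemma norm_sub_neg_le_of_fderiv_le {V W : Type*} [NormedAddCommGroup V] [NormedSpace ℝ V]
    [NormedAddCommGroup W] [NormedSpace ℝ W] {G : V → W} (hG : Differentiable ℝ G)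
    {C : ℝ} (hb : ∀ x, ‖fderiv ℝ G x‖ ≤ C) (x : V) : ‖G x - G (-x)‖ ≤ 2 * C * ‖x‖ := by
  have := norm_add_sub_le_of_fderiv_le hG hb (-x) (x + x)
  rw [neg_add_cancel_left] at this
  refine this.trans ?_
  have h2 : ‖x + x‖ ≤ 2 * ‖x‖ := by linarith [norm_add_le x x]
  have hC : 0 ≤ C := (norm_nonneg _).trans (hb 0)
  nlinarith

set_option maxSynthPendingDepth 3 in
/-- Parity-separated Taylor estimates, uniform on the whole space, for a compactly supported
function with a critical zero at the origin. -/
lemma exists_taylor_bounds {V : Type*} [NormedAddCommGroup V] [NormedSpace ℝ V] {F : V → ℝ}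
    (hF : ContDiff ℝ ∞ F) (hs : HasCompactSupport F) (h0 : F 0 = 0) (hF10 : fderiv ℝ F 0 = 0) :
    ∃ C, 0 ≤ C ∧ (∀ x, ‖F x - F (-x)‖ ≤ C * ‖x‖ ^ 3) ∧
      (∀ x, ‖F x + F (-x) - fderiv ℝ (fderiv ℝ F) 0 x x‖ ≤ C * ‖x‖ ^ 4) ∧
      (∀ x y, ‖F (x + y) - F x - fderiv ℝ F x y‖ ≤ C * ‖y‖ ^ 2) ∧
      ∀ x, ‖fderiv ℝ F x‖ ≤ C * ‖x‖ := by
  set F1 := fderiv ℝ F with hF1d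
  set F2 := fderiv ℝ F1 with hF2d
  set F3 := fderiv ℝ F2 with hF3d
  have hF1 : ContDiff ℝ ∞ F1 := hF.fderiv_right (by simp)
  have hF2 : ContDiff ℝ ∞ F2 := hF1.fderiv_right (by simp)
  have hF3 : ContDiff ℝ ∞ F3 := hF2.fderiv_right (by simp)
  have hF4 : ContDiff ℝ ∞ (fderiv ℝ F3) := hF3.fderiv_right (by simp)
  have d0 := hF.differentiable (by simp)
  have d1 := hF1.differentiable (by simp)
  have d2 := hF2.differentiable (by simp)
  have d3 := hF3.differentiable (by simp)
  have s1 : HasCompactSupport F1 := hs.fderiv ℝ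
  have s2 : HasCompactSupport F2 := s1.fderiv ℝ
  have s3 : HasCompactSupport F3 := s2.fderiv ℝ
  obtain ⟨C2, hC2, b2⟩ := exists_bound hF2.continuous s2
  obtain ⟨C3, hC3, b3⟩ := exists_bound hF3.continuous s3
  obtain ⟨C4, hC4, b4⟩ := exists_bound hF4.continuous (s3.fderiv ℝ)
  have hsymm : ∀ x y, F2 0 x y = F2 0 y x := fun x y =>
    (hF.contDiffAt.isSymmSndFDerivAt (by simpa using ENat.LEInfty.out)).eq x y
  -- Differentiating turns the odd part into a sum and then again into a difference. The zeroth and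
  -- first derivatives vanish at `0`, the latter because the gradient does, and the second is
  -- Lipschitz through the bound on `F3`.
  have hodd : ∀ x, ‖F x - F (-x)‖ ≤ 2 * C3 * ‖x‖ ^ 3 := by
    have e1 : ∀ x, HasFDerivAt (fun x => F x - F (-x)) (F1 x + F1 (-x)) x := fun x => by
      convert! (d0 x).hasFDerivAt.sub (hasFDerivAt_comp_neg d0 x) using 1
      rw [sub_neg_eq_add]
    have e2 : ∀ x, HasFDerivAt (fun x => F1 x + F1 (-x)) (F2 x - F2 (-x)) x := fun x => by
      convert! (d1 x).hasFDerivAt.add (hasFDerivAt_comp_neg d1 x) using 1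
    refine norm_le_pow_succ_of_norm_fderiv_le (fun x => (e1 x).differentiableAt) (by simp)
      (by positivity) fun x => ?_
    rw [(e1 x).fderiv]
    refine norm_le_pow_succ_of_norm_fderiv_le (G := fun x => F1 x + F1 (-x)) (k := 1)
      (fun x => (e2 x).differentiableAt) (by simp [hF10]) (by positivity) (fun x => ?_) x
    rw [(e2 x).fderiv, pow_one]
    exact norm_sub_neg_le_of_fderiv_le d2 b3 x
  -- After subtraction of the Hessian form the derivatives up to order two vanish at `0`. The third
  -- is an odd difference of `F3`, which vanishes linearly, and this gives the fourth power.
  have heven : ∀ x, ‖F x + F (-x) - F2 0 x x‖ ≤ 2 * C4 * ‖x‖ ^ 4 := by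
    have q : ∀ x, HasFDerivAt (fun x => F2 0 x x) ((2 : ℝ) • F2 0 x) x := fun x => by
      have h := (F2 0).hasFDerivAt (x := x) |>.clm_apply (hasFDerivAt_id x)
      convert! h using 1
      ext v
      have h2 : (2 : ℝ) • F2 0 x = F2 0 x + F2 0 x := two_smul _ _
      rw [h2]
      simp [hsymm v x]
    have e1 : ∀ x, HasFDerivAt (fun x => F x + F (-x) - F2 0 x x)
        (F1 x - F1 (-x) - (2 : ℝ) • F2 0 x) x := fun x => by
      convert! ((d0 x).hasFDerivAt.add (hasFDerivAt_comp_neg d0 x)).sub (q x) using 1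
    have e2 : ∀ x, HasFDerivAt (fun x => F1 x - F1 (-x) - (2 : ℝ) • F2 0 x)
        (F2 x + F2 (-x) - (2 : ℝ) • F2 0) x := fun x => by
      convert! ((d1 x).hasFDerivAt.sub (hasFDerivAt_comp_neg d1 x)).sub
        (((F2 0).hasFDerivAt (x := x)).const_smul (2 : ℝ)) using 1
      rw [sub_neg_eq_add]
    have e3 : ∀ x, HasFDerivAt (fun x => F2 x + F2 (-x) - (2 : ℝ) • F2 0)
        (F3 x - F3 (-x)) x := fun x => by
      convert! ((d2 x).hasFDerivAt.add (hasFDerivAt_comp_neg d2 x)).sub_const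
        ((2 : ℝ) • F2 0) using 1
    refine norm_le_pow_succ_of_norm_fderiv_le (fun x => (e1 x).differentiableAt) (by simp [h0])
      (by positivity) fun x => ?_
    rw [(e1 x).fderiv]
    refine norm_le_pow_succ_of_norm_fderiv_le (G := fun x => F1 x - F1 (-x) - (2 : ℝ) • F2 0 x)
      (k := 2) (fun x => (e2 x).differentiableAt) (by simp) (by positivity) (fun x => ?_) x
    rw [(e2 x).fderiv]
    refine norm_le_pow_succ_of_norm_fderiv_le (G := fun x => F2 x + F2 (-x) - (2 : ℝ) • F2 0)
      (k := 1) (fun x => (e3 x).differentiableAt) (by simp [two_smul]) (by positivity)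
      (fun x => ?_) x
    rw [(e3 x).fderiv, pow_one]
    exact norm_sub_neg_le_of_fderiv_le d3 b4 x
  have htan : ∀ x y, ‖F (x + y) - F x - F1 x y‖ ≤ C2 * ‖y‖ ^ 2 := by
    intro x
    have e1 : ∀ y, HasFDerivAt (fun y => F (x + y) - F x - F1 x y) (F1 (x + y) - F1 x) y :=
      fun y => by
        have h := (d0 (x + y)).hasFDerivAt.comp y ((hasFDerivAt_id y).const_add x)
        exact (h.sub_const (F x)).sub (F1 x).hasFDerivAt
    refine norm_le_pow_succ_of_norm_fderiv_le (fun y => (e1 y).differentiableAt) (by simp) hC2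
      fun y => ?_
    rw [(e1 y).fderiv, pow_one]
    exact norm_add_sub_le_of_fderiv_le d1 b2 x y
  have hF1b : ∀ x, ‖F1 x‖ ≤ C2 * ‖x‖ := fun x => by
    simpa [hF10] using norm_add_sub_le_of_fderiv_le d1 b2 0 x
  refine ⟨C2 + 2 * C3 + 2 * C4, by positivity, fun x => (hodd x).trans ?_,
    fun x => (heven x).trans ?_, fun x y => (htan x y).trans ?_, fun x => (hF1b x).trans ?_⟩ <;>
  · gcongr
    linarith

lemma exists_graphBounds {F : Base n → ℝ} (hF : ContDiff ℝ ∞ F) (hs : HasCompactSupport F)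
    (h0 : F 0 = 0) (h1 : ∀ i, pd i F 0 = 0) :
    ∃ (A : Base n →L[ℝ] Base n) (C : ℝ), GraphBounds F A C (lap (lap F) 0) ∧
      ∀ i j, ⟪A (EuclideanSpace.single i 1), EuclideanSpace.single j 1⟫ = hessian F 0 i j := by
  have hF10 : fderiv ℝ F 0 = 0 := by
    ext v; rw [sum_coord_mul_pd]; simp [h1]
  obtain ⟨C, hC, hodd, heven, htan, hF1b⟩ := exists_taylor_bounds hF hs h0 hF10
  obtain ⟨C6, hC6, b6⟩ := exists_heat_expansion hF hs
  have hsymm : ∀ x y, fderiv ℝ (fderiv ℝ F) 0 x y = fderiv ℝ (fderiv ℝ F) 0 y x := fun x y =>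
    (hF.contDiffAt.isSymmSndFDerivAt (by simpa using ENat.LEInfty.out)).eq x y
  -- The operator that represents the second derivative at `0` through the inner product.
  let A : Base n →L[ℝ] Base n := ∑ i, ((fderiv ℝ (fderiv ℝ F) 0).flip
    (EuclideanSpace.single i 1)).smulRight (EuclideanSpace.single i (1 : ℝ))
  have hA : ∀ x y, ⟪A x, y⟫ = fderiv ℝ (fderiv ℝ F) 0 x y := fun x y => by
    have hy : y = ∑ i, y i • EuclideanSpace.single i (1 : ℝ) := by
      conv_lhs => rw [← (EuclideanSpace.basisFun (Fin n) ℝ).sum_repr y]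
      simp
    conv_rhs => rw [hy, map_sum]
    simp only [A, _root_.sum_apply, ContinuousLinearMap.smulRight_apply,
      ContinuousLinearMap.flip_apply, sum_inner, inner_smul_left, EuclideanSpace.inner_single_left,
      map_smul, smul_eq_mul, conj_trivial, map_one, one_mul]
    exact Finset.sum_congr rfl fun i _ => mul_comm _ _
  have hAtr : LinearMap.trace ℝ (Base n) A = lap F 0 := by
    rw [LinearMap.trace_eq_sum_inner _ (EuclideanSpace.basisFun (Fin n) ℝ), lap]
    refine Finset.sum_congr rfl fun i _ => ?_
    rw [← fderiv_fderiv_single F hF i i]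
    simp only [EuclideanSpace.basisFun_apply]
    rw [real_inner_comm]
    exact hA _ _
  refine ⟨A, C + C6, ⟨by positivity, hF.continuous, ?_, ?_, ?_, ?_, ?_⟩, ?_⟩
  · intro x y
    rw [hA, real_inner_comm, hA, hsymm]
  · intro x
    rw [hA, ← Real.norm_eq_abs]
    refine (heven x).trans ?_
    gcongr
    linarith
  · intro x
    rw [← Real.norm_eq_abs]
    refine (hodd x).trans ?_
    gcongr
    linarith
  · intro x
    refine ⟨fderiv ℝ F x, (hF1b x).trans ?_, fun y => (htan x y).trans ?_⟩ <;>
    · gcongr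
      linarith
  · intro a
    have := b6 a
    rw [h0, zero_add] at this
    rw [hAtr]
    refine this.trans ?_
    gcongr
    linarith
  · intro i j
    rw [hA]
    exact fderiv_fderiv_single F hF i j 0

end Taylor

end TwoKernel

namespace TwoKernel

open ProbabilityTheory
open scoped RealInnerProductSpace

/-! ### Localisation, and the height of the interface after the half step. -/

section FirstStep

/-- A weighted moment of the standard Gaussian measure. -/
noncomputable def gaussMoment (n k : ℕ) : ℝ := ∫ ξ, (1 + ‖ξ‖) ^ k ∂(stdGaussian (Base n))

variable {n : ℕ}

lemma one_le_gaussMoment (k : ℕ) : 1 ≤ gaussMoment n k := by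
  have h : ∫ _ξ, (1 : ℝ) ∂(stdGaussian (Base n)) ≤ gaussMoment n k :=
    integral_mono (integrable_const _) (integrable_one_add_norm_pow k) fun ξ =>
      one_le_pow₀ (by linarith [norm_nonneg ξ])
  simpa using h

lemma gaussMoment_nonneg (k : ℕ) : 0 ≤ gaussMoment n k := zero_le_one.trans (one_le_gaussMoment k)

lemma abs_integral_le_gaussMoment {g : Base n → ℝ} {C : ℝ} {k : ℕ}
    (h : ∀ ξ, |g ξ| ≤ C * (1 + ‖ξ‖) ^ k) :
    |∫ ξ, g ξ ∂(stdGaussian (Base n))| ≤ C * gaussMoment n k := by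
  rw [gaussMoment, ← integral_const_mul]
  exact norm_integral_le_of_norm_le (f := g) ((integrable_one_add_norm_pow k).const_mul C)
    (ae_of_all _ h)

lemma integrable_gaussPrimitive_comp {v : Base n → ℝ} (hv : Measurable v) :
    Integrable (fun ξ => gaussPrimitive (v ξ)) (stdGaussian (Base n)) :=
  integrable_of_polynomial_bound (C := 2) (m := 0)
    (continuous_gaussPrimitive.measurable.comp hv).aestronglyMeasurable fun ξ => by
    simpa using abs_gaussPrimitive_le_two _

/-- Two heights that agree near the origin have almost the same erf-mean there. -/
lemma abs_integral_sub_le_of_agree {v v' : Base n → ℝ} (hv : Measurable v) (hv' : Measurable v')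
    {a : ℝ} (ha : 0 ≤ a) (h : ∀ ξ, a * ‖ξ‖ ≤ 1 → v ξ = v' ξ) (k : ℕ) :
    |∫ ξ, gaussPrimitive (v ξ) ∂(stdGaussian (Base n)) -
      ∫ ξ, gaussPrimitive (v' ξ) ∂(stdGaussian (Base n))| ≤ 4 * a ^ k * gaussMoment n k := by
  rw [← integral_sub (integrable_gaussPrimitive_comp hv) (integrable_gaussPrimitive_comp hv')]
  refine abs_integral_le_gaussMoment fun ξ => ?_
  by_cases hξ : a * ‖ξ‖ ≤ 1
  · rw [h ξ hξ, sub_self, abs_zero]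
    positivity
  · have h1 : 1 ≤ (a * (1 + ‖ξ‖)) ^ k := one_le_pow₀ (by nlinarith)
    rw [mul_pow] at h1
    have h2 := abs_sub (gaussPrimitive (v ξ)) (gaussPrimitive (v' ξ))
    have h3 := abs_gaussPrimitive_le_two (v ξ)
    have h4 := abs_gaussPrimitive_le_two (v' ξ)
    rw [mul_assoc]
    linarith

/-- For `‖x‖ ≤ 1` and `a ‖ξ‖ ≤ 1` the point `x + aξ` stays in the ball of radius `2`, where the two
functions agree. -/
lemma abs_erfMean_sub_le {φ Φ : Base n → ℝ} (hφ : Continuous φ) (hΦ : Continuous Φ)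
    (h : ∀ x, ‖x‖ ≤ 2 → φ x = Φ x) {x : Base n} (hx : ‖x‖ ≤ 1) {a : ℝ} (ha : 0 ≤ a) (s : ℝ) (k : ℕ) :
    |erfMean φ a x s - erfMean Φ a x s| ≤ 4 * a ^ k * gaussMoment n k := by
  refine abs_integral_sub_le_of_agree (v := fun ξ => (φ (x + a • ξ) - s) / a)
    (v' := fun ξ => (Φ (x + a • ξ) - s) / a) (by fun_prop) (by fun_prop) ha (fun ξ hξ => ?_) k
  rw [h]
  refine (norm_add_le _ _).trans ?_
  rw [norm_smul, Real.norm_eq_abs, abs_of_nonneg ha]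
  linarith

/-- An upper barrier for the height after the first step. -/
lemma exists_barrier (n : ℕ) {C : ℝ} (hC : 0 ≤ C) :
    ∃ K ε₀ : ℝ, 0 ≤ K ∧ 0 < ε₀ ∧ ε₀ ≤ 1 ∧ ∀ (φ Φ : Base n → ℝ), Continuous φ → Continuous Φ →
      (∀ x, ‖x‖ ≤ 2 → φ x = Φ x) → ∀ (x : Base n) (L : Base n →L[ℝ] ℝ), ‖x‖ ≤ 1 → ‖L‖ ≤ C →
      (∀ y, |Φ (x + y) - Φ x - L y| ≤ C * ‖y‖ ^ 2) → ∀ ε, 0 < ε → ε ≤ ε₀ →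
      erfMean φ ε x (Φ x + K * ε ^ 2) < 0 := by
  set γ := stdGaussian (Base n)
  set m1 := gaussMoment n 1
  set m2 := gaussMoment n 2
  have hm1 : 1 ≤ m1 := one_le_gaussMoment 1
  have hm2 : 1 ≤ m2 := one_le_gaussMoment 2
  -- By Markov's inequality in the form `1 - (1 + ‖ξ‖)/R ≤ 1` on the ball of radius `R` and `≤ 0`
  -- outside it, this choice leaves mean `1/2`. On the ball `|L ξ| ≤ C R`, and since `K ε ≤ 1` the
  -- slope of `p` between `L ξ - K ε` and `L ξ` is at least `c`.
  set R := 2 * m1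
  set c := Real.exp (-(C * R + 1) ^ 2 / 2)
  have hc : 0 < c := Real.exp_pos _
  -- Makes the gain `c K ε / 2` from raising the height exceed the quadratic error `C ε m2` plus the
  -- localisation error `4 ε² m2`.
  set K := 2 / c * ((C + 4) * m2) + 1
  have hK : 1 ≤ K := by
    have : 0 ≤ 2 / c * ((C + 4) * m2) := by positivity
    simp only [K]; linarith
  refine ⟨K, 1 / K, by linarith, by positivity, by rw [div_le_one (by linarith)]; exact hK, ?_⟩
  intro φ Φ hφ hΦ hag x L hx hL htan ε hε hεK
  have hKε : K * ε ≤ 1 := by rwa [le_div_iff₀ (by linarith), mul_comm] at hεK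
  have hε1 : ε ≤ 1 := by nlinarith
  have h1 := abs_erfMean_sub_le hφ hΦ hag hx hε.le (Φ x + K * ε ^ 2) 2
  have hLc : Measurable fun ξ => L ξ := L.continuous.measurable
  have i1 : Integrable (fun ξ => gaussPrimitive (L ξ)) γ := integrable_gaussPrimitive_comp hLc
  have i3 : Integrable (fun ξ : Base n => C * ε * (1 + ‖ξ‖) ^ 2) γ :=
    (integrable_one_add_norm_pow 2).const_mul _
  have i4 : Integrable (fun ξ : Base n => c * (K * ε) * (1 - (1 + ‖ξ‖) ^ 1 / R)) γ :=
    (((integrable_const 1).sub ((integrable_one_add_norm_pow 1).div_const R))).const_mul _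
  -- The tangent plane contributes nothing, because `p ∘ L` is odd.
  have h0 : ∫ ξ, gaussPrimitive (L ξ) ∂γ = 0 := by
    have := integral_stdGaussian_neg (fun ξ => gaussPrimitive (L ξ))
    simp only [map_neg, gaussPrimitive_neg, integral_neg] at this
    simp only [γ]
    linarith
  have h2 : erfMean Φ ε x (Φ x + K * ε ^ 2) ≤ ∫ ξ, (gaussPrimitive (L ξ) +
      C * ε * (1 + ‖ξ‖) ^ 2 - c * (K * ε) * (1 - (1 + ‖ξ‖) ^ 1 / R)) ∂γ := by
    refine integral_mono (integrable_erfMean hΦ _ _) ((i1.add i3).sub i4) fun ξ => ?_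
    simp only
    have ht := (abs_le.1 (htan (ε • ξ))).2
    rw [norm_smul, Real.norm_eq_abs, abs_of_pos hε, map_smul, smul_eq_mul] at ht
    have e1 : (Φ (x + ε • ξ) - (Φ x + K * ε ^ 2)) / ε ≤ (L ξ - K * ε) + C * ε * ‖ξ‖ ^ 2 := by
      rw [div_le_iff₀ hε]
      nlinarith
    have e2 := strictMono_gaussPrimitive.monotone e1
    have e3 := gaussPrimitive_sub_le (a := L ξ - K * ε) (b := (L ξ - K * ε) + C * ε * ‖ξ‖ ^ 2)
      (by have : 0 ≤ C * ε * ‖ξ‖ ^ 2 := by positivity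
          linarith)
    have e4 : C * ε * ‖ξ‖ ^ 2 ≤ C * ε * (1 + ‖ξ‖) ^ 2 := by gcongr; linarith
    have e5 : c * (K * ε) * (1 - (1 + ‖ξ‖) ^ 1 / R) ≤
        gaussPrimitive (L ξ) - gaussPrimitive (L ξ - K * ε) := by
      have hp : 0 ≤ (1 + ‖ξ‖) ^ 1 / R := by positivity
      have hKp : 0 ≤ K * ε := by positivity
      by_cases hξ : ‖ξ‖ ≤ R
      · have hLξ : |L ξ| ≤ C * R := (L.le_opNorm ξ).trans (by gcongr)
        have := abs_le.1 hLξ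
        have h5 := le_gaussPrimitive_sub (R := C * R + 1) (a := L ξ - K * ε) (b := L ξ)
          (by linarith) (by linarith) (by linarith)
        rw [sub_sub_cancel] at h5
        refine le_trans ?_ h5
        have : 0 ≤ c * (K * ε) := by positivity
        nlinarith
      · have h6 : 1 ≤ (1 + ‖ξ‖) ^ 1 / R := by
          rw [one_le_div (by positivity), pow_one]; linarith
        have h7 : 0 ≤ gaussPrimitive (L ξ) - gaussPrimitive (L ξ - K * ε) :=
          sub_nonneg.2 (strictMono_gaussPrimitive.monotone (by linarith))
        have : 0 ≤ c * (K * ε) := by positivity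
        nlinarith
    linarith
  have h3 : ∫ ξ, (gaussPrimitive (L ξ) + C * ε * (1 + ‖ξ‖) ^ 2 -
      c * (K * ε) * (1 - (1 + ‖ξ‖) ^ 1 / R)) ∂γ = C * ε * m2 - c * (K * ε) * (1 / 2) := by
    rw [integral_sub (by exact i1.add i3) i4, integral_add i1 i3, h0, integral_const_mul,
      integral_const_mul, integral_sub (integrable_const 1)
        ((integrable_one_add_norm_pow 1).div_const R), integral_div]
    have : ∫ ξ : Base n, (1 + ‖ξ‖) ^ 1 ∂γ = m1 := rfl
    rw [this]
    have : ∫ ξ : Base n, (1 + ‖ξ‖) ^ 2 ∂γ = m2 := rfl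
    rw [this]
    have : m1 / R = 1 / 2 := by simp only [R]; field_simp
    rw [this]
    simp
    left; norm_num
  have h4 := (abs_le.1 h1).2
  have h5 : c * K = 2 * ((C + 4) * m2) + c := by
    simp only [K]; field_simp
  have h6 : 4 * ε ^ 2 * m2 ≤ 4 * ε * m2 := by
    gcongr
    nlinarith
  rw [h3] at h2
  have h7 : c * (K * ε) * (1 / 2) = (C + 4) * m2 * ε + c * ε / 2 := by
    rw [show c * (K * ε) * (1 / 2) = c * K * ε / 2 by ring, h5]; ring
  have h8 : 0 < c * ε := by positivity
  rw [h7] at h2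
  change _ ≤ 4 * ε ^ 2 * m2 at h4
  nlinarith

/-- Reflection in the vertical direction turns the upper barrier into a lower one. -/
lemma erfMean_neg (φ : Base n → ℝ) (a : ℝ) (x : Base n) (s : ℝ) :
    erfMean (fun y => -φ y) a x (-s) = -erfMean φ a x s := by
  unfold erfMean
  rw [← integral_neg]
  congr 1
  ext ξ
  rw [← gaussPrimitive_neg]
  congr 1
  ring

/-- The height after the first step is within `O(ε²)` of the original one. -/
lemma exists_height_bound {F f : Base n → ℝ} {A : Base n →L[ℝ] Base n} {C D₂ : ℝ}
    (hF : GraphBounds F A C D₂) (hf : Continuous f) (hfF : ∀ x, ‖x‖ ≤ 2 → f x = F x) :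
    ∃ K ε₀ : ℝ, 0 ≤ K ∧ 0 < ε₀ ∧ ε₀ ≤ 1 ∧ ∀ ε, 0 < ε → ε ≤ ε₀ → ∀ ψ : Base n → ℝ,
      (∀ x, erfMean f ε x (ψ x) = 0) → ∀ x, ‖x‖ ≤ 1 → |ψ x - F x| ≤ K * ε ^ 2 := by
  obtain ⟨K, ε₀, hK, hε₀, hε₁, hb⟩ := exists_barrier n hF.nonneg
  refine ⟨K, ε₀, hK, hε₀, hε₁, fun ε hε hε' ψ hψ x hx => ?_⟩
  obtain ⟨L, hL, ht⟩ := hF.tangent x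
  have hLC : ‖L‖ ≤ C := hL.trans (mul_le_of_le_one_right hF.nonneg hx)
  have h1 := hb f F hf hF.continuous hfF x L hx hLC ht ε hε hε'
  have h2 := hb (fun y => -f y) (fun y => -F y) hf.neg hF.continuous.neg
    (fun y hy => by rw [hfF y hy]) x (-L) hx (by rwa [norm_neg]) (fun y => by
      have := ht y
      rw [← abs_neg] at this
      convert! this using 2
      simp; ring) ε hε hε'
  have h3 : -F x + K * ε ^ 2 = -(F x - K * ε ^ 2) := by ring
  simp only [h3] at h2
  rw [erfMean_neg, neg_lt_zero] at h2
  have hanti := erfMean_strictAnti (a := ε) hf hε x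
  rw [← hψ x] at h1 h2
  have h4 := hanti.lt_iff_gt.1 h1
  have h5 := hanti.lt_iff_gt.1 h2
  rw [abs_le]
  constructor <;> linarith

/-- The properties of the height after the first step that determine the second: it is `O(ε²)`
away from the original height, and satisfies the expanded implicit equation. -/
structure HalfStep (F : Base n → ℝ) (K ε : ℝ) (h : Base n → ℝ) : Prop where
  measurable : Measurable h
  near : ∀ x, |h x - F x| ≤ K * ε ^ 2
  balance : ∀ ξ, |∫ η, (F (ε • ξ + ε • η) - h (ε • ξ)) ∂(stdGaussian (Base n)) -
    1 / (6 * ε ^ 2) * ∫ η, (F (ε • ξ + ε • η) - h (ε • ξ)) ^ 3 ∂(stdGaussian (Base n))| ≤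
      K * ε ^ 6 * (1 + ‖ξ‖) ^ 5

/-- The deviation `F(εξ + εη) - h(εξ)` is `O(ε²)`. -/
lemma abs_deviation_le {F h : Base n → ℝ} {A : Base n →L[ℝ] Base n} {C D₂ K ε : ℝ}
    (hF : GraphBounds F A C D₂) (hε : 0 ≤ ε) (ξ η : Base n)
    (hh : |h (ε • ξ) - F (ε • ξ)| ≤ K * ε ^ 2) :
    |F (ε • ξ + ε • η) - h (ε • ξ)| ≤
      (2 * C + K) * ε ^ 2 * ((1 + ‖ξ‖) * (1 + ‖η‖) ^ 2) := by
  obtain ⟨L, hL, ht⟩ := hF.tangent (ε • ξ)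
  have hC := hF.nonneg
  have h1 := ht (ε • η)
  rw [norm_smul, Real.norm_eq_abs, abs_of_nonneg hε] at hL h1
  have h2 : |L (ε • η)| ≤ C * (ε * ‖ξ‖) * (ε * ‖η‖) := by
    refine (L.le_opNorm _).trans ?_
    rw [norm_smul, Real.norm_eq_abs, abs_of_nonneg hε]
    gcongr
  have hKε : 0 ≤ K * ε ^ 2 := (abs_nonneg _).trans hh
  have h3 : |F (ε • ξ + ε • η) - h (ε • ξ)| ≤
      C * (ε * ‖η‖) ^ 2 + C * (ε * ‖ξ‖) * (ε * ‖η‖) + K * ε ^ 2 := by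
    have e : F (ε • ξ + ε • η) - h (ε • ξ) = (F (ε • ξ + ε • η) - F (ε • ξ) - L (ε • η)) +
      L (ε • η) - (h (ε • ξ) - F (ε • ξ)) := by ring
    rw [e]
    refine (abs_sub _ _).trans ?_
    refine add_le_add ((abs_add_le _ _).trans (add_le_add h1 h2)) hh
  refine h3.trans ?_
  have hx := norm_nonneg ξ
  have hy := norm_nonneg η
  have p1 : ‖η‖ ^ 2 ≤ (1 + ‖ξ‖) * (1 + ‖η‖) ^ 2 := by nlinarith [mul_nonneg hx (sq_nonneg (1 + ‖η‖))]
  have p2 : ‖ξ‖ * ‖η‖ ≤ (1 + ‖ξ‖) * (1 + ‖η‖) ^ 2 := by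
    gcongr
    · linarith
    · nlinarith
  have p3 : 1 ≤ (1 + ‖ξ‖) * (1 + ‖η‖) ^ 2 := by
    have := one_le_pow₀ (n := 2) (show 1 ≤ 1 + ‖η‖ by linarith)
    nlinarith
  have hCε : 0 ≤ C * ε ^ 2 := by positivity
  nlinarith [mul_le_mul_of_nonneg_left p1 hCε, mul_le_mul_of_nonneg_left p2 hCε,
    mul_le_mul_of_nonneg_left p3 hKε]

/-- The erf-mean of a small quantity, expanded to third order. -/
lemma abs_erf_expansion_le {V : Base n → ℝ} (hV : Measurable V) {B a : ℝ} {k : ℕ} (ha : 0 < a)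
    (h : ∀ ξ, |V ξ| ≤ B * a * (1 + ‖ξ‖) ^ k) :
    |∫ ξ, gaussPrimitive (V ξ / a) ∂(stdGaussian (Base n)) -
      (1 / a * ∫ ξ, V ξ ∂(stdGaussian (Base n)) -
        1 / (6 * a ^ 3) * ∫ ξ, V ξ ^ 3 ∂(stdGaussian (Base n)))| ≤
      B ^ 5 * gaussMoment n (k * 5) := by
  have i0 := integrable_gaussPrimitive_comp (hV.div_const a)
  have i1 : Integrable V (stdGaussian (Base n)) :=
    integrable_of_polynomial_bound hV.aestronglyMeasurable h
  have i3 : Integrable (fun ξ => V ξ ^ 3) (stdGaussian (Base n)) := by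
    refine integrable_of_polynomial_bound (C := (B * a) ^ 3) (m := k * 3)
      (hV.pow_const 3).aestronglyMeasurable fun ξ => ?_
    rw [abs_pow, pow_mul, ← mul_pow]
    gcongr
    exact h ξ
  rw [← integral_const_mul, ← integral_const_mul,
    ← integral_sub (i1.const_mul _) (i3.const_mul _),
    ← integral_sub i0 (by exact (i1.const_mul _).sub (i3.const_mul _))]
  refine abs_integral_le_gaussMoment fun ξ => ?_
  have h1 := abs_gaussPrimitive_sub_cubic_le (V ξ / a)
  have h2 : |V ξ / a| ≤ B * (1 + ‖ξ‖) ^ k := by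
    rw [abs_div, abs_of_pos ha, div_le_iff₀ ha]
    refine (h ξ).trans (le_of_eq (by ring))
  have h3 : V ξ / a - (V ξ / a) ^ 3 / 6 = 1 / a * V ξ - 1 / (6 * a ^ 3) * V ξ ^ 3 := by
    field_simp
  rw [h3] at h1
  refine h1.trans ?_
  have h4 : |V ξ / a| ^ 5 ≤ (B * (1 + ‖ξ‖) ^ k) ^ 5 := by gcongr
  rw [mul_pow, ← pow_mul] at h4
  have : 0 ≤ |V ξ / a| ^ 5 := by positivity
  linarith

/-- The height after the first step, extended by the original one away from the origin. -/
noncomputable def glue (ψ F : Base n → ℝ) (x : Base n) : ℝ :=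
  open Classical in if ‖x‖ ≤ 1 then ψ x else F x

lemma measurable_glue {ψ F : Base n → ℝ} (hψ : Measurable ψ) (hF : Measurable F) :
    Measurable (glue ψ F) :=
  Measurable.ite (measurableSet_le measurable_norm measurable_const) hψ hF

/-- Inside the unit ball the cubic expansion of `p` applies to the exact equation for `ψ`; the
fifth-order remainder, with argument `O(ε (1 + ‖ξ‖))`, fixes the weight `(1 + ‖ξ‖)⁵`. Outside, only
size estimates are used. An estimate valid for all `ξ` is needed because it will be averaged over
`ξ`. -/
lemma exists_halfStep {F f : Base n → ℝ} {A : Base n →L[ℝ] Base n} {C D₂ : ℝ}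
    (hF : GraphBounds F A C D₂) (hf : Continuous f) (hfF : ∀ x, ‖x‖ ≤ 2 → f x = F x) :
    ∃ K ε₀ : ℝ, 0 ≤ K ∧ 0 < ε₀ ∧ ε₀ ≤ 1 ∧ ∀ ε, 0 < ε → ε ≤ ε₀ → ∀ ψ : Base n → ℝ,
      Continuous ψ → (∀ x, erfMean f ε x (ψ x) = 0) → HalfStep F K ε (glue ψ F) := by
  obtain ⟨K, ε₀, hK, hε₀, hε₁, hb⟩ := exists_height_bound hF hf hfF
  have hC := hF.nonneg
  set B := 2 * C + K
  have hB : 0 ≤ B := by positivity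
  set m10 := gaussMoment n 10
  set m6 := gaussMoment n 6
  set m2 := gaussMoment n 2
  have hm10 : 1 ≤ m10 := one_le_gaussMoment 10
  have hm6 : 1 ≤ m6 := one_le_gaussMoment 6
  have hm2 : 1 ≤ m2 := one_le_gaussMoment 2
  -- The summands are the bound on the height, the quintic remainder and the localisation error
  -- (inside the unit ball), and the first and third moments (outside it).
  refine ⟨K + (B ^ 5 * m10 + 4 * m6 + B * m2 + B ^ 3 * m6), ε₀, by positivity, hε₀, hε₁,
    fun ε hε hε' ψ hψc hψ => ?_⟩
  have hε1 : ε ≤ 1 := hε'.trans hε₁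
  have hnear : ∀ x, |glue ψ F x - F x| ≤ K * ε ^ 2 := by
    intro x
    unfold glue
    split_ifs with hx
    · exact hb ε hε hε' ψ hψ x hx
    · rw [sub_self, abs_zero]; positivity
  have hFc := hF.continuous
  refine ⟨measurable_glue hψc.measurable hFc.measurable, fun x => (hnear x).trans ?_, fun ξ => ?_⟩
  · gcongr
    have : 0 ≤ B ^ 5 * m10 + 4 * m6 + B * m2 + B ^ 3 * m6 := by positivity
    linarith
  set W : Base n → ℝ := fun η => F (ε • ξ + ε • η) - glue ψ F (ε • ξ) with hWdef
  have hWm : Measurable W := by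
    have : Continuous W := by fun_prop
    exact this.measurable
  have hN : 1 ≤ 1 + ‖ξ‖ := by linarith [norm_nonneg ξ]
  have hW : ∀ η, |W η| ≤ B * ε ^ 2 * (1 + ‖ξ‖) * (1 + ‖η‖) ^ 2 := fun η => by
    rw [mul_assoc]
    exact abs_deviation_le hF hε.le ξ η (hnear _)
  change |∫ η, W η ∂_ - 1 / (6 * ε ^ 2) * ∫ η, W η ^ 3 ∂_| ≤ _
  by_cases hx : ‖ε • ξ‖ ≤ 1
  · have h1 := abs_erf_expansion_le hWm (B := B * ε * (1 + ‖ξ‖)) (a := ε) (k := 2) hε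
      (fun η => (hW η).trans (le_of_eq (by ring)))
    have h2 := abs_erfMean_sub_le hf hFc hfF hx hε.le (ψ (ε • ξ)) 6
    rw [hψ, zero_sub, abs_neg] at h2
    have h3 : ∫ η, gaussPrimitive (W η / ε) ∂(stdGaussian (Base n)) =
        erfMean F ε (ε • ξ) (ψ (ε • ξ)) := by
      unfold erfMean
      simp only [W, glue, if_pos hx]
    rw [h3] at h1
    have h4 : |1 / ε * ∫ η, W η ∂(stdGaussian (Base n)) -
        1 / (6 * ε ^ 3) * ∫ η, W η ^ 3 ∂(stdGaussian (Base n))| ≤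
        (B * ε * (1 + ‖ξ‖)) ^ 5 * m10 + 4 * ε ^ 6 * m6 := by
      have e : gaussMoment n (2 * 5) = m10 := rfl
      rw [e] at h1
      change _ ≤ 4 * ε ^ 6 * m6 at h2
      rw [abs_le] at h1 h2 ⊢
      constructor <;> linarith
    have h5 : ∫ η, W η ∂(stdGaussian (Base n)) -
        1 / (6 * ε ^ 2) * ∫ η, W η ^ 3 ∂(stdGaussian (Base n)) =
        ε * (1 / ε * ∫ η, W η ∂(stdGaussian (Base n)) -
        1 / (6 * ε ^ 3) * ∫ η, W η ^ 3 ∂(stdGaussian (Base n))) := by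
      field_simp
    rw [h5, abs_mul, abs_of_pos hε]
    have h6 := mul_le_mul_of_nonneg_left h4 hε.le
    refine h6.trans ?_
    have h7 : 1 ≤ (1 + ‖ξ‖) ^ 5 := one_le_pow₀ hN
    have h8 : ε * (4 * ε ^ 6 * m6) ≤ 4 * m6 * ε ^ 6 * (1 + ‖ξ‖) ^ 5 := by
      calc ε * (4 * ε ^ 6 * m6) ≤ 1 * (4 * ε ^ 6 * m6) := by gcongr
        _ = 4 * m6 * ε ^ 6 * 1 := by ring
        _ ≤ _ := by gcongr
    have h9 : 0 ≤ (K + B * m2 + B ^ 3 * m6) * ε ^ 6 * (1 + ‖ξ‖) ^ 5 := by positivity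
    nlinarith
  -- Where `‖εξ‖ > 1` the missing powers of `ε` are supplied by factors `ε (1 + ‖ξ‖) ≥ 1`: four for
  -- the mean, two for the cubic term.
  · have hx1 : 1 ≤ ε * (1 + ‖ξ‖) := by
      rw [norm_smul, Real.norm_eq_abs, abs_of_pos hε] at hx
      nlinarith
    have h1 := abs_integral_le_gaussMoment hW
    have h2 : |∫ η, W η ^ 3 ∂(stdGaussian (Base n))| ≤ (B * ε ^ 2 * (1 + ‖ξ‖)) ^ 3 * m6 := by
      refine abs_integral_le_gaussMoment (k := 6) fun η => ?_
      rw [abs_pow, show 6 = 2 * 3 from rfl, pow_mul, ← mul_pow]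
      gcongr
      exact hW η
    have h3 : |1 / (6 * ε ^ 2) * ∫ η, W η ^ 3 ∂(stdGaussian (Base n))| ≤
        B ^ 3 * ε ^ 4 * (1 + ‖ξ‖) ^ 3 * m6 := by
      rw [abs_mul, abs_of_pos (by positivity : 0 < 1 / (6 * ε ^ 2))]
      calc _ ≤ 1 / (6 * ε ^ 2) * ((B * ε ^ 2 * (1 + ‖ξ‖)) ^ 3 * m6) := by gcongr
        _ = (1 / 6) * (B ^ 3 * ε ^ 4 * (1 + ‖ξ‖) ^ 3 * m6) := by field_simp
        _ ≤ 1 * (B ^ 3 * ε ^ 4 * (1 + ‖ξ‖) ^ 3 * m6) := by gcongr; norm_num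
        _ = _ := one_mul _
    have h4 : B * ε ^ 2 * (1 + ‖ξ‖) * m2 ≤ B * m2 * ε ^ 6 * (1 + ‖ξ‖) ^ 5 := by
      calc _ = B * ε ^ 2 * (1 + ‖ξ‖) * m2 * 1 := (mul_one _).symm
        _ ≤ B * ε ^ 2 * (1 + ‖ξ‖) * m2 * (ε * (1 + ‖ξ‖)) ^ 4 := by
          gcongr; exact one_le_pow₀ hx1
        _ = _ := by ring
    have h5 : B ^ 3 * ε ^ 4 * (1 + ‖ξ‖) ^ 3 * m6 ≤ B ^ 3 * m6 * ε ^ 6 * (1 + ‖ξ‖) ^ 5 := by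
      calc _ = B ^ 3 * ε ^ 4 * (1 + ‖ξ‖) ^ 3 * m6 * 1 := (mul_one _).symm
        _ ≤ B ^ 3 * ε ^ 4 * (1 + ‖ξ‖) ^ 3 * m6 * (ε * (1 + ‖ξ‖)) ^ 2 := by
          gcongr; exact one_le_pow₀ hx1
        _ = _ := by ring
    refine (abs_sub _ _).trans ?_
    have h9 : 0 ≤ (K + B ^ 5 * m10 + 4 * m6) * ε ^ 6 * (1 + ‖ξ‖) ^ 5 := by positivity
    have h10 : |∫ η, W η ∂(stdGaussian (Base n))| ≤ B * ε ^ 2 * (1 + ‖ξ‖) * m2 := h1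
    nlinarith

end FirstStep

end TwoKernel

namespace TwoKernel

open ProbabilityTheory
open scoped RealInnerProductSpace

/-! ### Parity in third moments, and consequences of the graph bounds. -/

section SecondStep

/-- Third moments under a measure-preserving involution see the odd part only quadratically. -/
lemma abs_integral_pow_three_sub_le {Ω : Type*} [MeasurableSpace Ω] {μ : Measure Ω} {σ : Ω → Ω}
    (hσ : MeasurePreserving σ μ μ) (hσe : MeasurableEmbedding σ) {W w P : Ω → ℝ}
    (hW : AEStronglyMeasurable W μ) (hw : AEStronglyMeasurable w μ)
    (hP : Integrable (fun x => P x ^ 3) μ) {ε : ℝ} (hε : 0 < ε) (hε1 : ε ≤ 1)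
    (hwP : ∀ x, |w x| ≤ P x) (heven : ∀ x, |W x + W (σ x) - 2 * ε ^ 2 * w x| ≤ 2 * ε ^ 4 * P x)
    (hodd : ∀ x, |W x - W (σ x)| ≤ 2 * ε ^ 3 * P x) :
    |∫ x, W x ^ 3 ∂μ - ε ^ 6 * ∫ x, w x ^ 3 ∂μ| ≤ 13 * ε ^ 8 * ∫ x, P x ^ 3 ∂μ := by
  have hε43 : ε ^ 4 ≤ ε ^ 2 := pow_le_pow_of_le_one hε.le hε1 (by norm_num)
  have hε32 : ε ^ 3 ≤ ε ^ 2 := pow_le_pow_of_le_one hε.le hε1 (by norm_num)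
  have hε2 : ε ^ 2 ≤ 1 := pow_le_one₀ hε.le hε1
  have hP0 : ∀ x, 0 ≤ P x := fun x => (abs_nonneg _).trans (hwP x)
  have hWb : ∀ x, |W x| ≤ 3 * P x := fun x => by
    have h1 := abs_le.1 (heven x)
    have h2 := abs_le.1 (hodd x)
    have h3 := abs_le.1 (hwP x)
    have h4 := hP0 x
    have h5 := mul_le_mul_of_nonneg_right (hε43.trans hε2) h4
    have h6 := mul_le_mul_of_nonneg_right (hε32.trans hε2) h4
    have h7 : |ε ^ 2 * w x| ≤ P x := by
      rw [abs_mul, abs_of_nonneg (by positivity)]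
      nlinarith [hwP x, abs_nonneg (w x)]
    have h8 := abs_le.1 h7
    rw [abs_le]
    constructor <;> nlinarith
  have i1 : Integrable (fun x => W x ^ 3) μ := by
    refine (hP.const_mul 27).mono' (hW.pow 3) (ae_of_all _ fun x => ?_)
    rw [norm_pow, Real.norm_eq_abs]
    calc |W x| ^ 3 ≤ (3 * P x) ^ 3 := by gcongr; exact hWb x
      _ = _ := by ring
  have i2 : Integrable (fun x => W (σ x) ^ 3) μ := hσ.integrable_comp_of_integrable i1
  have i3 : Integrable (fun x => w x ^ 3) μ := by
    refine hP.mono' (hw.pow 3) (ae_of_all _ fun x => ?_)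
    rw [norm_pow, Real.norm_eq_abs]
    gcongr
    exact hwP x
  have h1 : ∫ x, W x ^ 3 ∂μ = ∫ x, (W x ^ 3 + W (σ x) ^ 3) / 2 ∂μ := by
    rw [integral_div, integral_add i1 i2, hσ.integral_comp hσe (fun x => W x ^ 3)]
    ring
  rw [h1, ← integral_const_mul, ← integral_const_mul,
    ← integral_sub (by exact (i1.add i2).div_const 2) (i3.const_mul _)]
  refine norm_integral_le_of_norm_le (f := fun x => (W x ^ 3 + W (σ x) ^ 3) / 2 - ε ^ 6 * w x ^ 3)
    (hP.const_mul _) (ae_of_all _ fun x => ?_)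
  rw [Real.norm_eq_abs]
  have hp := hP0 x
  set e := (W x + W (σ x)) / 2
  set o := (W x - W (σ x)) / 2
  set v := ε ^ 2 * w x
  have he : |e - v| ≤ ε ^ 4 * P x := by
    have : e - v = (W x + W (σ x) - 2 * ε ^ 2 * w x) / 2 := by simp only [e, v]; ring
    rw [this, abs_div, abs_two]
    linarith [heven x]
  have ho : |o| ≤ ε ^ 3 * P x := by
    simp only [o]
    rw [abs_div, abs_two]
    linarith [hodd x]
  have hv : |v| ≤ ε ^ 2 * P x := by
    simp only [v]
    rw [abs_mul, abs_of_nonneg (by positivity)]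
    gcongr
    exact hwP x
  have he2 : |e| ≤ 2 * (ε ^ 2 * P x) := by
    have h5 := mul_le_mul_of_nonneg_right hε43 hp
    have h6 := abs_add_le (e - v) v
    rw [sub_add_cancel] at h6
    linarith
  -- With even part `e`, odd part `o` and leading term `v = ε² w`, the symmetrised cube is `e³ + 3 e
  -- o²`. The difference `e³ - v³` costs `7 ε⁸ P³` and the odd part `6 ε⁸ P³`, which gives the
  -- constant `13`.
  have hid : (W x ^ 3 + W (σ x) ^ 3) / 2 - ε ^ 6 * w x ^ 3 =
      (e - v) * (e ^ 2 + e * v + v ^ 2) + 3 * e * o ^ 2 := by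
    simp only [e, o, v]; ring
  rw [hid]
  have hq : |e ^ 2 + e * v + v ^ 2| ≤ 7 * (ε ^ 2 * P x) ^ 2 := by
    refine (abs_add_le _ _).trans ?_
    have := abs_add_le (e ^ 2) (e * v)
    rw [abs_mul, abs_pow] at this
    rw [abs_pow]
    have t1 : |e| ^ 2 ≤ (2 * (ε ^ 2 * P x)) ^ 2 := by gcongr
    have t2 : |e| * |v| ≤ (2 * (ε ^ 2 * P x)) * (ε ^ 2 * P x) := by gcongr
    have t3 : |v| ^ 2 ≤ (ε ^ 2 * P x) ^ 2 := by gcongr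
    nlinarith
  refine (abs_add_le _ _).trans ?_
  rw [abs_mul, abs_mul, abs_mul, abs_pow, abs_of_pos (by norm_num : (0:ℝ) < 3)]
  have t1 : |e - v| * |e ^ 2 + e * v + v ^ 2| ≤ (ε ^ 4 * P x) * (7 * (ε ^ 2 * P x) ^ 2) := by
    gcongr
  have t2 : 3 * |e| * |o| ^ 2 ≤ 3 * (2 * (ε ^ 2 * P x)) * (ε ^ 3 * P x) ^ 2 := by gcongr
  calc _ ≤ (ε ^ 4 * P x) * (7 * (ε ^ 2 * P x) ^ 2) +
        3 * (2 * (ε ^ 2 * P x)) * (ε ^ 3 * P x) ^ 2 := add_le_add t1 t2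
    _ = _ := by ring

variable {n : ℕ} {F : Base n → ℝ} {A : Base n →L[ℝ] Base n} {C D₂ : ℝ}

namespace GraphBounds

/-- The even estimate at `x = 0` reads `|2 F 0| ≤ 0`. -/
lemma zero (hF : GraphBounds F A C D₂) : F 0 = 0 := by
  have := hF.even 0
  simp only [neg_zero, map_zero, inner_zero_left, norm_zero] at this
  have h2 := abs_nonpos_iff.1 (this.trans (by norm_num))
  linarith

/-- At the origin the bound `‖L‖ ≤ C ‖0‖` forces the tangent map to vanish, so the tangent estimate
there is purely quadratic. -/
lemma abs_le (hF : GraphBounds F A C D₂) (x : Base n) : |F x| ≤ C * ‖x‖ ^ 2 := by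
  obtain ⟨L, hL, ht⟩ := hF.tangent 0
  rw [norm_zero, mul_zero, norm_le_zero_iff] at hL
  have := ht x
  rwa [hL, zero_add, hF.zero, sub_zero, _root_.zero_apply, sub_zero] at this

lemma abs_smul_le (hF : GraphBounds F A C D₂) {a : ℝ} (ξ : Base n) :
    |F (a • ξ)| ≤ C * a ^ 2 * (1 + ‖ξ‖) ^ 2 := by
  refine (hF.abs_le _).trans ?_
  rw [norm_smul, mul_pow, Real.norm_eq_abs, sq_abs, mul_assoc]
  have := hF.nonneg
  gcongr
  linarith

lemma integrable_smul (hF : GraphBounds F A C D₂) (a : ℝ) :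
    Integrable (fun ξ => F (a • ξ)) (stdGaussian (Base n)) := by
  have := hF.continuous
  exact integrable_of_polynomial_bound (by fun_prop) fun ξ => hF.abs_smul_le ξ

lemma integrable_add_smul (hF : GraphBounds F A C D₂) (x : Base n) (a : ℝ) :
    Integrable (fun η => F (x + a • η)) (stdGaussian (Base n)) := by
  have hc := hF.continuous
  have hC := hF.nonneg
  refine integrable_of_polynomial_bound (C := C * (‖x‖ + |a|) ^ 2) (m := 2) (by fun_prop)
    fun η => ?_
  refine (hF.abs_le _).trans ?_
  rw [mul_assoc, ← mul_pow]
  gcongr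
  refine (norm_add_le _ _).trans ?_
  rw [norm_smul, Real.norm_eq_abs]
  nlinarith [norm_nonneg x, norm_nonneg η, abs_nonneg a]

end GraphBounds

lemma norm_add_le_weights (ξ η : Base n) : ‖ξ + η‖ ≤ (1 + ‖ξ‖) * (1 + ‖η‖) := by
  refine (norm_add_le _ _).trans ?_
  nlinarith [norm_nonneg ξ, norm_nonneg η]

/-- In the expansion the cross term and the centred form have mean zero. This yields the leading
profile `ε² (⟪Aξ, ξ⟫ + tr A)/2` of the height after the half step. -/
lemma integral_quadratic_add (A : Base n →L[ℝ] Base n) (hA : ∀ x y, ⟪A x, y⟫ = ⟪x, A y⟫)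
    (ξ : Base n) :
    Integrable (fun η => ⟪A (ξ + η), ξ + η⟫) (stdGaussian (Base n)) ∧
    ∫ η, ⟪A (ξ + η), ξ + η⟫ ∂(stdGaussian (Base n)) =
      ⟪A ξ, ξ⟫ + LinearMap.trace ℝ (Base n) A := by
  obtain ⟨Cq, hCq, hq⟩ := exists_centredForm_bound A
  have i1 : Integrable (centredForm A) (stdGaussian (Base n)) :=
    integrable_of_polynomial_bound (continuous_centredForm A).aestronglyMeasurable hq
  have i2 : Integrable (fun η => ⟪η, A ξ⟫) (stdGaussian (Base n)) := by
    refine integrable_of_polynomial_bound (C := ‖A ξ‖) (m := 1) (by fun_prop) fun η => ?_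
    refine (abs_real_inner_le_norm _ _).trans ?_
    nlinarith [norm_nonneg (A ξ), norm_nonneg η]
  have h : ∀ η, ⟪A (ξ + η), ξ + η⟫ = ⟪A ξ, ξ⟫ + LinearMap.trace ℝ (Base n) A + 2 * ⟪η, A ξ⟫ +
      2 * centredForm A η := by
    intro η
    unfold centredForm
    rw [map_add, inner_add_left, inner_add_right, inner_add_right, hA η ξ, real_inner_comm η (A ξ)]
    ring
  have j := ((integrable_const (μ := stdGaussian (Base n))
    (⟪A ξ, ξ⟫ + LinearMap.trace ℝ (Base n) A)).add (i2.const_mul 2)).add (i1.const_mul 2)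
  simp_rw [h]
  refine ⟨j, ?_⟩
  rw [integral_add (by exact (integrable_const _).add (i2.const_mul 2)) (i1.const_mul 2),
    integral_add (integrable_const _) (i2.const_mul 2), integral_const_mul, integral_const_mul,
    integral_centredForm, integral_inner_stdGaussian]
  simp

/-- The Gaussian mean of `F` near the origin, separated by parity. -/
lemma mean_parity (hF : GraphBounds F A C D₂) {ε : ℝ} (hε : 0 ≤ ε) (ξ : Base n) :
    |∫ η, F (ε • ξ + ε • η) ∂(stdGaussian (Base n)) +
      ∫ η, F (ε • (-ξ) + ε • η) ∂(stdGaussian (Base n)) -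
      ε ^ 2 * (⟪A ξ, ξ⟫ + LinearMap.trace ℝ (Base n) A)| ≤
        C * ε ^ 4 * (1 + ‖ξ‖) ^ 4 * gaussMoment n 4 ∧
    |∫ η, F (ε • ξ + ε • η) ∂(stdGaussian (Base n)) -
      ∫ η, F (ε • (-ξ) + ε • η) ∂(stdGaussian (Base n))| ≤
        C * ε ^ 3 * (1 + ‖ξ‖) ^ 3 * gaussMoment n 3 := by
  have hC := hF.nonneg
  have hneg : ∫ η, F (ε • (-ξ) + ε • η) ∂(stdGaussian (Base n)) =
      ∫ η, F (-(ε • (ξ + η))) ∂(stdGaussian (Base n)) := by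
    rw [← integral_stdGaussian_neg]
    congr 1; ext η; congr 1
    simp only [smul_neg, smul_add]
    abel
  have hpos : ∀ η, F (ε • ξ + ε • η) = F (ε • (ξ + η)) := fun η => by rw [smul_add]
  have i1 : Integrable (fun η => F (ε • (ξ + η))) (stdGaussian (Base n)) := by
    simpa only [smul_add] using hF.integrable_add_smul (ε • ξ) ε
  have i2 : Integrable (fun η => F (-(ε • (ξ + η)))) (stdGaussian (Base n)) := by
    have := hF.integrable_add_smul (-(ε • ξ)) (-ε)
    refine this.congr (ae_of_all _ fun η => ?_)
    simp only [smul_add, neg_smul, neg_add]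
  obtain ⟨i3, hquad⟩ := integral_quadratic_add A hF.symm ξ
  have hw : ∀ (η : Base n) (k : ℕ), ‖ε • (ξ + η)‖ ^ k ≤ ε ^ k * (1 + ‖ξ‖) ^ k * (1 + ‖η‖) ^ k := by
    intro η k
    rw [← mul_pow, ← mul_pow, norm_smul, Real.norm_eq_abs, abs_of_nonneg hε, mul_assoc]
    gcongr
    exact norm_add_le_weights ξ η
  rw [hneg]
  simp_rw [hpos]
  constructor
  · rw [← hquad, ← integral_const_mul, ← integral_add i1 i2,
      ← integral_sub (by exact i1.add i2) (i3.const_mul _)]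
    refine abs_integral_le_gaussMoment fun η => ?_
    have h1 := hF.even (ε • (ξ + η))
    have h2 : ⟪A (ε • (ξ + η)), ε • (ξ + η)⟫ = ε ^ 2 * ⟪A (ξ + η), ξ + η⟫ := by
      rw [map_smul, real_inner_smul_left, real_inner_smul_right]; ring
    rw [h2] at h1
    refine h1.trans ?_
    calc _ ≤ C * (ε ^ 4 * (1 + ‖ξ‖) ^ 4 * (1 + ‖η‖) ^ 4) := by gcongr; exact hw η 4
      _ = _ := by ring
  · rw [← integral_sub i1 i2]
    refine abs_integral_le_gaussMoment fun η => ?_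
    refine (hF.odd (ε • (ξ + η))).trans ?_
    calc _ ≤ C * (ε ^ 3 * (1 + ‖ξ‖) ^ 3 * (1 + ‖η‖) ^ 3) := by gcongr; exact hw η 3
      _ = _ := by ring

end SecondStep

end TwoKernel

namespace TwoKernel

open ProbabilityTheory
open scoped RealInnerProductSpace

/-! ### The cubic correction in the half step. -/

section SecondStep

variable {n : ℕ} {F : Base n → ℝ} {A : Base n →L[ℝ] Base n} {C D₂ : ℝ}

set_option maxHeartbeats 200000 in
/-- The third moment of the deviation `F(εξ + εη) - h(εξ)`. -/
lemma exists_deviation_pow_three (hF : GraphBounds F A C D₂) {E2 : ℝ} (hE2 : 0 ≤ E2) :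
    ∃ I, 0 ≤ I ∧ ∀ ε, 0 < ε → ε ≤ 1 → ∀ h : Base n → ℝ, Measurable h →
      (∀ ξ, |h (ε • ξ) + h (ε • (-ξ)) - ε ^ 2 * (⟪A ξ, ξ⟫ + LinearMap.trace ℝ (Base n) A)| ≤
        E2 * ε ^ 4 * (1 + ‖ξ‖) ^ 5) →
      (∀ ξ, |h (ε • ξ) - h (ε • (-ξ))| ≤ E2 * ε ^ 3 * (1 + ‖ξ‖) ^ 5) →
      |∫ q : Base n × Base n, (F (ε • q.1 + ε • q.2) - h (ε • q.1)) ^ 3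
          ∂((stdGaussian (Base n)).prod (stdGaussian (Base n))) -
        ε ^ 6 * (4 * LinearMap.trace ℝ (Base n) (A * A * A : Base n →L[ℝ] Base n))| ≤
        13 * ε ^ 8 * I := by
  have hC := hF.nonneg
  have hFc := hF.continuous
  set γ := stdGaussian (Base n) with hγ
  obtain ⟨Cq, hCq, hq⟩ := exists_centredForm_bound A
  set D := C + E2 + ‖A‖ + Cq with hDdef
  have hD : 0 ≤ D := by positivity
  set I := ∫ q : Base n × Base n, (D * ((1 + ‖q.1‖) ^ 5 * (1 + ‖q.2‖) ^ 5)) ^ 3 ∂(γ.prod γ)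
  have hI : 0 ≤ I := integral_nonneg fun q => by positivity
  refine ⟨I, hI, fun ε hε hε1 h hhm heven hodd => ?_⟩
  have one_le : ∀ x : Base n, 1 ≤ 1 + ‖x‖ := fun x => by linarith [norm_nonneg x]
  have hpi : ∀ k l : ℕ, Integrable (fun q : Base n × Base n => (1 + ‖q.1‖) ^ k * (1 + ‖q.2‖) ^ l)
      (γ.prod γ) := fun k l =>
    (integrable_one_add_norm_pow k).mul_prod (integrable_one_add_norm_pow l)
  have hWm : Measurable fun q : Base n × Base n => F (ε • q.1 + ε • q.2) - h (ε • q.1) := by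
    have h1 : Measurable fun q : Base n × Base n => F (ε • q.1 + ε • q.2) := by
      have : Continuous fun q : Base n × Base n => F (ε • q.1 + ε • q.2) := by fun_prop
      exact this.measurable
    exact h1.sub (hhm.comp (measurable_fst.const_smul ε))
  rw [← integral_prod_pow_three hF.symm]
  have hneg := measurePreserving_neg_stdGaussian (E := Base n)
  -- The measure-preserving map is the joint reflection `(ξ, η) ↦ (-ξ, -η)`, and the leading profile
  -- is `⟪ξ, Aη⟫ + q(η)`.
  refine abs_integral_pow_three_sub_le (hneg.prod hneg)
    ((Homeomorph.neg (Base n)).measurableEmbedding.prodMap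
      (Homeomorph.neg (Base n)).measurableEmbedding)
    hWm.aestronglyMeasurable ?_ ?_ hε hε1 (fun q => ?_) (fun q => ?_) (fun q => ?_)
  · have := continuous_centredForm A
    exact Continuous.aestronglyMeasurable (by fun_prop)
  · refine ((hpi 15 15).const_mul (D ^ 3)).congr (ae_of_all _ fun q => ?_)
    simp only [mul_pow, ← pow_mul]
  · obtain ⟨ξ, η⟩ := q
    simp only
    have hN := one_le ξ
    have hM := one_le η
    have t1 : |⟪ξ, A η⟫| ≤ ‖A‖ * ((1 + ‖ξ‖) ^ 5 * (1 + ‖η‖) ^ 5) := by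
      calc _ ≤ ‖ξ‖ * ‖A η‖ := abs_real_inner_le_norm _ _
        _ ≤ (1 + ‖ξ‖) * (‖A‖ * (1 + ‖η‖)) := by
          gcongr
          · linarith
          · exact (A.le_opNorm η).trans (by gcongr; linarith)
        _ ≤ (1 + ‖ξ‖) ^ 5 * (‖A‖ * (1 + ‖η‖) ^ 5) := by
          gcongr
          · exact le_self_pow₀ hN (by norm_num)
          · exact le_self_pow₀ hM (by norm_num)
        _ = _ := by ring
    have t2 : |centredForm A η| ≤ Cq * ((1 + ‖ξ‖) ^ 5 * (1 + ‖η‖) ^ 5) := by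
      refine (hq η).trans ?_
      gcongr
      calc (1 + ‖η‖) ^ 2 ≤ (1 + ‖η‖) ^ 5 := pow_le_pow_right₀ hM (by norm_num)
        _ ≤ _ := le_mul_of_one_le_left (by positivity) (one_le_pow₀ hN)
    have t3 : 0 ≤ (C + E2) * ((1 + ‖ξ‖) ^ 5 * (1 + ‖η‖) ^ 5) := by positivity
    refine (abs_add_le _ _).trans ?_
    generalize (1 + ‖ξ‖) ^ 5 * (1 + ‖η‖) ^ 5 = Z at *
    rw [hDdef]
    linarith
  · obtain ⟨ξ, η⟩ := q
    simp only [Prod.map]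
    have hN := one_le ξ
    have hM := one_le η
    have h1 := hF.even (ε • (ξ + η))
    have h2 : ⟪A (ε • (ξ + η)), ε • (ξ + η)⟫ = ε ^ 2 * ⟪A (ξ + η), ξ + η⟫ := by
      rw [map_smul, real_inner_smul_left, real_inner_smul_right]; ring
    -- Subtracting the leading height `⟪Aξ, ξ⟫ + tr A` leaves exactly twice the profile whose third
    -- moment is known.
    have h3 : ⟪A (ξ + η), ξ + η⟫ = ⟪A ξ, ξ⟫ + LinearMap.trace ℝ (Base n) A +
        2 * (⟪ξ, A η⟫ + centredForm A η) := by
      unfold centredForm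
      rw [map_add, inner_add_left, inner_add_right, inner_add_right, hF.symm ξ η,
        hF.symm η ξ, real_inner_comm (A ξ) η, hF.symm ξ η]
      ring
    rw [h2, h3] at h1
    have h4 := heven ξ
    have e1 : ε • ξ + ε • η = ε • (ξ + η) := (smul_add _ _ _).symm
    have e2 : ε • -ξ + ε • -η = -(ε • (ξ + η)) := by
      simp only [smul_neg, smul_add, neg_add]
    rw [e1, e2]
    have w1 : C * ‖ε • (ξ + η)‖ ^ 4 ≤ C * ε ^ 4 * ((1 + ‖ξ‖) ^ 5 * (1 + ‖η‖) ^ 5) := by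
      rw [norm_smul, mul_pow, Real.norm_eq_abs, abs_of_pos hε, mul_assoc]
      gcongr
      calc ‖ξ + η‖ ^ 4 ≤ ((1 + ‖ξ‖) * (1 + ‖η‖)) ^ 4 := by
            gcongr; exact norm_add_le_weights ξ η
        _ = (1 + ‖ξ‖) ^ 4 * (1 + ‖η‖) ^ 4 := mul_pow _ _ _
        _ ≤ _ := by
          gcongr <;> norm_num
    have w2 : E2 * ε ^ 4 * (1 + ‖ξ‖) ^ 5 ≤ E2 * ε ^ 4 * ((1 + ‖ξ‖) ^ 5 * (1 + ‖η‖) ^ 5) := by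
      gcongr
      exact le_mul_of_one_le_right (by positivity) (one_le_pow₀ hM)
    have w3 : 0 ≤ (C + E2 + 2 * (‖A‖ + Cq)) * ε ^ 4 * ((1 + ‖ξ‖) ^ 5 * (1 + ‖η‖) ^ 5) := by
      positivity
    rw [hDdef]
    rw [_root_.abs_le] at h1 h4 ⊢
    generalize (1 + ‖ξ‖) ^ 5 * (1 + ‖η‖) ^ 5 = Z at *
    generalize (1 + ‖ξ‖) ^ 5 = Z' at *
    constructor <;> linarith
  · obtain ⟨ξ, η⟩ := q
    simp only [Prod.map]
    have hN := one_le ξ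
    have hM := one_le η
    have h1 := hF.odd (ε • (ξ + η))
    have h4 := hodd ξ
    have e1 : ε • ξ + ε • η = ε • (ξ + η) := (smul_add _ _ _).symm
    have e2 : ε • -ξ + ε • -η = -(ε • (ξ + η)) := by
      simp only [smul_neg, smul_add, neg_add]
    rw [e1, e2]
    have w1 : C * ‖ε • (ξ + η)‖ ^ 3 ≤ C * ε ^ 3 * ((1 + ‖ξ‖) ^ 5 * (1 + ‖η‖) ^ 5) := by
      rw [norm_smul, mul_pow, Real.norm_eq_abs, abs_of_pos hε, mul_assoc]
      gcongr
      calc ‖ξ + η‖ ^ 3 ≤ ((1 + ‖ξ‖) * (1 + ‖η‖)) ^ 3 := by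
            gcongr; exact norm_add_le_weights ξ η
        _ = (1 + ‖ξ‖) ^ 3 * (1 + ‖η‖) ^ 3 := mul_pow _ _ _
        _ ≤ _ := by
          gcongr <;> norm_num
    have w2 : E2 * ε ^ 3 * (1 + ‖ξ‖) ^ 5 ≤ E2 * ε ^ 3 * ((1 + ‖ξ‖) ^ 5 * (1 + ‖η‖) ^ 5) := by
      gcongr
      exact le_mul_of_one_le_right (by positivity) (one_le_pow₀ hM)
    have w3 : 0 ≤ (C + E2 + 2 * (‖A‖ + Cq)) * ε ^ 3 * ((1 + ‖ξ‖) ^ 5 * (1 + ‖η‖) ^ 5) := by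
      positivity
    rw [hDdef]
    rw [_root_.abs_le] at h1 h4 ⊢
    generalize (1 + ‖ξ‖) ^ 5 * (1 + ‖η‖) ^ 5 = Z at *
    generalize (1 + ‖ξ‖) ^ 5 = Z' at *
    constructor <;> linarith

end SecondStep

end TwoKernel

namespace TwoKernel

open ProbabilityTheory
open scoped RealInnerProductSpace

/-! ### The height after the half step: parity and Gaussian mean. -/

section SecondStep

variable {n : ℕ} {F : Base n → ℝ} {A : Base n →L[ℝ] Base n} {C D₂ : ℝ}

set_option maxHeartbeats 400000 in
/-- The height after the first step, separated by parity, and its Gaussian mean. -/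
lemma exists_halfStep_expansion (hF : GraphBounds F A C D₂) (K : ℝ) (hK : 0 ≤ K) :
    ∃ C', 0 ≤ C' ∧ ∀ ε, 0 < ε → ε ≤ 1 → ∀ h, HalfStep F K ε h →
      (∀ ξ, |h (ε • ξ) + h (ε • (-ξ)) - ε ^ 2 * (⟪A ξ, ξ⟫ + LinearMap.trace ℝ (Base n) A)| ≤
        C' * ε ^ 4 * (1 + ‖ξ‖) ^ 5) ∧
      (∀ ξ, |h (ε • ξ) - h (ε • (-ξ))| ≤ C' * ε ^ 3 * (1 + ‖ξ‖) ^ 5) ∧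
      |∫ ξ, F ((√2 * ε) • ξ) ∂(stdGaussian (Base n)) - ∫ ξ, h (ε • ξ) ∂(stdGaussian (Base n)) -
        2 / 3 * ε ^ 4 * LinearMap.trace ℝ (Base n) (A * A * A : Base n →L[ℝ] Base n)| ≤
        C' * ε ^ 6 := by
  set γ := stdGaussian (Base n) with hγ
  set τ := LinearMap.trace ℝ (Base n) (A * A * A : Base n →L[ℝ] Base n)
  have hC := hF.nonneg
  have hFc := hF.continuous
  set B := 2 * C + K
  have hB : 0 ≤ B := by positivity
  set m6 := gaussMoment n 6
  set m5 := gaussMoment n 5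
  set m4 := gaussMoment n 4
  set m3 := gaussMoment n 3
  have hm6 : 1 ≤ m6 := one_le_gaussMoment 6
  have hm5 : 1 ≤ m5 := one_le_gaussMoment 5
  have hm4 : 1 ≤ m4 := one_le_gaussMoment 4
  have hm3 : 1 ≤ m3 := one_le_gaussMoment 3
  set E1 := K + B ^ 3 * m6
  have hE1 : 0 ≤ E1 := by positivity
  set E2 := C * m4 + C * m3 + 2 * E1
  have hE2 : 0 ≤ E2 := by positivity
  obtain ⟨I, hI, hIb⟩ := exists_deviation_pow_three hF hE2
  refine ⟨E2 + (K * m5 + 13 * I), by positivity, fun ε hε hε1 h hh => ?_⟩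
  have hhm := hh.measurable
  have hε64 : ε ^ 6 ≤ ε ^ 4 := pow_le_pow_of_le_one hε.le hε1 (by norm_num)
  have hε43 : ε ^ 4 ≤ ε ^ 3 := pow_le_pow_of_le_one hε.le hε1 (by norm_num)
  set W : Base n × Base n → ℝ := fun q => F (ε • q.1 + ε • q.2) - h (ε • q.1) with hWdef
  have hWm : Measurable W := by
    have h1 : Measurable fun q : Base n × Base n => F (ε • q.1 + ε • q.2) := by
      have : Continuous fun q : Base n × Base n => F (ε • q.1 + ε • q.2) := by fun_prop
      exact this.measurable
    exact h1.sub (hhm.comp (measurable_fst.const_smul ε))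
  have hWb : ∀ q, |W q| ≤ B * ε ^ 2 * ((1 + ‖q.1‖) * (1 + ‖q.2‖) ^ 2) := fun q =>
    abs_deviation_le hF hε.le q.1 q.2 (hh.near _)
  have one_le : ∀ x : Base n, 1 ≤ 1 + ‖x‖ := fun x => by linarith [norm_nonneg x]
  -- the mean of `F` against `h`
  have hmean : ∀ ξ, |∫ η, F (ε • ξ + ε • η) ∂γ - h (ε • ξ)| ≤ E1 * ε ^ 4 * (1 + ‖ξ‖) ^ 5 := by
    intro ξ
    have h1 := hh.balance ξ
    have h2 : |∫ η, (F (ε • ξ + ε • η) - h (ε • ξ)) ^ 3 ∂γ| ≤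
        (B * ε ^ 2 * (1 + ‖ξ‖)) ^ 3 * m6 := by
      refine abs_integral_le_gaussMoment (k := 6) fun η => ?_
      rw [abs_pow, show 6 = 2 * 3 from rfl, pow_mul, ← mul_pow]
      gcongr
      exact (hWb (ξ, η)).trans (le_of_eq (by ring))
    have h3 : |1 / (6 * ε ^ 2) * ∫ η, (F (ε • ξ + ε • η) - h (ε • ξ)) ^ 3 ∂γ| ≤
        B ^ 3 * m6 * ε ^ 4 * (1 + ‖ξ‖) ^ 5 := by
      rw [abs_mul, abs_of_pos (by positivity : 0 < 1 / (6 * ε ^ 2))]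
      calc _ ≤ 1 / (6 * ε ^ 2) * ((B * ε ^ 2 * (1 + ‖ξ‖)) ^ 3 * m6) := by gcongr
        _ = (1 / 6) * (B ^ 3 * m6 * ε ^ 4 * (1 + ‖ξ‖) ^ 3) := by field_simp
        _ ≤ 1 * (B ^ 3 * m6 * ε ^ 4 * (1 + ‖ξ‖) ^ 5) := by
          gcongr
          · norm_num
          · exact one_le ξ
          · norm_num
        _ = _ := one_mul _
    rw [integral_sub (hF.integrable_add_smul _ _) (integrable_const _)] at h1
    simp only [integral_const, probReal_univ, one_smul] at h1
    have h4 : K * ε ^ 6 * (1 + ‖ξ‖) ^ 5 ≤ K * ε ^ 4 * (1 + ‖ξ‖) ^ 5 := by gcongr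
    have e : E1 * ε ^ 4 * (1 + ‖ξ‖) ^ 5 =
        K * ε ^ 4 * (1 + ‖ξ‖) ^ 5 + B ^ 3 * m6 * ε ^ 4 * (1 + ‖ξ‖) ^ 5 := by
      simp only [E1]; ring
    rw [e]
    rw [_root_.abs_le] at h1 h3 ⊢
    constructor <;> linarith
  have hheven : ∀ ξ, |h (ε • ξ) + h (ε • (-ξ)) -
      ε ^ 2 * (⟪A ξ, ξ⟫ + LinearMap.trace ℝ (Base n) A)| ≤ E2 * ε ^ 4 * (1 + ‖ξ‖) ^ 5 := by
    intro ξ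
    have h1 := hmean ξ
    have h2 := hmean (-ξ)
    rw [norm_neg] at h2
    have h3 := (mean_parity hF hε.le ξ).1
    have h4 : C * ε ^ 4 * (1 + ‖ξ‖) ^ 4 * gaussMoment n 4 ≤ C * m4 * ε ^ 4 * (1 + ‖ξ‖) ^ 5 := by
      calc _ = C * m4 * ε ^ 4 * (1 + ‖ξ‖) ^ 4 := by simp only [m4]; ring
        _ ≤ _ := by
          gcongr
          · exact one_le ξ
          · norm_num
    have h5 : 0 ≤ C * m3 * ε ^ 4 * (1 + ‖ξ‖) ^ 5 := by positivity
    have e : E2 * ε ^ 4 * (1 + ‖ξ‖) ^ 5 = C * m4 * ε ^ 4 * (1 + ‖ξ‖) ^ 5 +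
        C * m3 * ε ^ 4 * (1 + ‖ξ‖) ^ 5 + 2 * (E1 * ε ^ 4 * (1 + ‖ξ‖) ^ 5) := by
      simp only [E2]; ring
    rw [e]
    rw [_root_.abs_le] at h1 h2 h3 ⊢
    constructor <;> linarith
  have hhodd : ∀ ξ, |h (ε • ξ) - h (ε • (-ξ))| ≤ E2 * ε ^ 3 * (1 + ‖ξ‖) ^ 5 := by
    intro ξ
    have h1 := hmean ξ
    have h2 := hmean (-ξ)
    rw [norm_neg] at h2
    have h3 := (mean_parity hF hε.le ξ).2
    have h4 : C * ε ^ 3 * (1 + ‖ξ‖) ^ 3 * gaussMoment n 3 ≤ C * m3 * ε ^ 3 * (1 + ‖ξ‖) ^ 5 := by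
      calc _ = C * m3 * ε ^ 3 * (1 + ‖ξ‖) ^ 3 := by simp only [m3]; ring
        _ ≤ _ := by
          gcongr
          · exact one_le ξ
          · norm_num
    have h5 : 0 ≤ C * m4 * ε ^ 3 * (1 + ‖ξ‖) ^ 5 := by positivity
    have h6 : E1 * ε ^ 4 * (1 + ‖ξ‖) ^ 5 ≤ E1 * ε ^ 3 * (1 + ‖ξ‖) ^ 5 := by gcongr
    have e : E2 * ε ^ 3 * (1 + ‖ξ‖) ^ 5 = C * m4 * ε ^ 3 * (1 + ‖ξ‖) ^ 5 +
        C * m3 * ε ^ 3 * (1 + ‖ξ‖) ^ 5 + 2 * (E1 * ε ^ 3 * (1 + ‖ξ‖) ^ 5) := by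
      simp only [E2]; ring
    rw [e]
    rw [_root_.abs_le] at h1 h2 h3 ⊢
    constructor <;> linarith
  have hgap : 0 ≤ K * m5 + 13 * I := by positivity
  refine ⟨fun ξ => (hheven ξ).trans ?_, fun ξ => (hhodd ξ).trans ?_, ?_⟩
  · gcongr; linarith
  · gcongr; linarith
  -- the mean of `h`
  have hpi : ∀ k l : ℕ, Integrable (fun q : Base n × Base n => (1 + ‖q.1‖) ^ k * (1 + ‖q.2‖) ^ l)
      (γ.prod γ) := fun k l =>
    (integrable_one_add_norm_pow k).mul_prod (integrable_one_add_norm_pow l)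
  have iW : Integrable W (γ.prod γ) := by
    refine ((hpi 1 2).const_mul (B * ε ^ 2)).mono' hWm.aestronglyMeasurable
      (ae_of_all _ fun q => ?_)
    rw [pow_one]
    exact hWb q
  have iW3 : Integrable (fun q => W q ^ 3) (γ.prod γ) := by
    refine ((hpi 3 6).const_mul ((B * ε ^ 2) ^ 3)).mono' (hWm.pow_const 3).aestronglyMeasurable
      (ae_of_all _ fun q => ?_)
    rw [norm_pow, Real.norm_eq_abs]
    calc |W q| ^ 3 ≤ (B * ε ^ 2 * ((1 + ‖q.1‖) * (1 + ‖q.2‖) ^ 2)) ^ 3 := by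
          gcongr; exact hWb q
      _ = _ := by ring
  -- The pointwise equation of the half step, averaged over `ξ`.
  have hbal : |∫ q, W q ∂(γ.prod γ) - 1 / (6 * ε ^ 2) * ∫ q, W q ^ 3 ∂(γ.prod γ)| ≤
      K * ε ^ 6 * m5 := by
    rw [integral_prod _ iW, integral_prod _ iW3, ← integral_const_mul,
      ← integral_sub iW.integral_prod_left (iW3.integral_prod_left.const_mul _)]
    exact abs_integral_le_gaussMoment hh.balance
  have hWint : ∫ q, W q ∂(γ.prod γ) = ∫ ξ, F ((√2 * ε) • ξ) ∂γ - ∫ ξ, h (ε • ξ) ∂γ := by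
    have j1 : Integrable (fun q : Base n × Base n => F (ε • q.1 + ε • q.2)) (γ.prod γ) := by
      refine ((hpi 2 2).const_mul (C * ε ^ 2)).mono' (by fun_prop) (ae_of_all _ fun q => ?_)
      rw [Real.norm_eq_abs, ← smul_add]
      refine (hF.abs_le _).trans ?_
      rw [norm_smul, mul_pow, Real.norm_eq_abs, sq_abs, mul_assoc]
      have h1 : ‖q.1 + q.2‖ ^ 2 ≤ (1 + ‖q.1‖) ^ 2 * (1 + ‖q.2‖) ^ 2 := by
        rw [← mul_pow]
        gcongr
        exact norm_add_le_weights _ _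
      gcongr
    have j2 : Integrable (fun ξ => h (ε • ξ)) γ := by
      refine integrable_of_polynomial_bound (C := C * ε ^ 2 + K * ε ^ 2) (m := 2)
        (hhm.comp (measurable_const_smul ε)).aestronglyMeasurable fun ξ => ?_
      have h1 := hh.near (ε • ξ)
      have h2 := hF.abs_smul_le (a := ε) ξ
      have h3 : K * ε ^ 2 * 1 ≤ K * ε ^ 2 * (1 + ‖ξ‖) ^ 2 := by
        gcongr; exact one_le_pow₀ (one_le ξ)
      have h4 := abs_add_le (h (ε • ξ) - F (ε • ξ)) (F (ε • ξ))
      rw [sub_add_cancel] at h4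
      rw [add_mul]
      linarith
    have j3 : Integrable (fun q : Base n × Base n => h (ε • q.1)) (γ.prod γ) :=
      j2.comp_fst γ
    simp only [hWdef]
    rw [integral_sub j1 j3]
    congr 1
    -- The semigroup property: two half steps of the linear flow are one full step, hence the scale
    -- `√2 ε`.
    · have := integral_prod_stdGaussian_add (E := Base n) (g := fun x => F (ε • x)) (by fun_prop)
      simp only [smul_add, smul_smul] at this
      rw [mul_comm √2 ε]
      exact this
    · rw [integral_prod _ j3]
      simp
  have hcube := hIb ε hε hε1 h hhm hheven hhodd
  rw [hWint] at hbal
  have hfin : |1 / (6 * ε ^ 2) * ∫ q, W q ^ 3 ∂(γ.prod γ) - 2 / 3 * ε ^ 4 * τ| ≤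
      13 * I * ε ^ 6 := by
    -- The third moment `4 ε⁶ tr A³` divided by `6 ε²` is the correction `(2/3) ε⁴ tr A³`.
    have e : 1 / (6 * ε ^ 2) * ∫ q, W q ^ 3 ∂(γ.prod γ) - 2 / 3 * ε ^ 4 * τ =
        1 / (6 * ε ^ 2) * (∫ q, W q ^ 3 ∂(γ.prod γ) - ε ^ 6 * (4 * τ)) := by
      field_simp
      ring
    rw [e, abs_mul, abs_of_pos (by positivity : 0 < 1 / (6 * ε ^ 2))]
    calc _ ≤ 1 / (6 * ε ^ 2) * (13 * ε ^ 8 * I) := by gcongr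
      _ = 1 / 6 * (13 * I * ε ^ 6) := by field_simp
      _ ≤ 1 * (13 * I * ε ^ 6) := by gcongr; norm_num
      _ = _ := one_mul _
  have h0 : 0 ≤ E2 * ε ^ 6 := by positivity
  rw [_root_.abs_le] at hbal hfin ⊢
  constructor <;> linarith

end SecondStep

end TwoKernel

namespace TwoKernel

open ProbabilityTheory
open scoped RealInnerProductSpace

/-! ### Expansion of the height at which the second step crosses the axis. -/

section Axis

variable {n : ℕ} {F : Base n → ℝ} {A : Base n →L[ℝ] Base n} {C D₂ : ℝ}

lemma sq_sqrt_two : √2 ^ 2 = (2 : ℝ) := Real.sq_sqrt (by norm_num)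

/-- The third moment of a nearly even function of size `O(ε²)` on the horizontal space. -/
lemma abs_integral_pow_three_centredForm_le {V : Base n → ℝ} (hV : Measurable V) {D c : ℝ}
    (hA : ∀ x y, ⟪A x, y⟫ = ⟪x, A y⟫) {ε : ℝ} (hε : 0 < ε) (hε1 : ε ≤ 1)
    (hD : ∀ ξ, |c * centredForm A ξ| ≤ D * (1 + ‖ξ‖) ^ 5)
    (heven : ∀ ξ, |V ξ + V (-ξ) - 2 * ε ^ 2 * (c * centredForm A ξ)| ≤
      2 * ε ^ 4 * (D * (1 + ‖ξ‖) ^ 5))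
    (hodd : ∀ ξ, |V ξ - V (-ξ)| ≤ 2 * ε ^ 3 * (D * (1 + ‖ξ‖) ^ 5)) :
    |∫ ξ, V ξ ^ 3 ∂(stdGaussian (Base n)) -
      ε ^ 6 * (c ^ 3 * LinearMap.trace ℝ (Base n) (A * A * A : Base n →L[ℝ] Base n))| ≤
      13 * ε ^ 8 * (D ^ 3 * gaussMoment n 15) := by
  have hc := continuous_centredForm A
  have h := abs_integral_pow_three_sub_le (measurePreserving_neg_stdGaussian (E := Base n))
    (Homeomorph.neg (Base n)).measurableEmbedding (W := V) (w := fun ξ => c * centredForm A ξ)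
    (P := fun ξ => D * (1 + ‖ξ‖) ^ 5) hV.aestronglyMeasurable (by fun_prop)
    (((integrable_one_add_norm_pow 15).const_mul (D ^ 3)).congr (ae_of_all _ fun ξ => by
      simp only [mul_pow, ← pow_mul])) hε hε1 hD heven hodd
  simp only [mul_pow, ← pow_mul, integral_const_mul, integral_centredForm_pow_three hA] at h
  exact h

/-- The balance of the two steps at the height of the crossing, multiplied out. -/
lemma abs_axis_balance_le {ε X Y IV IV' I3 I3' K N : ℝ} (hε : 0 < ε) (hK : 0 ≤ K)
    (heq : |√2 * X - Y| ≤ K * ε ^ 5)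
    (hX : |X - (1 / ε * IV - 1 / (6 * ε ^ 3) * I3)| ≤ N * ε ^ 5)
    (hY : |Y - (1 / (√2 * ε) * IV' - 1 / (6 * (√2 * ε) ^ 3) * I3')| ≤ N * ε ^ 5) :
    |2 * IV - IV' - 1 / (3 * ε ^ 2) * I3 + 1 / (12 * ε ^ 2) * I3'| ≤ 4 * (K + N) * ε ^ 6 := by
  have hs := sqrt_two_bounds
  have hs2 := sq_sqrt_two
  have hsε : 0 < √2 * ε := by positivity
  -- Multiplication by `√2 ε` clears the scales: the weight `√2` of the first term becomes `2`, and
  -- `√2 ε / (6 (√2 ε)³) = 1/(12 ε²)`. The extra factor `ε` raises the error from `ε⁵` to `ε⁶`.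
  have key : 2 * IV - IV' - 1 / (3 * ε ^ 2) * I3 + 1 / (12 * ε ^ 2) * I3' =
      (√2 * ε) * (√2 * X - Y) - 2 * ε * (X - (1 / ε * IV - 1 / (6 * ε ^ 3) * I3)) +
      (√2 * ε) * (Y - (1 / (√2 * ε) * IV' - 1 / (6 * (√2 * ε) ^ 3) * I3')) := by
    have t1 : (√2 * ε) * (1 / (√2 * ε) * IV') = IV' := by field_simp
    have t2 : (√2 * ε) * (1 / (6 * (√2 * ε) ^ 3) * I3') = 1 / (12 * ε ^ 2) * I3' := by
      have : (√2 * ε) ^ 3 = (√2 * ε) * (2 * ε ^ 2) := by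
        rw [show (√2 * ε) ^ 3 = (√2 * ε) * (√2 ^ 2 * ε ^ 2) by ring, hs2]
      rw [this]
      field_simp
      ring
    have t3 : 2 * ε * (1 / ε * IV) = 2 * IV := by field_simp
    have t4 : 2 * ε * (1 / (6 * ε ^ 3) * I3) = 1 / (3 * ε ^ 2) * I3 := by
      field_simp; ring
    have t5 : (√2 * ε) * (√2 * X) = 2 * ε * X := by
      rw [show (√2 * ε) * (√2 * X) = √2 ^ 2 * (ε * X) by ring, hs2]; ring
    rw [mul_sub, mul_sub (2 * ε), mul_sub (√2 * ε) Y, mul_sub (2 * ε) (1 / ε * IV),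
      mul_sub (√2 * ε) (1 / (√2 * ε) * IV'), t1, t2, t3, t4, t5]
    ring
  rw [key]
  have a1 : |(√2 * ε) * (√2 * X - Y)| ≤ 2 * ε * (K * ε ^ 5) := by
    rw [abs_mul, abs_of_pos hsε]
    gcongr
    linarith
  have a2 : |2 * ε * (X - (1 / ε * IV - 1 / (6 * ε ^ 3) * I3))| ≤ 2 * ε * (N * ε ^ 5) := by
    rw [abs_mul, abs_of_pos (by positivity : 0 < 2 * ε)]
    gcongr
  have a3 : |(√2 * ε) * (Y - (1 / (√2 * ε) * IV' - 1 / (6 * (√2 * ε) ^ 3) * I3'))| ≤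
      2 * ε * (N * ε ^ 5) := by
    rw [abs_mul, abs_of_pos hsε]
    gcongr
    linarith
  have a4 : 4 * (K + N) * ε ^ 6 = 2 * ε * (K * ε ^ 5) + 2 * ε * (N * ε ^ 5) +
      2 * ε * (N * ε ^ 5) + 2 * K * ε ^ 6 := by ring
  have a5 : 0 ≤ 2 * K * ε ^ 6 := by positivity
  rw [a4]
  rw [_root_.abs_le] at a1 a2 a3 ⊢
  constructor <;> linarith

/-- The crossing height to first order. -/
lemma abs_axis_first_order_le {ε z H M I3 I3' τ tr C C1 E0 N : ℝ} (hε : 0 < ε) (hε1 : ε ≤ 1)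
    (hC : 0 ≤ C) (hC1 : 0 ≤ C1) (hE0 : 0 ≤ E0) (hN : 0 ≤ N)
    (hmain : |2 * (H - z) - (M - z) - 1 / (3 * ε ^ 2) * I3 + 1 / (12 * ε ^ 2) * I3'| ≤ E0 * ε ^ 6)
    (hmean : |M - H - 2 / 3 * ε ^ 4 * τ| ≤ C1 * ε ^ 6)
    (hM : |M - (ε ^ 2 * tr + ε ^ 4 / 2 * D₂)| ≤ C * (8 * ε ^ 6))
    (hI3 : |I3| ≤ N * ε ^ 6) (hI3' : |I3'| ≤ N * ε ^ 6) :
    |z - ε ^ 2 * tr| ≤ (E0 + N + 2 * (|τ| + C1) + |D₂| + 8 * C) * ε ^ 4 := by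
  have hε64 : ε ^ 6 ≤ ε ^ 4 := pow_le_pow_of_le_one hε.le hε1 (by norm_num)
  have b1 : |1 / (3 * ε ^ 2) * I3| ≤ 1 / 3 * (N * ε ^ 4) := by
    rw [abs_mul, abs_of_pos (by positivity : 0 < 1 / (3 * ε ^ 2))]
    calc _ ≤ 1 / (3 * ε ^ 2) * (N * ε ^ 6) := by gcongr
      _ = _ := by field_simp
  have b2 : |1 / (12 * ε ^ 2) * I3'| ≤ 1 / 12 * (N * ε ^ 4) := by
    rw [abs_mul, abs_of_pos (by positivity : 0 < 1 / (12 * ε ^ 2))]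
    calc _ ≤ 1 / (12 * ε ^ 2) * (N * ε ^ 6) := by gcongr
      _ = _ := by field_simp
  have b3 : E0 * ε ^ 6 ≤ E0 * ε ^ 4 := by gcongr
  have b4 : C1 * ε ^ 6 ≤ C1 * ε ^ 4 := by gcongr
  have b5 : C * (8 * ε ^ 6) ≤ C * (8 * ε ^ 4) := by gcongr
  have b6 : |ε ^ 4 * τ| ≤ |τ| * ε ^ 4 := by
    rw [abs_mul, abs_of_nonneg (by positivity : 0 ≤ ε ^ 4), mul_comm]
  have b7 : |ε ^ 4 * D₂| ≤ |D₂| * ε ^ 4 := by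
    rw [abs_mul, abs_of_nonneg (by positivity : 0 ≤ ε ^ 4), mul_comm]
  have b8 : 0 ≤ N * ε ^ 4 := by positivity
  have b9 : 0 ≤ |τ| * ε ^ 4 := by positivity
  have b10 : 0 ≤ |D₂| * ε ^ 4 := by positivity
  have b12 : 0 ≤ C1 * ε ^ 4 := by positivity
  have b13 : 0 ≤ C * ε ^ 4 := by positivity
  have b11 : (E0 + N + 2 * (|τ| + C1) + |D₂| + 8 * C) * ε ^ 4 = E0 * ε ^ 4 + N * ε ^ 4 +
      2 * (|τ| * ε ^ 4) + 2 * (C1 * ε ^ 4) + |D₂| * ε ^ 4 + C * (8 * ε ^ 4) := by ring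
  rw [b11]
  generalize 1 / (3 * ε ^ 2) * I3 = y at *
  generalize 1 / (12 * ε ^ 2) * I3' = y' at *
  rw [_root_.abs_le] at hmain hmean hM b1 b2 b6 b7 ⊢
  constructor <;> linarith

/-- The crossing height to second order. -/
lemma abs_axis_second_order_le {ε z H M I3 I3' τ tr C C1 E0 J : ℝ} (hε : 0 < ε)
    (hC1 : 0 ≤ C1) (hJ : 0 ≤ J)
    (hmain : |2 * (H - z) - (M - z) - 1 / (3 * ε ^ 2) * I3 + 1 / (12 * ε ^ 2) * I3'| ≤ E0 * ε ^ 6)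
    (hmean : |M - H - 2 / 3 * ε ^ 4 * τ| ≤ C1 * ε ^ 6)
    (hM : |M - (ε ^ 2 * tr + ε ^ 4 / 2 * D₂)| ≤ C * (8 * ε ^ 6))
    (hI3 : |I3 - ε ^ 6 * (1 ^ 3 * τ)| ≤ J * ε ^ 8)
    (hI3' : |I3' - ε ^ 6 * (2 ^ 3 * τ)| ≤ J * ε ^ 8) :
    |z - (ε ^ 2 * tr + ε ^ 4 * (1 / 2 * D₂ - τ))| ≤ (E0 + J + 2 * C1 + 8 * C) * ε ^ 6 := by
  have c1 : |1 / (3 * ε ^ 2) * I3 - 1 / 3 * ε ^ 4 * τ| ≤ 1 / 3 * (J * ε ^ 6) := by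
    have e : 1 / (3 * ε ^ 2) * I3 - 1 / 3 * ε ^ 4 * τ =
        1 / (3 * ε ^ 2) * (I3 - ε ^ 6 * (1 ^ 3 * τ)) := by
      field_simp
    rw [e, abs_mul, abs_of_pos (by positivity : 0 < 1 / (3 * ε ^ 2))]
    calc _ ≤ 1 / (3 * ε ^ 2) * (J * ε ^ 8) := by gcongr
      _ = _ := by field_simp
  have c2 : |1 / (12 * ε ^ 2) * I3' - 2 / 3 * ε ^ 4 * τ| ≤ 1 / 12 * (J * ε ^ 6) := by
    have e : 1 / (12 * ε ^ 2) * I3' - 2 / 3 * ε ^ 4 * τ =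
        1 / (12 * ε ^ 2) * (I3' - ε ^ 6 * (2 ^ 3 * τ)) := by
      field_simp
      ring
    rw [e, abs_mul, abs_of_pos (by positivity : 0 < 1 / (12 * ε ^ 2))]
    calc _ ≤ 1 / (12 * ε ^ 2) * (J * ε ^ 8) := by gcongr
      _ = _ := by field_simp
  have c3 : 0 ≤ J * ε ^ 6 := by positivity
  have c4 : 0 ≤ C1 * ε ^ 6 := by positivity
  generalize 1 / (3 * ε ^ 2) * I3 = y at *
  generalize 1 / (12 * ε ^ 2) * I3' = y' at *
  rw [_root_.abs_le] at hmain hmean hM c1 c2 ⊢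
  constructor <;> linarith

/-- The third moment of the height after the first step, relative to the crossing height. -/
lemma abs_integral_halfStep_pow_three_le (hsymm : ∀ x y, ⟪A x, y⟫ = ⟪x, A y⟫) {h : Base n → ℝ}
    (hh : Measurable h) {ε z C1 E1 Cq D : ℝ} (hε : 0 < ε) (hε1 : ε ≤ 1) (hC1 : 0 ≤ C1)
    (hE1' : 0 ≤ E1) (hCq : 0 ≤ Cq) (hq : ∀ ξ, |centredForm A ξ| ≤ Cq * (1 + ‖ξ‖) ^ 2)
    (heven : ∀ ξ, |h (ε • ξ) + h (ε • (-ξ)) -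
      ε ^ 2 * (⟪A ξ, ξ⟫ + LinearMap.trace ℝ (Base n) A)| ≤ C1 * ε ^ 4 * (1 + ‖ξ‖) ^ 5)
    (hodd : ∀ ξ, |h (ε • ξ) - h (ε • (-ξ))| ≤ C1 * ε ^ 3 * (1 + ‖ξ‖) ^ 5)
    (hz1 : |z - ε ^ 2 * LinearMap.trace ℝ (Base n) A| ≤ E1 * ε ^ 4)
    (hD : C1 + E1 + 2 * Cq ≤ D) :
    |∫ ξ, (h (ε • ξ) - z) ^ 3 ∂(stdGaussian (Base n)) -
      ε ^ 6 * (1 ^ 3 * LinearMap.trace ℝ (Base n) (A * A * A : Base n →L[ℝ] Base n))| ≤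
      13 * ε ^ 8 * (D ^ 3 * gaussMoment n 15) := by
  have one_le : ∀ x : Base n, 1 ≤ 1 + ‖x‖ := fun x => by linarith [norm_nonneg x]
  have hN5 : ∀ ξ : Base n, 1 ≤ (1 + ‖ξ‖) ^ 5 := fun ξ => one_le_pow₀ (one_le ξ)
  have hN25 : ∀ ξ : Base n, (1 + ‖ξ‖) ^ 2 ≤ (1 + ‖ξ‖) ^ 5 := fun ξ =>
    pow_le_pow_right₀ (one_le ξ) (by norm_num)
  have hVm : Measurable fun ξ => h (ε • ξ) - z := (hh.comp (measurable_const_smul ε)).sub_const z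
  have hdom : ∀ ξ : Base n, ∀ k : ℕ, (C1 + E1 + 2 * Cq) * ε ^ k * (1 + ‖ξ‖) ^ 5 ≤
      D * ε ^ k * (1 + ‖ξ‖) ^ 5 := fun ξ k => by gcongr
  refine abs_integral_pow_three_centredForm_le hVm hsymm hε hε1 (fun ξ => ?_) (fun ξ => ?_)
    (fun ξ => ?_)
  · rw [one_mul]
    refine (hq ξ).trans ?_
    calc Cq * (1 + ‖ξ‖) ^ 2 ≤ D * (1 + ‖ξ‖) ^ 2 := by gcongr; linarith
      _ ≤ _ := mul_le_mul_of_nonneg_left (hN25 ξ) (by linarith)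
  · have h1 := heven ξ
    have h2 : (h (ε • ξ) - z) + (h (ε • (-ξ)) - z) - 2 * ε ^ 2 * (1 * centredForm A ξ) =
        (h (ε • ξ) + h (ε • (-ξ)) - ε ^ 2 * (⟪A ξ, ξ⟫ + LinearMap.trace ℝ (Base n) A)) - 2 * (z - ε ^ 2 * LinearMap.trace ℝ (Base n) A) := by
      simp only [centredForm]; ring
    rw [h2]
    refine (abs_sub _ _).trans ?_
    rw [abs_mul, abs_two]
    have h3 : E1 * ε ^ 4 * 1 ≤ E1 * ε ^ 4 * (1 + ‖ξ‖) ^ 5 := by gcongr; exact hN5 ξ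
    have h4 : 0 ≤ (C1 + 4 * Cq) * ε ^ 4 * (1 + ‖ξ‖) ^ 5 := by positivity
    have h7 := hdom ξ 4
    generalize (1 + ‖ξ‖) ^ 5 = Z at *
    linarith
  · have h1 := hodd ξ
    have h2 : (h (ε • ξ) - z) - (h (ε • (-ξ)) - z) = h (ε • ξ) - h (ε • (-ξ)) := by ring
    rw [h2]
    have h4 : 0 ≤ (C1 + 2 * E1 + 4 * Cq) * ε ^ 3 * (1 + ‖ξ‖) ^ 5 := by positivity
    have h7 := hdom ξ 3
    generalize (1 + ‖ξ‖) ^ 5 = Z at *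
    linarith

/-- The third moment of the initial height at the larger scale, relative to the crossing height. -/
lemma abs_integral_graph_pow_three_le (hF : GraphBounds F A C D₂)
    {ε z E1 Cq D : ℝ} (hε : 0 < ε) (hε1 : ε ≤ 1)
    (hE1' : 0 ≤ E1) (hCq : 0 ≤ Cq) (hq : ∀ ξ, |centredForm A ξ| ≤ Cq * (1 + ‖ξ‖) ^ 2)
    (hz1 : |z - ε ^ 2 * LinearMap.trace ℝ (Base n) A| ≤ E1 * ε ^ 4)
    (hD : 4 * C + E1 + 2 * Cq ≤ D) :
    |∫ ξ, (F ((√2 * ε) • ξ) - z) ^ 3 ∂(stdGaussian (Base n)) -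
      ε ^ 6 * (2 ^ 3 * LinearMap.trace ℝ (Base n) (A * A * A : Base n →L[ℝ] Base n))| ≤
      13 * ε ^ 8 * (D ^ 3 * gaussMoment n 15) := by
  have one_le : ∀ x : Base n, 1 ≤ 1 + ‖x‖ := fun x => by linarith [norm_nonneg x]
  have hN5 : ∀ ξ : Base n, 1 ≤ (1 + ‖ξ‖) ^ 5 := fun ξ => one_le_pow₀ (one_le ξ)
  have hN25 : ∀ ξ : Base n, (1 + ‖ξ‖) ^ 2 ≤ (1 + ‖ξ‖) ^ 5 := fun ξ =>
    pow_le_pow_right₀ (one_le ξ) (by norm_num)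
  have hN45 : ∀ ξ : Base n, (1 + ‖ξ‖) ^ 4 ≤ (1 + ‖ξ‖) ^ 5 := fun ξ =>
    pow_le_pow_right₀ (one_le ξ) (by norm_num)
  have hN35 : ∀ ξ : Base n, (1 + ‖ξ‖) ^ 3 ≤ (1 + ‖ξ‖) ^ 5 := fun ξ =>
    pow_le_pow_right₀ (one_le ξ) (by norm_num)
  have hC := hF.nonneg
  have hFc := hF.continuous
  have hs := sqrt_two_bounds
  have hs2 := sq_sqrt_two
  have hsε : 0 < √2 * ε := by positivity
  have hV'm : Measurable fun ξ : Base n => F ((√2 * ε) • ξ) - z :=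
    (show Continuous fun ξ : Base n => F ((√2 * ε) • ξ) - z by fun_prop).measurable
  have hdom : ∀ ξ : Base n, ∀ k : ℕ, (4 * C + E1 + 2 * Cq) * ε ^ k * (1 + ‖ξ‖) ^ 5 ≤
      D * ε ^ k * (1 + ‖ξ‖) ^ 5 := fun ξ k => by gcongr
  refine abs_integral_pow_three_centredForm_le hV'm hF.symm hε hε1 (fun ξ => ?_) (fun ξ => ?_)
    (fun ξ => ?_)
  · rw [abs_mul, abs_two]
    calc 2 * |centredForm A ξ| ≤ 2 * (Cq * (1 + ‖ξ‖) ^ 2) := by gcongr; exact hq ξ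
      _ = (2 * Cq) * (1 + ‖ξ‖) ^ 2 := by ring
      _ ≤ D * (1 + ‖ξ‖) ^ 2 := by gcongr; linarith
      _ ≤ _ := mul_le_mul_of_nonneg_left (hN25 ξ) (by linarith)
  · have h1 := hF.even ((√2 * ε) • ξ)
    have h2 : (F ((√2 * ε) • ξ) - z) + (F ((√2 * ε) • (-ξ)) - z) - 2 * ε ^ 2 * (2 * centredForm A ξ) =
        (F ((√2 * ε) • ξ) + F (-((√2 * ε) • ξ)) - ⟪A ((√2 * ε) • ξ), (√2 * ε) • ξ⟫) -
        2 * (z - ε ^ 2 * LinearMap.trace ℝ (Base n) A) := by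
      simp only [centredForm, smul_neg]
      rw [map_smul, real_inner_smul_left, real_inner_smul_right]
      have : √2 * ε * (√2 * ε * ⟪A ξ, ξ⟫) = 2 * ε ^ 2 * ⟪A ξ, ξ⟫ := by
        rw [show √2 * ε * (√2 * ε * ⟪A ξ, ξ⟫) = √2 ^ 2 * (ε ^ 2 * ⟪A ξ, ξ⟫) by ring, hs2]; ring
      rw [this]; ring
    rw [h2]
    refine (abs_sub _ _).trans ?_
    rw [abs_mul 2, abs_two]
    have h3 : E1 * ε ^ 4 * 1 ≤ E1 * ε ^ 4 * (1 + ‖ξ‖) ^ 5 := by gcongr; exact hN5 ξ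
    have h5 : C * ‖(√2 * ε) • ξ‖ ^ 4 ≤ 4 * C * ε ^ 4 * (1 + ‖ξ‖) ^ 5 := by
      rw [norm_smul, Real.norm_eq_abs, abs_of_pos hsε, mul_pow, mul_pow,
        show √2 ^ 4 = (√2 ^ 2) ^ 2 by ring, hs2]
      calc _ = 4 * C * ε ^ 4 * ‖ξ‖ ^ 4 := by ring
        _ ≤ 4 * C * ε ^ 4 * (1 + ‖ξ‖) ^ 4 := by gcongr; linarith
        _ ≤ _ := mul_le_mul_of_nonneg_left (hN45 ξ) (by positivity)
    have h4 : 0 ≤ (4 * C + 4 * Cq) * ε ^ 4 * (1 + ‖ξ‖) ^ 5 := by positivity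
    have h6 := h1.trans h5
    have h7 := hdom ξ 4
    generalize (1 + ‖ξ‖) ^ 5 = Z at *
    linarith
  · have h1 := hF.odd ((√2 * ε) • ξ)
    have h2 : (F ((√2 * ε) • ξ) - z) - (F ((√2 * ε) • (-ξ)) - z) = F ((√2 * ε) • ξ) - F (-((√2 * ε) • ξ)) := by
      simp only [smul_neg]; ring
    rw [h2]
    have h5 : C * ‖(√2 * ε) • ξ‖ ^ 3 ≤ 4 * C * ε ^ 3 * (1 + ‖ξ‖) ^ 5 := by
      rw [norm_smul, Real.norm_eq_abs, abs_of_pos hsε, mul_pow, mul_pow,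
        show √2 ^ 3 = √2 ^ 2 * √2 by ring, hs2]
      calc _ ≤ C * (2 * 2 * ε ^ 3 * ‖ξ‖ ^ 3) := by gcongr; linarith
        _ = 4 * C * ε ^ 3 * ‖ξ‖ ^ 3 := by ring
        _ ≤ 4 * C * ε ^ 3 * (1 + ‖ξ‖) ^ 3 := by gcongr; linarith
        _ ≤ _ := mul_le_mul_of_nonneg_left (hN35 ξ) (by positivity)
    have h4 : 0 ≤ (2 * E1 + 4 * C + 4 * Cq) * ε ^ 3 * (1 + ‖ξ‖) ^ 5 := by positivity
    have h6 := h1.trans h5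
    have h7 := hdom ξ 3
    generalize (1 + ‖ξ‖) ^ 5 = Z at *
    linarith
/-- The height at which the second step crosses the axis, to second order. -/
lemma exists_axis_expansion (hF : GraphBounds F A C D₂) (K : ℝ) (hK : 0 ≤ K) :
    ∃ C', 0 ≤ C' ∧ ∀ ε, 0 < ε → ε ≤ 1 → ∀ h, HalfStep F K ε h → ∀ z : ℝ, |z| ≤ K * ε ^ 2 →
      |√2 * ∫ ξ, gaussPrimitive ((h (ε • ξ) - z) / ε) ∂(stdGaussian (Base n)) -
        ∫ ξ, gaussPrimitive ((F ((√2 * ε) • ξ) - z) / (√2 * ε)) ∂(stdGaussian (Base n))| ≤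
        K * ε ^ 5 →
      |z - (ε ^ 2 * LinearMap.trace ℝ (Base n) A + ε ^ 4 * (1 / 2 * D₂ -
        LinearMap.trace ℝ (Base n) (A * A * A : Base n →L[ℝ] Base n)))| ≤ C' * ε ^ 6 := by
  have hC := hF.nonneg
  have hFc := hF.continuous
  obtain ⟨Cq, hCq, hq⟩ := exists_centredForm_bound A
  obtain ⟨C1, hC1, hexp⟩ := exists_halfStep_expansion hF K hK
  have hs := sqrt_two_bounds
  have hs2 := sq_sqrt_two
  have one_le : ∀ x : Base n, 1 ≤ 1 + ‖x‖ := fun x => by linarith [norm_nonneg x]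
  obtain ⟨B, hB, hBdef⟩ : ∃ B, 0 ≤ B ∧ B = 2 * C + 2 * K := ⟨_, by positivity, rfl⟩
  have hm10 : 0 ≤ gaussMoment n 10 := gaussMoment_nonneg 10
  have hm6 : 0 ≤ gaussMoment n 6 := gaussMoment_nonneg 6
  have hm15 : 0 ≤ gaussMoment n 15 := gaussMoment_nonneg 15
  obtain ⟨E0, hE0, hE0def⟩ : ∃ E, 0 ≤ E ∧ E = 4 * (K + B ^ 5 * gaussMoment n 10) :=
    ⟨_, by positivity, rfl⟩
  obtain ⟨E1, hE1, hE1def⟩ : ∃ E, 0 ≤ E ∧ E = E0 + B ^ 3 * gaussMoment n 6 +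
      2 * (|LinearMap.trace ℝ (Base n) (A * A * A : Base n →L[ℝ] Base n)| + C1) + |D₂| + 8 * C :=
    ⟨_, by positivity, rfl⟩
  obtain ⟨D, hD, hDdef⟩ : ∃ D, 0 ≤ D ∧ D = C1 + E1 + 4 * C + 2 * Cq := ⟨_, by positivity, rfl⟩
  obtain ⟨J, hJ, hJdef⟩ : ∃ J, 0 ≤ J ∧ J = 13 * (D ^ 3 * gaussMoment n 15) :=
    ⟨_, by positivity, rfl⟩
  refine ⟨E0 + J + 2 * C1 + 8 * C, by positivity, fun ε hε hε1 h hh z hz heq => ?_⟩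
  obtain ⟨heven, hodd, hmean⟩ := hexp ε hε hε1 h hh
  have hhm := hh.measurable
  have hsε : 0 < √2 * ε := by positivity
  have hVm : Measurable fun ξ => h (ε • ξ) - z :=
    (hhm.comp (measurable_const_smul ε)).sub_const z
  have hV'm : Measurable fun ξ : Base n => F ((√2 * ε) • ξ) - z :=
    (show Continuous fun ξ : Base n => F ((√2 * ε) • ξ) - z by fun_prop).measurable
  have hz2 : ∀ ξ : Base n, |z| ≤ K * ε ^ 2 * (1 + ‖ξ‖) ^ 2 := fun ξ =>
    hz.trans (le_mul_of_one_le_right (by positivity) (one_le_pow₀ (one_le ξ)))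
  have hhb : ∀ ξ, |h (ε • ξ)| ≤ (C + K) * ε ^ 2 * (1 + ‖ξ‖) ^ 2 := by
    intro ξ
    have h1 := hh.near (ε • ξ)
    have h2 := hF.abs_smul_le (a := ε) ξ
    have h3 : K * ε ^ 2 * 1 ≤ K * ε ^ 2 * (1 + ‖ξ‖) ^ 2 := by
      gcongr; exact one_le_pow₀ (one_le ξ)
    have h4 := abs_add_le (h (ε • ξ) - F (ε • ξ)) (F (ε • ξ))
    rw [sub_add_cancel] at h4
    linarith
  have hVb : ∀ ξ, |h (ε • ξ) - z| ≤ B * ε ^ 2 * (1 + ‖ξ‖) ^ 2 := by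
    intro ξ
    have h1 := abs_sub (h (ε • ξ)) z
    have h2 := hhb ξ
    have h3 := hz2 ξ
    have h4 : 0 ≤ C * ε ^ 2 * (1 + ‖ξ‖) ^ 2 := by positivity
    rw [hBdef]
    linarith
  have hV'b : ∀ ξ, |F ((√2 * ε) • ξ) - z| ≤ B * ε ^ 2 * (1 + ‖ξ‖) ^ 2 := by
    intro ξ
    have h1 := abs_sub (F ((√2 * ε) • ξ)) z
    have h2 := hF.abs_smul_le (a := √2 * ε) ξ
    rw [mul_pow, hs2] at h2
    have h3 := hz2 ξ
    have h4 : 0 ≤ K * ε ^ 2 * (1 + ‖ξ‖) ^ 2 := by positivity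
    rw [hBdef]
    linarith
  have hX := abs_erf_expansion_le hVm (B := B * ε) (k := 2) hε
    (fun ξ => (hVb ξ).trans (le_of_eq (by ring)))
  -- The same constant `B ε` serves at the larger scale since `√2 ≥ 1`.
  have hY := abs_erf_expansion_le hV'm (B := B * ε) (k := 2) hsε (fun ξ => (hV'b ξ).trans (by
    have : B * ε ^ 2 ≤ B * ε * (√2 * ε) := by nlinarith [mul_nonneg hB (sq_nonneg ε)]
    exact mul_le_mul_of_nonneg_right this (by positivity)))
  have iV : Integrable (fun ξ => h (ε • ξ)) (stdGaussian (Base n)) :=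
    integrable_of_polynomial_bound (hhm.comp (measurable_const_smul ε)).aestronglyMeasurable hhb
  have hIV : ∫ ξ, (h (ε • ξ) - z) ∂(stdGaussian (Base n)) =
      ∫ ξ, h (ε • ξ) ∂(stdGaussian (Base n)) - z := by
    rw [integral_sub iV (integrable_const _)]; simp
  have hIV' : ∫ ξ, (F ((√2 * ε) • ξ) - z) ∂(stdGaussian (Base n)) =
      ∫ ξ, F ((√2 * ε) • ξ) ∂(stdGaussian (Base n)) - z := by
    rw [integral_sub (hF.integrable_smul _) (integrable_const _)]; simp
  have hI3 : |∫ ξ, (h (ε • ξ) - z) ^ 3 ∂(stdGaussian (Base n))| ≤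
      (B * ε ^ 2) ^ 3 * gaussMoment n 6 := by
    refine abs_integral_le_gaussMoment (k := 6) fun ξ => ?_
    rw [abs_pow, show 6 = 2 * 3 from rfl, pow_mul, ← mul_pow]
    gcongr
    exact hVb ξ
  have hI3' : |∫ ξ, (F ((√2 * ε) • ξ) - z) ^ 3 ∂(stdGaussian (Base n))| ≤
      (B * ε ^ 2) ^ 3 * gaussMoment n 6 := by
    refine abs_integral_le_gaussMoment (k := 6) fun ξ => ?_
    rw [abs_pow, show 6 = 2 * 3 from rfl, pow_mul, ← mul_pow]
    gcongr
    exact hV'b ξ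
  have hM := hF.mean (√2 * ε)
  have e1 : (√2 * ε) ^ 2 / 2 = ε ^ 2 := by rw [mul_pow, hs2]; ring
  have e2 : (√2 * ε) ^ 4 / 8 = ε ^ 4 / 2 := by
    rw [mul_pow, show √2 ^ 4 = (√2 ^ 2) ^ 2 by ring, hs2]; ring
  have e3 : |√2 * ε| ^ 6 = 8 * ε ^ 6 := by
    rw [abs_of_pos hsε, mul_pow, show √2 ^ 6 = (√2 ^ 2) ^ 3 by ring, hs2]; ring
  rw [e1, e2, e3] at hM
  have e4 : (B * ε) ^ 5 * gaussMoment n (2 * 5) = B ^ 5 * gaussMoment n 10 * ε ^ 5 := by ring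
  have e5 : (B * ε ^ 2) ^ 3 * gaussMoment n 6 = B ^ 3 * gaussMoment n 6 * ε ^ 6 := by ring
  rw [e4] at hX hY
  rw [e5] at hI3 hI3'
  have hmain := abs_axis_balance_le hε hK heq hX hY
  rw [hIV, hIV', ← hE0def] at hmain
  -- A bootstrap: crude bounds on the cubes give `z = ε² tr A + O(ε⁴)`. With this value subtracted,
  -- both cubed quantities have multiples of the centred form as leading terms, so their third
  -- moments are known and the same balance can be read to second order.
  have hz1 := abs_axis_first_order_le hε hε1 hC hC1 hE0 (by positivity) hmain hmean hM hI3 hI3'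
  rw [← hE1def] at hz1
  have e6 : 13 * ε ^ 8 * (D ^ 3 * gaussMoment n 15) = J * ε ^ 8 := by rw [hJdef]; ring
  have hcub := abs_integral_halfStep_pow_three_le (D := D) hF.symm hhm hε hε1 hC1 hE1 hCq hq heven
    hodd hz1 (by linarith)
  have hcub' := abs_integral_graph_pow_three_le (D := D) hF hε hε1 hE1 hCq hq hz1 (by linarith)
  rw [e6] at hcub hcub'
  exact abs_axis_second_order_le hε hC1 hJ hmain hmean hM hcub hcub'

end Axis

end TwoKernel

namespace TwoKernel

open ProbabilityTheory
open scoped RealInnerProductSpace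

/-! ### Existence and uniqueness of the crossing, by comparison with a flat interface. -/

section Crossing

variable {n : ℕ}

/-- At scale `a` the graph deviates from the horizontal by `O(a²)`, which shifts the argument of the
1-Lipschitz `p` by `O(a)`. Where `a ‖ξ‖ > 1`, the bound `|p| ≤ 2` and the weight suffice. -/
lemma abs_erfMean_zero_sub_le {φ : Base n → ℝ} (hφ : Continuous φ) {a B : ℝ} (ha : 0 < a)
    (hB : 0 ≤ B) (h : ∀ ξ, a * ‖ξ‖ ≤ 1 → |φ (a • ξ)| ≤ B * a ^ 2 * (1 + ‖ξ‖) ^ 2) (s : ℝ) :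
    |erfMean φ a 0 s - gaussPrimitive (-s / a)| ≤ (B + 4) * a * gaussMoment n 2 := by
  have hc : gaussPrimitive (-s / a) = ∫ _, gaussPrimitive (-s / a) ∂(stdGaussian (Base n)) := by
    simp
  rw [erfMean, hc, ← integral_sub (integrable_erfMean hφ 0 s) (integrable_const _)]
  refine abs_integral_le_gaussMoment fun ξ => ?_
  rw [zero_add]
  have hN : (1 : ℝ) ≤ 1 + ‖ξ‖ := by linarith [norm_nonneg ξ]
  rcases le_or_gt (a * ‖ξ‖) 1 with hξ | hξ
  · refine (abs_gaussPrimitive_sub_le _ _).trans ?_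
    have e : (φ (a • ξ) - s) / a - -s / a = φ (a • ξ) / a := by ring
    rw [e, abs_div, abs_of_pos ha, div_le_iff₀ ha]
    have h4 : 0 ≤ 4 * a * (1 + ‖ξ‖) ^ 2 * a := by positivity
    linarith [h ξ hξ]
  · have h1 := abs_gaussPrimitive_le_two ((φ (a • ξ) - s) / a)
    have h2 := abs_gaussPrimitive_le_two (-s / a)
    have h3 := abs_sub (gaussPrimitive ((φ (a • ξ) - s) / a)) (gaussPrimitive (-s / a))
    have h4 : (1 : ℝ) ≤ a * (1 + ‖ξ‖) ^ 2 := by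
      have : a * (1 + ‖ξ‖) * 1 ≤ a * (1 + ‖ξ‖) * (1 + ‖ξ‖) := by gcongr
      nlinarith
    have h5 : 0 ≤ B * (a * (1 + ‖ξ‖) ^ 2) := by positivity
    nlinarith

lemma erfMean_sub_le {φ : Base n → ℝ} (hφ : Continuous φ) {a : ℝ} (ha : 0 < a) (x : Base n)
    {s s' : ℝ} (hs : s ≤ s') : erfMean φ a x s - erfMean φ a x s' ≤ (s' - s) / a := by
  rw [erfMean, erfMean, ← integral_sub (integrable_erfMean hφ x s) (integrable_erfMean hφ x s')]
  have hc : (s' - s) / a = ∫ _, (s' - s) / a ∂(stdGaussian (Base n)) := by simp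
  rw [hc]
  refine integral_mono ((integrable_erfMean hφ x s).sub (integrable_erfMean hφ x s'))
    (integrable_const _) fun ξ => ?_
  refine (gaussPrimitive_sub_le (by gcongr)).trans (le_of_eq ?_)
  ring

/-- The flat profile is increasing where `√2 exp(-σ²/2) > 1/√2`, that is where the exponential
exceeds `1/2`. The point `1.155` is the edge `1.15` of the transition region plus the tolerance
`0.005` for the height of the graph. -/
lemma exp_neg_profile : 0.51 ≤ Real.exp (-1.155 ^ 2 / 2) := by
  have h2 := Real.exp_bound' (x := (1.155 ^ 2 / 2 : ℝ)) (by norm_num) (by norm_num) (n := 6)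
    (by norm_num)
  rw [neg_div, Real.exp_neg, le_inv_comm₀ (by norm_num) (Real.exp_pos _)]
  refine h2.trans ?_
  norm_num [Finset.sum_range_succ, Nat.factorial]

/-- The first term of the second step has slope at least `0.51 / ε` near the axis crossing. -/
lemma le_erfMean_sub {ψ : Base n → ℝ} (hψ : Continuous ψ) {ε B : ℝ} (hε : 0 < ε)
    (hB : 0 ≤ B) (h : ∀ ξ, ε * ‖ξ‖ ≤ 1 → |ψ (ε • ξ)| ≤ B * ε ^ 2 * (1 + ‖ξ‖) ^ 2) {s s' : ℝ}
    (hss : s ≤ s') (hs : -(1.15 * ε) ≤ s) (hs' : s' ≤ 1.15 * ε) :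
    0.51 * ((s' - s) / ε) * (1 - (200 * B + 1) * ε * gaussMoment n 2) ≤
      erfMean ψ ε 0 s - erfMean ψ ε 0 s' := by
  rw [erfMean, erfMean, ← integral_sub (integrable_erfMean hψ 0 s) (integrable_erfMean hψ 0 s')]
  have i2 := integrable_one_add_norm_pow (E := Base n) 2
  have hc : 0.51 * ((s' - s) / ε) * (1 - (200 * B + 1) * ε * gaussMoment n 2) =
      ∫ ξ, 0.51 * ((s' - s) / ε) * (1 - (200 * B + 1) * ε * (1 + ‖ξ‖) ^ 2)
        ∂(stdGaussian (Base n)) := by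
    rw [integral_const_mul, integral_sub (integrable_const _) (i2.const_mul _),
      integral_const_mul, gaussMoment]
    simp
  rw [hc]
  refine integral_mono (((integrable_const _).sub (i2.const_mul _)).const_mul _)
    ((integrable_erfMean hψ 0 s).sub (integrable_erfMean hψ 0 s')) fun ξ => ?_
  simp only [zero_add]
  have hN : (1 : ℝ) ≤ 1 + ‖ξ‖ := by linarith [norm_nonneg ξ]
  have hd : 0 ≤ (s' - s) / ε := div_nonneg (by linarith) hε.le
  have hle : (ψ (ε • ξ) - s') / ε ≤ (ψ (ε • ξ) - s) / ε := by gcongr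
  -- On this event both arguments lie in `[-1.155, 1.155]`. Off it `(200 B + 1) ε (1 + ‖ξ‖)² ≥ 1`,
  -- with `200 = 1/0.005`, so the claimed lower bound is nonpositive while the increment of `p` is
  -- nonnegative.
  by_cases hξ : ε * ‖ξ‖ ≤ 1 ∧ |ψ (ε • ξ)| ≤ 0.005 * ε
  · obtain ⟨h1, h2⟩ := _root_.abs_le.1 hξ.2
    have h3 := le_gaussPrimitive_sub (R := 1.155) hle
      (by rw [le_div_iff₀ hε]; linarith) (by rw [div_le_iff₀ hε]; linarith)
    refine le_trans ?_ h3
    have e : (ψ (ε • ξ) - s) / ε - (ψ (ε • ξ) - s') / ε = (s' - s) / ε := by ring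
    rw [e]
    have h4 : 0 ≤ (200 * B + 1) * ε * (1 + ‖ξ‖) ^ 2 := by positivity
    calc _ ≤ 0.51 * ((s' - s) / ε) * 1 := by gcongr; linarith
      _ ≤ _ := by rw [mul_one]; exact mul_le_mul_of_nonneg_right exp_neg_profile hd
  · have h1 : 1 ≤ (200 * B + 1) * ε * (1 + ‖ξ‖) ^ 2 := by
      have hsq : (0 : ℝ) ≤ 200 * (B * ε * (1 + ‖ξ‖) ^ 2) := by positivity
      have hsq' : (0 : ℝ) ≤ ε * (1 + ‖ξ‖) ^ 2 := by positivity
      rcases le_or_gt (ε * ‖ξ‖) 1 with h2 | h2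
      · have h3 : 0.005 * ε < |ψ (ε • ξ)| := not_le.1 fun h3 => hξ ⟨h2, h3⟩
        have h4 := h3.trans_le (h ξ h2)
        have h5 : 0.005 < B * ε * (1 + ‖ξ‖) ^ 2 := by
          refine lt_of_mul_lt_mul_right ?_ hε.le
          linarith
        linarith
      · have : ε * (1 + ‖ξ‖) * 1 ≤ ε * (1 + ‖ξ‖) * (1 + ‖ξ‖) := by gcongr
        nlinarith
    have h6 : 0.51 * ((s' - s) / ε) * (1 - (200 * B + 1) * ε * (1 + ‖ξ‖) ^ 2) ≤ 0 :=
      mul_nonpos_of_nonneg_of_nonpos (by positivity) (by linarith)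
    linarith [strictMono_gaussPrimitive.monotone hle]

/-- A function close to the profile, and decreasing in the transition region, changes sign
exactly once. -/
lemma exists_unique_sign_change {g : ℝ → ℝ} (hg : Continuous g) {ε δ : ℝ} (hε : 0 < ε)
    (hδ : δ ≤ 0.005)
    (hnear : ∀ s, |g s - (√2 * gaussPrimitive (-s / ε) - gaussPrimitive (-s / (√2 * ε)))| ≤ δ)
    (hslope : ∀ s s', s ≤ s' → -(1.15 * ε) ≤ s → s' ≤ 1.15 * ε →
      0.005 * ((s' - s) / ε) ≤ g s - g s') :
    ∃ z, |z| ≤ 200 * δ * ε ∧ g z = 0 ∧ (∀ s < z, 0 < g s) ∧ ∀ s, z < s → g s < 0 := by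
  have hneg : ∀ s, s ≤ -(1.15 * ε) → 0 < g s := by
    intro s hs
    have h1 := le_profile (σ := -s / ε) (by rw [le_div_iff₀ hε]; linarith)
    have h2 := _root_.abs_le.1 (hnear s)
    rw [div_div, mul_comm ε] at h1
    linarith [h2.1]
  have hpos : ∀ s, 1.15 * ε ≤ s → g s < 0 := by
    intro s hs
    have h1 := le_profile (σ := s / ε) (by rw [le_div_iff₀ hε]; linarith)
    have h2 := _root_.abs_le.1 (hnear s)
    rw [div_div, mul_comm ε] at h1
    rw [neg_div, neg_div, gaussPrimitive_neg, gaussPrimitive_neg] at h2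
    linarith [h2.2]
  obtain ⟨z, hz, hz0⟩ := intermediate_value_Icc' (a := -(1.15 * ε)) (b := 1.15 * ε)
    (by linarith) hg.continuousOn
    ⟨(hpos _ le_rfl).le, (hneg _ le_rfl).le⟩
  refine ⟨z, ?_, hz0, fun s hs => ?_, fun s hs => ?_⟩
  -- The profile vanishes at `0`, so `|g 0| ≤ δ`; dividing by the slope `0.005 / ε` bounds the zero
  -- by `200 δ ε`.
  · have h0 : |g 0| ≤ δ := by simpa using hnear 0
    rw [_root_.abs_le] at h0
    rcases le_total 0 z with hz' | hz'
    · have h := hslope 0 z hz' (by linarith) hz.2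
      rw [hz0, sub_zero, sub_zero] at h
      rw [abs_of_nonneg hz']
      have : z / ε ≤ 200 * δ := by linarith
      rwa [div_le_iff₀ hε] at this
    · have h := hslope z 0 hz' hz.1 (by linarith)
      rw [hz0, zero_sub, zero_sub] at h
      rw [abs_of_nonpos hz']
      have : -z / ε ≤ 200 * δ := by linarith
      rwa [div_le_iff₀ hε] at this
  · rcases le_or_gt s (-(1.15 * ε)) with h | h
    · exact hneg s h
    · have h1 := hslope s z hs.le h.le hz.2
      have : 0 < (z - s) / ε := div_pos (by linarith) hε
      linarith
  · rcases le_or_gt (1.15 * ε) s with h | h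
    · exact hpos s h
    · have h1 := hslope z s hs.le hz.1 h.le
      have : 0 < (s - z) / ε := div_pos (by linarith) hε
      linarith

variable {F f : Base n → ℝ} {A : Base n →L[ℝ] Base n} {C D₂ : ℝ}

lemma exists_axis_crossing (hF : GraphBounds F A C D₂) (hf : Continuous f)
    (hfF : ∀ x, ‖x‖ ≤ 2 → f x = F x) {K : ℝ} (hK : 0 ≤ K) :
    ∃ K' ε₀ : ℝ, 0 ≤ K' ∧ 0 < ε₀ ∧ ∀ ε, 0 < ε → ε ≤ ε₀ → ∀ ψ : Base n → ℝ, Continuous ψ →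
      HalfStep F K ε (glue ψ F) → ∃ z, |z| ≤ K' * ε ^ 2 ∧
        √2 * erfMean ψ ε 0 z - erfMean f (√2 * ε) 0 z = 0 ∧
        (∀ s < z, 0 < √2 * erfMean ψ ε 0 s - erfMean f (√2 * ε) 0 s) ∧
        ∀ s, z < s → √2 * erfMean ψ ε 0 s - erfMean f (√2 * ε) 0 s < 0 := by
  have hC := hF.nonneg
  have hs := sqrt_two_bounds
  have hs2 := sq_sqrt_two
  have hm : 1 ≤ gaussMoment n 2 := one_le_gaussMoment 2
  obtain ⟨m, hmd⟩ : ∃ m, m = gaussMoment n 2 := ⟨_, rfl⟩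
  rw [← hmd] at hm
  -- Large enough to bound both the distance to the profile and the loss in the slope estimate by `ε
  -- L ≤ 0.005`.
  obtain ⟨L, hL, hLd⟩ : ∃ L, 0 < L ∧ L = (200 * (C + K) + 4 * (C + K) + 17) * m :=
    ⟨_, by positivity, rfl⟩
  refine ⟨200 * L, 0.005 / L, by positivity, by positivity, fun ε hε hεL ψ hψ hh => ?_⟩
  rw [le_div_iff₀ hL] at hεL
  have hsε : 0 < √2 * ε := by positivity
  have hψb : ∀ ξ, ε * ‖ξ‖ ≤ 1 → |ψ (ε • ξ)| ≤ (C + K) * ε ^ 2 * (1 + ‖ξ‖) ^ 2 := by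
    intro ξ hξ
    have h1 := hh.near (ε • ξ)
    rw [glue, if_pos (by rwa [norm_smul, Real.norm_eq_abs, abs_of_pos hε])] at h1
    have h2 := hF.abs_smul_le (a := ε) ξ
    have h3 : K * ε ^ 2 * 1 ≤ K * ε ^ 2 * (1 + ‖ξ‖) ^ 2 := by
      gcongr; exact one_le_pow₀ (by linarith [norm_nonneg ξ])
    have h4 := abs_add_le (ψ (ε • ξ) - F (ε • ξ)) (F (ε • ξ))
    rw [sub_add_cancel] at h4
    linarith
  have hfb : ∀ ξ, √2 * ε * ‖ξ‖ ≤ 1 →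
      |f ((√2 * ε) • ξ)| ≤ C * (√2 * ε) ^ 2 * (1 + ‖ξ‖) ^ 2 := by
    intro ξ hξ
    rw [hfF _ (by rw [norm_smul, Real.norm_eq_abs, abs_of_pos hsε]; linarith)]
    exact hF.abs_smul_le ξ
  have hcψ := (continuous_erfMean (a := ε) hψ).comp
    (by fun_prop : Continuous fun s : ℝ => ((0 : Base n), s))
  have hcf := (continuous_erfMean (a := √2 * ε) hf).comp
    (by fun_prop : Continuous fun s : ℝ => ((0 : Base n), s))
  simp only [Function.comp_def] at hcψ hcf
  suffices h : ∃ z, |z| ≤ 200 * (ε * L) * ε ∧ _ by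
    obtain ⟨z, hz, hz'⟩ := h
    exact ⟨z, hz.trans (le_of_eq (by ring)), hz'⟩
  refine exists_unique_sign_change
    (g := fun s => √2 * erfMean ψ ε 0 s - erfMean f (√2 * ε) 0 s)
    ((continuous_const.mul hcψ).sub hcf) (δ := ε * L) hε hεL (fun s => ?_)
    (fun s s' hss hs1 hs2' => ?_)
  · have h1 := abs_erfMean_zero_sub_le hψ hε (by positivity) hψb s
    have h2 := abs_erfMean_zero_sub_le hf hsε hC hfb s
    rw [← hmd] at h1 h2
    have e : √2 * erfMean ψ ε 0 s - erfMean f (√2 * ε) 0 s -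
        (√2 * gaussPrimitive (-s / ε) - gaussPrimitive (-s / (√2 * ε))) =
        √2 * (erfMean ψ ε 0 s - gaussPrimitive (-s / ε)) -
        (erfMean f (√2 * ε) 0 s - gaussPrimitive (-s / (√2 * ε))) := by ring
    rw [e]
    refine (abs_sub _ _).trans ?_
    rw [abs_mul, abs_of_pos (by positivity : 0 < √2)]
    have h3 : √2 * |erfMean ψ ε 0 s - gaussPrimitive (-s / ε)| ≤ 2 * ((C + K + 4) * ε * m) := by
      gcongr; linarith
    have h4 : (C + 4) * (√2 * ε) * m ≤ (C + 4) * (2 * ε) * m := by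
      gcongr; linarith
    have h5 : 0 ≤ (200 * (C + K) + 2 * K + 1) * ε * m := by positivity
    rw [hLd]
    linarith
  · have h1 := le_erfMean_sub hψ hε (by positivity) hψb hss hs1 hs2'
    have h2 := erfMean_sub_le hf hsε 0 hss
    rw [← hmd] at h1
    have hd : 0 ≤ (s' - s) / ε := div_nonneg (by linarith) hε.le
    have h3 : (200 * (C + K) + 1) * ε * m ≤ 0.005 := by
      have : 0 ≤ (4 * (C + K) + 16) * ε * m := by positivity
      rw [hLd] at hεL
      linarith
    have h4 : 0.507 * ((s' - s) / ε) ≤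
        0.51 * ((s' - s) / ε) * (1 - (200 * (C + K) + 1) * ε * m) := by
      nlinarith
    -- The net slope is at least `√2 · 0.507 - √2/2 = 0.007 √2 > 0.005`, in units of `1/ε`.
    have e : (s' - s) / (√2 * ε) = √2 / 2 * ((s' - s) / ε) := by
      field_simp
      rw [hs2]
    rw [e] at h2
    generalize (s' - s) / ε = d at *
    have h5 : √2 * (0.507 * d) ≤ √2 * (erfMean ψ ε 0 s - erfMean ψ ε 0 s') := by
      gcongr; linarith
    nlinarith

/-- The crossing height of the two-kernel step over the origin. -/
lemma exists_axis_height (hF : GraphBounds F A C D₂) (hf : Continuous f)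
    (hfF : ∀ x, ‖x‖ ≤ 2 → f x = F x) :
    ∃ C' ε₀ : ℝ, 0 < ε₀ ∧ ∀ ε, 0 < ε → ε ≤ ε₀ → ∀ ψ : Base n → ℝ, Continuous ψ →
      (∀ x, erfMean f ε x (ψ x) = 0) → ∃ z,
        √2 * erfMean ψ ε 0 z - erfMean f (√2 * ε) 0 z = 0 ∧
        (∀ s < z, 0 < √2 * erfMean ψ ε 0 s - erfMean f (√2 * ε) 0 s) ∧
        (∀ s, z < s → √2 * erfMean ψ ε 0 s - erfMean f (√2 * ε) 0 s < 0) ∧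
        |z - (ε ^ 2 * LinearMap.trace ℝ (Base n) A + ε ^ 4 * (1 / 2 * D₂ -
          LinearMap.trace ℝ (Base n) (A * A * A : Base n →L[ℝ] Base n)))| ≤ C' * ε ^ 6 := by
  obtain ⟨K, ε₁, hK, hε₁, hε₁1, hhalf⟩ := exists_halfStep hF hf hfF
  obtain ⟨K', ε₂, hK', hε₂, hcross⟩ := exists_axis_crossing hF hf hfF hK
  have hm : 0 ≤ gaussMoment n 5 := gaussMoment_nonneg 5
  -- One constant for three bounds: the half step, the size of `z`, and the error `O(ε⁵)` from
  -- replacing `ψ` by `glue ψ F` and `f` by `F` in the crossing equation.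
  obtain ⟨C', hC', hexp⟩ := exists_axis_expansion hF (K + K' + 40 * gaussMoment n 5)
    (by positivity)
  have hs := sqrt_two_bounds
  have hFc := hF.continuous
  refine ⟨C', min ε₁ ε₂, lt_min hε₁ hε₂, fun ε hε hεm ψ hψ hψ0 => ?_⟩
  have hε1 : ε ≤ 1 := (hεm.trans (min_le_left _ _)).trans hε₁1
  have hh := hhalf ε hε (hεm.trans (min_le_left _ _)) ψ hψ hψ0
  obtain ⟨z, hz, hz0, hlt, hgt⟩ := hcross ε hε (hεm.trans (min_le_right _ _)) ψ hψ hh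
  refine ⟨z, hz0, hlt, hgt, hexp ε hε hε1 (glue ψ F) ?_ z ?_ ?_⟩
  · refine ⟨hh.measurable, fun x => (hh.near x).trans ?_, fun ξ => (hh.balance ξ).trans ?_⟩
    · gcongr; linarith
    · gcongr; linarith
  · refine hz.trans ?_
    gcongr; linarith
  · have hsε : 0 < √2 * ε := by positivity
    have hmeas := hh.measurable
    have hψm := hψ.measurable
    have h1 := abs_integral_sub_le_of_agree (n := n)
      (v := fun ξ => (glue ψ F (ε • ξ) - z) / ε) (v' := fun ξ => (ψ (0 + ε • ξ) - z) / ε)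
      (((hmeas.comp (measurable_const_smul ε)).sub_const z).div_const ε)
      (show Continuous fun ξ : Base n => (ψ (0 + ε • ξ) - z) / ε by fun_prop).measurable
      hε.le (fun ξ hξ => by
        rw [glue, if_pos (by rwa [norm_smul, Real.norm_eq_abs, abs_of_pos hε]), zero_add]) 5
    -- If `ε ‖ξ‖ ≤ 1` then `√2 ε ‖ξ‖ ≤ 2`, so agreement of `f` and `F` on the ball of radius `2`
    -- covers the larger scale too.
    have h2 := abs_integral_sub_le_of_agree (n := n)
      (v := fun ξ => (F ((√2 * ε) • ξ) - z) / (√2 * ε))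
      (v' := fun ξ => (f (0 + (√2 * ε) • ξ) - z) / (√2 * ε))
      (show Continuous fun ξ : Base n => (F ((√2 * ε) • ξ) - z) / (√2 * ε) by
        fun_prop).measurable
      (show Continuous fun ξ : Base n => (f (0 + (√2 * ε) • ξ) - z) / (√2 * ε) by
        fun_prop).measurable
      hε.le (fun ξ hξ => by
        rw [zero_add, hfF _ (by
          rw [norm_smul, Real.norm_eq_abs, abs_of_pos hsε]
          nlinarith [mul_nonneg hε.le (norm_nonneg ξ)])]) 5
    have e1 : ∫ ξ, gaussPrimitive ((ψ (0 + ε • ξ) - z) / ε) ∂(stdGaussian (Base n)) =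
      erfMean ψ ε 0 z := rfl
    have e2 : ∫ ξ, gaussPrimitive ((f (0 + (√2 * ε) • ξ) - z) / (√2 * ε))
      ∂(stdGaussian (Base n)) = erfMean f (√2 * ε) 0 z := rfl
    rw [e1] at h1
    rw [e2] at h2
    generalize ∫ ξ, gaussPrimitive ((glue ψ F (ε • ξ) - z) / ε) ∂(stdGaussian (Base n)) = X at *
    generalize ∫ ξ, gaussPrimitive ((F ((√2 * ε) • ξ) - z) / (√2 * ε))
      ∂(stdGaussian (Base n)) = Y at *
    have e : √2 * X - Y = √2 * (X - erfMean ψ ε 0 z) - (Y - erfMean f (√2 * ε) 0 z) := by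
      linarith
    rw [e]
    refine (abs_sub _ _).trans ?_
    rw [abs_mul, abs_of_pos (by positivity : 0 < √2)]
    have h3 : √2 * |X - erfMean ψ ε 0 z| ≤ 2 * (4 * ε ^ 5 * gaussMoment n 5) := by
      gcongr; linarith
    have h4 : 0 ≤ (K + K' + 28 * gaussMoment n 5) * ε ^ 5 := by positivity
    linarith

end Crossing

end TwoKernel

namespace TwoKernel

open ProbabilityTheory
open scoped RealInnerProductSpace

/-! ### Return from the cutoff to the original function. -/

section CrossingExpansion

variable {n : ℕ} {f F : Base n → ℝ}

lemma pd_congr_nhds {x : Base n} (h : f =ᶠ[𝓝 x] F) (i : Fin n) : pd i f =ᶠ[𝓝 x] pd i F :=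
  h.fderiv.mono fun y hy => by rw [pd, pd, hy]

lemma lap_congr_nhds {x : Base n} (h : f =ᶠ[𝓝 x] F) : lap f =ᶠ[𝓝 x] lap F := by
  have : ∀ᶠ y in 𝓝 x, ∀ i, pd i (pd i f) y = pd i (pd i F) y :=
    eventually_all.2 fun i => pd_congr_nhds (pd_congr_nhds h i) i
  exact this.mono fun y hy => by simp only [lap, hy]

lemma hessian_congr_nhds {x : Base n} (h : f =ᶠ[𝓝 x] F) : hessian f x = hessian F x := by
  ext i j
  exact (pd_congr_nhds (pd_congr_nhds h j) i).eq_of_nhds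

lemma laplacian_eq_lap (hf : ContDiff ℝ ∞ f) : Δ f = lap f := by
  ext x
  rw [InnerProductSpace.laplacian_eq_iteratedFDeriv_orthonormalBasis f
    (EuclideanSpace.basisFun (Fin n) ℝ), lap]
  refine Finset.sum_congr rfl fun i _ => ?_
  rw [iteratedFDeriv_two_apply, ← fderiv_fderiv_single f hf]
  simp

/-- Since `f` may grow arbitrarily, its Gaussian moments need not exist; the expansion is carried
out for a compactly supported function with the same germ at the origin. -/
lemma exists_cutoff (hf : ContDiff ℝ ∞ f) :
    ∃ F : Base n → ℝ, ContDiff ℝ ∞ F ∧ HasCompactSupport F ∧ ∀ x, ‖x‖ ≤ 2 → f x = F x := by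
  let χ : ContDiffBump (0 : Base n) := ⟨2, 3, by norm_num, by norm_num⟩
  refine ⟨fun x => χ x * f x, χ.contDiff.mul hf, χ.hasCompactSupport.mul_right, fun x hx => ?_⟩
  change f x = χ x * f x
  rw [χ.one_of_mem_closedBall (by simpa [χ] using hx), one_mul]

lemma trace_eq_of_inner_eq {A : Base n →L[ℝ] Base n} {M : Matrix (Fin n) (Fin n) ℝ}
    (hA : ∀ i j, ⟪A (EuclideanSpace.single i 1), EuclideanSpace.single j 1⟫ = M i j) :
    LinearMap.trace ℝ (Base n) A = M.trace ∧
      LinearMap.trace ℝ (Base n) (A * A * A : Base n →L[ℝ] Base n) = (M ^ 3).trace := by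
  let b := (EuclideanSpace.basisFun (Fin n) ℝ).toBasis
  -- The matrix entry `(i, j)` is `⟪A eⱼ, eᵢ⟫ = M j i`, hence the transpose, which does not affect
  -- traces.
  have hM : LinearMap.toMatrix b b A = M.transpose := by
    ext i j
    rw [LinearMap.toMatrix_apply, Matrix.transpose_apply, ← hA]
    simp [b, EuclideanSpace.inner_single_right]
  constructor
  · rw [LinearMap.trace_eq_matrix_trace ℝ b, hM, Matrix.trace_transpose]
  · have e : ((A * A * A : Base n →L[ℝ] Base n) : Base n →ₗ[ℝ] Base n) =
      (A : Base n →ₗ[ℝ] Base n) * (A : Base n →ₗ[ℝ] Base n) * (A : Base n →ₗ[ℝ] Base n) := rfl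
    rw [e, LinearMap.trace_eq_matrix_trace ℝ b, LinearMap.toMatrix_mul, LinearMap.toMatrix_mul, hM,
      ← Matrix.transpose_mul, ← Matrix.transpose_mul, Matrix.trace_transpose, pow_succ, pow_two,
      mul_assoc]

lemma trace_hessian (f : Base n → ℝ) (x : Base n) : (hessian f x).trace = lap f x := rfl

/-- The crossing height of one step, with its expansion. -/
lemma exists_crossing_expansion (hf : ContDiff ℝ ∞ f) (h0 : f 0 = 0) (h1 : ∀ i, pd i f 0 = 0) :
    ∃ z : ℝ → ℝ, (∀ᶠ t in 𝓝[>] (0 : ℝ), CrossesAxisAt (twoKernelStep t (subgraph f)) (z t)) ∧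
      (fun t : ℝ => z t - (t * lap f 0 + t ^ 2 *
        (1 / 2 * lap (lap f) 0 - ((hessian f 0) ^ 3).trace))) =O[𝓝[>] 0] fun t : ℝ => t ^ 3 := by
  obtain ⟨F, hF, hFs, hfF⟩ := exists_cutoff hf
  have hnhds : f =ᶠ[𝓝 0] F := by
    filter_upwards [Metric.closedBall_mem_nhds (0 : Base n) two_pos] with x hx
    exact hfF x (by simpa using hx)
  obtain ⟨A, C, hA, hAH⟩ := exists_graphBounds hF hFs (by rw [← hnhds.eq_of_nhds, h0])
    fun i => by rw [← (pd_congr_nhds hnhds i).eq_of_nhds, h1]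
  obtain ⟨ht1, ht3⟩ := trace_eq_of_inner_eq hAH
  obtain ⟨C', ε₀, hε₀, hstep⟩ := exists_axis_height hA hf.continuous hfF
  rw [ht1, ht3, ← hessian_congr_nhds hnhds, trace_hessian,
    ← (lap_congr_nhds (lap_congr_nhds hnhds)).eq_of_nhds] at hstep
  have key : ∀ t : ℝ, ∃ z : ℝ, 0 < t → t ≤ ε₀ ^ 2 →
      CrossesAxisAt (twoKernelStep t (subgraph f)) z ∧
      |z - (t * lap f 0 + t ^ 2 * (1 / 2 * lap (lap f) 0 - ((hessian f 0) ^ 3).trace))| ≤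
        C' * t ^ 3 := by
    intro t
    by_cases ht : 0 < t ∧ t ≤ ε₀ ^ 2
    · have hst : 0 < √t := Real.sqrt_pos.2 ht.1
      have hsq : √t ^ 2 = t := Real.sq_sqrt ht.1.le
      obtain ⟨ψ, hψ, hψ0, hψl⟩ := exists_level_height hf.continuous hst
      obtain ⟨z, hz, hlt, hgt, hb⟩ := hstep √t hst (Real.sqrt_le_iff.2 ⟨hε₀.le, ht.2⟩) ψ hψ hψ0
      rw [show √t ^ 4 = (√t ^ 2) ^ 2 by ring, show √t ^ 6 = (√t ^ 2) ^ 3 by ring, hsq] at hb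
      have hg : Continuous fun q : Base n × ℝ =>
          √2 * erfMean ψ √t q.1 q.2 - erfMean f (√2 * √t) q.1 q.2 :=
        (continuous_const.mul (continuous_erfMean hψ)).sub (continuous_erfMean hf.continuous)
      exact ⟨z, fun _ _ => ⟨crossesAxisAt_of_sign hg
        (fun q => mem_twoKernelStep_subgraph hf.continuous hψ ht.1 hψl q.1 q.2) hz hlt hgt, hb⟩⟩
    -- The value for large or nonpositive `t` is irrelevant; it makes `z` a total function.
    · exact ⟨0, fun h h' => absurd ⟨h, h'⟩ ht⟩
  choose z hz using key
  have hev : ∀ᶠ t in 𝓝[>] (0 : ℝ), 0 < t ∧ t ≤ ε₀ ^ 2 := by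
    filter_upwards [Ioc_mem_nhdsGT (show (0 : ℝ) < ε₀ ^ 2 by positivity)] with t ht using ht
  refine ⟨z, hev.mono fun t ht => (hz t ht.1 ht.2).1, IsBigO.of_bound C' (hev.mono fun t ht => ?_)⟩
  rw [Real.norm_eq_abs, Real.norm_eq_abs, abs_of_nonneg (pow_nonneg ht.1.le 3)]
  exact (hz t ht.1 ht.2).2

end CrossingExpansion

end TwoKernel

namespace TwoKernel

/-! ### Directional derivatives within a set, and the second time derivative of a quasilinear flow.
-/

section DirDeriv

variable {W : Type*} [NormedAddCommGroup W] [NormedSpace ℝ W] {S : Set W}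

/-- The derivative of `g` within `S` in the direction `v`. -/
noncomputable def dirDeriv (S : Set W) (v : W) (g : W → ℝ) (q : W) : ℝ := fderivWithin ℝ g S q v

variable {g g' a b c : W → ℝ} {q : W}

lemma contDiffOn_dirDeriv (hS : UniqueDiffOn ℝ S) (hg : ContDiffOn ℝ ∞ g S) (v : W) :
    ContDiffOn ℝ ∞ (dirDeriv S v g) S :=
  (hg.fderivWithin hS (by simp)).clm_apply contDiffOn_const

lemma _root_.ContDiffOn.differentiableWithinAt_of_infty (hg : ContDiffOn ℝ ∞ g S) (hq : q ∈ S) :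
    DifferentiableWithinAt ℝ g S q := hg.differentiableOn (by simp) q hq

/-- Derivatives within `S` see only values on `S`. This allows the evolution equation to be
differentiated at boundary points, in particular at the initial time. -/
lemma dirDeriv_congr (h : EqOn g g' S) (hq : q ∈ S) (v : W) :
    dirDeriv S v g q = dirDeriv S v g' q := by
  rw [dirDeriv, dirDeriv, fderivWithin_congr' h hq]

lemma dirDeriv_eqOn (h : EqOn g g' S) (v : W) : EqOn (dirDeriv S v g) (dirDeriv S v g') S :=
  fun _ hq => dirDeriv_congr h hq v

/-- Symmetry of the second derivative holds in the interior and passes to boundary points that are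
limits of interior points. -/
lemma dirDeriv_comm (hS : UniqueDiffOn ℝ S) (hSc : S ⊆ closure (interior S))
    (hg : ContDiffOn ℝ ∞ g S) (v w : W) :
    EqOn (dirDeriv S v (dirDeriv S w g)) (dirDeriv S w (dirDeriv S v g)) S := by
  intro q hq
  have h1 : DifferentiableWithinAt ℝ (fderivWithin ℝ g S) S q :=
    (hg.fderivWithin (m := ∞) hS (by simp)).differentiableOn (by simp) q hq
  have h2 : ∀ v w, dirDeriv S v (dirDeriv S w g) q =
      fderivWithin ℝ (fderivWithin ℝ g S) S q v w := fun v w => by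
    have h3 := (h1.hasFDerivWithinAt.clm_apply (hasFDerivWithinAt_const w q S)).fderivWithin
      (hS q hq)
    change fderivWithin ℝ (fun q => fderivWithin ℝ g S q w) S q v = _
    rw [h3]
    simp
  rw [h2, h2]
  exact (hg q hq).isSymmSndFDerivWithinAt (by simpa using ENat.LEInfty.out) hS (hSc hq) hq v w

lemma dirDeriv_mul (hS : UniqueDiffOn ℝ S) (ha : ContDiffOn ℝ ∞ a S) (hb : ContDiffOn ℝ ∞ b S)
    (hq : q ∈ S) (v : W) :
    dirDeriv S v (fun q => a q * b q) q = dirDeriv S v a q * b q + a q * dirDeriv S v b q := by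
  rw [dirDeriv, fderivWithin_fun_mul (hS q hq) (ha.differentiableWithinAt_of_infty hq)
    (hb.differentiableWithinAt_of_infty hq)]
  simp [dirDeriv]; ring

lemma dirDeriv_sub (hS : UniqueDiffOn ℝ S) (ha : ContDiffOn ℝ ∞ a S) (hb : ContDiffOn ℝ ∞ b S)
    (hq : q ∈ S) (v : W) :
    dirDeriv S v (fun q => a q - b q) q = dirDeriv S v a q - dirDeriv S v b q := by
  rw [dirDeriv, fderivWithin_fun_sub (hS q hq) (ha.differentiableWithinAt_of_infty hq)
    (hb.differentiableWithinAt_of_infty hq)]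
  simp [dirDeriv]

lemma dirDeriv_sum {ι : Type*} [Fintype ι] {a : ι → W → ℝ} (hS : UniqueDiffOn ℝ S)
    (ha : ∀ i, ContDiffOn ℝ ∞ (a i) S) (hq : q ∈ S) (v : W) :
    dirDeriv S v (fun q => ∑ i, a i q) q = ∑ i, dirDeriv S v (a i) q := by
  rw [dirDeriv, fderivWithin_fun_sum (hS q hq)
    fun i _ => (ha i).differentiableWithinAt_of_infty hq]
  simp [dirDeriv]

lemma dirDeriv_mul_mul_eq_zero (hS : UniqueDiffOn ℝ S) (ha : ContDiffOn ℝ ∞ a S)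
    (hb : ContDiffOn ℝ ∞ b S) (hc : ContDiffOn ℝ ∞ c S) (hq : q ∈ S) (v : W)
    (ha0 : a q = 0) (hb0 : b q = 0) : dirDeriv S v (fun q => a q * b q * c q) q = 0 := by
  rw [dirDeriv_mul hS (ha.mul hb) hc hq, dirDeriv_mul hS ha hb hq, ha0, hb0]
  ring

/-- The second derivative of a product two of whose factors vanish. -/
lemma dirDeriv_dirDeriv_mul_mul (hS : UniqueDiffOn ℝ S) (ha : ContDiffOn ℝ ∞ a S)
    (hb : ContDiffOn ℝ ∞ b S) (hc : ContDiffOn ℝ ∞ c S) (hq : q ∈ S) (v : W)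
    (ha0 : a q = 0) (hb0 : b q = 0) :
    dirDeriv S v (dirDeriv S v (fun q => a q * b q * c q)) q =
      2 * (dirDeriv S v a q * dirDeriv S v b q * c q) := by
  have ha' := contDiffOn_dirDeriv hS ha v
  have hb' := contDiffOn_dirDeriv hS hb v
  have hc' := contDiffOn_dirDeriv hS hc v
  have hab' := contDiffOn_dirDeriv hS (ha.mul hb) v
  -- The derivative is arranged as a combination of products with a factor `a` or `b`, signs being
  -- absorbed so that the difference rule applies. At `q` a further derivative must fall on that
  -- vanishing factor, and only the two mixed terms survive.
  have e : EqOn (dirDeriv S v (fun q => a q * b q * c q))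
      (fun q => (b q * (dirDeriv S v a q * c q) - a q * (dirDeriv S v b q * -c q)) -
        a q * b q * -dirDeriv S v c q) S := by
    intro p hp
    simp only
    rw [dirDeriv_mul hS (ha.mul hb) hc hp, dirDeriv_mul hS ha hb hp]
    ring
  rw [dirDeriv_congr e hq, dirDeriv_sub hS ((hb.mul (ha'.mul hc)).sub (ha.mul (hb'.mul hc.neg)))
    ((ha.mul hb).mul hc'.neg) hq, dirDeriv_mul_mul_eq_zero hS ha hb hc'.neg hq v ha0 hb0,
    dirDeriv_sub hS (hb.mul (ha'.mul hc)) (ha.mul (hb'.mul hc.neg)) hq,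
    dirDeriv_mul hS hb (ha'.mul hc) hq, dirDeriv_mul hS ha (hb'.mul hc.neg) hq, ha0, hb0]
  ring

/-- The second time derivative of a solution of a quasilinear heat equation
`∂_τ g = ∑ ∂ᵢ∂ᵢ g - ∑ ∂ᵢg ∂ⱼg cᵢⱼ` at a critical point. -/
lemma dirDeriv_dirDeriv_of_evolution {ι : Type*} [Fintype ι] (hS : UniqueDiffOn ℝ S)
    (hSc : S ⊆ closure (interior S)) (hg : ContDiffOn ℝ ∞ g S) {c : ι → ι → W → ℝ}
    (hc : ∀ i j, ContDiffOn ℝ ∞ (c i j) S) {e : ι → W} {τ : W}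
    (heq : EqOn (dirDeriv S τ g) (fun q => ∑ i, dirDeriv S (e i) (dirDeriv S (e i) g) q -
      ∑ i, ∑ j, dirDeriv S (e i) g q * dirDeriv S (e j) g q * c i j q) S)
    (hq : q ∈ S) (hcrit : ∀ i, dirDeriv S (e i) g q = 0) :
    dirDeriv S τ (dirDeriv S τ g) q =
      ∑ i, ∑ k, dirDeriv S (e k) (dirDeriv S (e k) (dirDeriv S (e i) (dirDeriv S (e i) g))) q -
      2 * ∑ k, ∑ i, ∑ j, dirDeriv S (e k) (dirDeriv S (e i) g) q *
        dirDeriv S (e k) (dirDeriv S (e j) g) q * c i j q := by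
  have hd : ∀ i, ContDiffOn ℝ ∞ (dirDeriv S (e i) g) S := fun i => contDiffOn_dirDeriv hS hg _
  have hdd : ∀ i, ContDiffOn ℝ ∞ (dirDeriv S (e i) (dirDeriv S (e i) g)) S := fun i =>
    contDiffOn_dirDeriv hS (hd i) _
  have hL : ContDiffOn ℝ ∞ (fun q => ∑ i, dirDeriv S (e i) (dirDeriv S (e i) g) q) S :=
    ContDiffOn.sum fun i _ => hdd i
  have hN1 : ∀ i j, ContDiffOn ℝ ∞
      (fun q => dirDeriv S (e i) g q * dirDeriv S (e j) g q * c i j q) S := fun i j =>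
    ((hd i).mul (hd j)).mul (hc i j)
  have hN2 : ∀ i, ContDiffOn ℝ ∞
      (fun q => ∑ j, dirDeriv S (e i) g q * dirDeriv S (e j) g q * c i j q) S := fun i =>
    ContDiffOn.sum fun j _ => hN1 i j
  have hN : ContDiffOn ℝ ∞
      (fun q => ∑ i, ∑ j, dirDeriv S (e i) g q * dirDeriv S (e j) g q * c i j q) S :=
    ContDiffOn.sum fun i _ => hN2 i
  have hNd : ∀ v, ∀ p ∈ S, dirDeriv S v
      (fun q => ∑ i, ∑ j, dirDeriv S (e i) g q * dirDeriv S (e j) g q * c i j q) p =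
      ∑ i, ∑ j, dirDeriv S v (fun q => dirDeriv S (e i) g q * dirDeriv S (e j) g q * c i j q) p :=
    fun v p hp => by
      rw [dirDeriv_sum hS hN2 hp]
      exact Finset.sum_congr rfl fun i _ => dirDeriv_sum hS (hN1 i) hp v
  have hNdd : ∀ v, dirDeriv S v (dirDeriv S v
      (fun q => ∑ i, ∑ j, dirDeriv S (e i) g q * dirDeriv S (e j) g q * c i j q)) q =
      2 * ∑ i, ∑ j, dirDeriv S v (dirDeriv S (e i) g) q *
        dirDeriv S v (dirDeriv S (e j) g) q * c i j q := fun v => by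
    have hN1' := fun i j => contDiffOn_dirDeriv hS (hN1 i j) v
    rw [dirDeriv_congr (hNd v) hq, dirDeriv_sum hS
      (fun i => ContDiffOn.sum fun j _ => hN1' i j) hq, Finset.mul_sum]
    refine Finset.sum_congr rfl fun i _ => ?_
    rw [dirDeriv_sum hS (hN1' i) hq, Finset.mul_sum]
    exact Finset.sum_congr rfl fun j _ => dirDeriv_dirDeriv_mul_mul hS (hd i) (hd j) (hc i j) hq v
      (hcrit i) (hcrit j)
  -- Moving the time derivative inside the Laplacian lets the equation be substituted a second time.
  have hcomm : ∀ i, EqOn (dirDeriv S τ (dirDeriv S (e i) (dirDeriv S (e i) g)))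
      (dirDeriv S (e i) (dirDeriv S (e i) (dirDeriv S τ g))) S := fun i =>
    (dirDeriv_comm hS hSc (hd i) τ (e i)).trans
      (dirDeriv_eqOn (dirDeriv_comm hS hSc hg τ (e i)) _)
  have hexp : ∀ k, dirDeriv S (e k) (dirDeriv S (e k) (dirDeriv S τ g)) q =
      ∑ i, dirDeriv S (e k) (dirDeriv S (e k) (dirDeriv S (e i) (dirDeriv S (e i) g))) q -
      2 * ∑ i, ∑ j, dirDeriv S (e k) (dirDeriv S (e i) g) q *
        dirDeriv S (e k) (dirDeriv S (e j) g) q * c i j q := fun k => by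
    have e1 : EqOn (dirDeriv S (e k) (dirDeriv S τ g))
        (fun q => ∑ i, dirDeriv S (e k) (dirDeriv S (e i) (dirDeriv S (e i) g)) q -
          dirDeriv S (e k) (fun q => ∑ i, ∑ j, dirDeriv S (e i) g q * dirDeriv S (e j) g q *
            c i j q) q) S := fun p hp => by
      rw [dirDeriv_congr heq hp, dirDeriv_sub hS hL hN hp, dirDeriv_sum hS hdd hp]
    have h3 := fun i => contDiffOn_dirDeriv hS (hdd i) (e k)
    rw [dirDeriv_congr e1 hq, dirDeriv_sub hS (ContDiffOn.sum fun i _ => h3 i)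
      (contDiffOn_dirDeriv hS hN _) hq, dirDeriv_sum hS h3 hq, hNdd]
  have hN0 : dirDeriv S τ
      (fun q => ∑ i, ∑ j, dirDeriv S (e i) g q * dirDeriv S (e j) g q * c i j q) q = 0 := by
    rw [hNd τ q hq]
    exact Finset.sum_eq_zero fun i _ => Finset.sum_eq_zero fun j _ =>
      dirDeriv_mul_mul_eq_zero hS (hd i) (hd j) (hc i j) hq τ (hcrit i) (hcrit j)
  rw [dirDeriv_congr heq hq, dirDeriv_sub hS hL hN hq, hN0, sub_zero, dirDeriv_sum hS hdd hq,
    Finset.sum_congr rfl fun i _ => hcomm i hq, Finset.sum_congr rfl fun i _ => hexp i,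
    Finset.sum_sub_distrib, Finset.mul_sum, Finset.sum_comm]

end DirDeriv

/-! ### One-sided Taylor expansion in time. -/

section TaylorInTime

lemma abs_le_of_abs_deriv_le {h h' : ℝ → ℝ} {δ M : ℝ} {k : ℕ} (hM : 0 ≤ M)
    (hd : ∀ t ∈ Icc 0 δ, HasDerivWithinAt h (h' t) (Icc 0 δ) t)
    (hb : ∀ t ∈ Icc 0 δ, |h' t| ≤ M * t ^ k) (h0 : h 0 = 0) :
    ∀ t ∈ Icc 0 δ, |h t| ≤ M * t ^ (k + 1) := by
  intro t ht
  have hsub : Icc 0 t ⊆ Icc 0 δ := Icc_subset_Icc_right ht.2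
  have := (convex_Icc (0 : ℝ) t).norm_image_sub_le_of_norm_hasDerivWithin_le (f := h) (f' := h')
    (C := M * t ^ k) (x := 0) (y := t) (fun s hs => (hd s (hsub hs)).mono hsub)
    (fun s hs => (hb s (hsub hs)).trans (by have := hs.1; have := hs.2; gcongr))
    (left_mem_Icc.2 ht.1) (right_mem_Icc.2 ht.1)
  rw [h0, sub_zero, sub_zero, Real.norm_eq_abs, Real.norm_eq_abs, abs_of_nonneg ht.1] at this
  exact this.trans (le_of_eq (by ring))

/-- Second-order Taylor expansion at the left end point. -/
lemma isBigO_taylor_two {v v1 v2 v3 : ℝ → ℝ} {T : ℝ} (hT : 0 < T)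
    (h1 : ∀ t ∈ Ico 0 T, HasDerivWithinAt v (v1 t) (Ico 0 T) t)
    (h2 : ∀ t ∈ Ico 0 T, HasDerivWithinAt v1 (v2 t) (Ico 0 T) t)
    (h3 : ∀ t ∈ Ico 0 T, HasDerivWithinAt v2 (v3 t) (Ico 0 T) t)
    (hc : ContinuousOn v3 (Ico 0 T)) :
    (fun t => v t - (v 0 + t * v1 0 + t ^ 2 * (v2 0 / 2))) =O[𝓝[>] 0] fun t : ℝ => t ^ 3 := by
  have hsub : Icc 0 (T / 2) ⊆ Ico 0 T := fun t ht => ⟨ht.1, by linarith [ht.2]⟩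
  -- The third derivative need not be bounded up to `T`, hence the compact interval `[0, T/2]`.
  obtain ⟨M, hM⟩ := isCompact_Icc.exists_bound_of_continuousOn (hc.mono hsub)
  have hM0 : 0 ≤ M := (norm_nonneg _).trans (hM 0 (left_mem_Icc.2 (by linarith)))
  have b2 := abs_le_of_abs_deriv_le (h := fun t => v2 t - v2 0) (h' := v3) (δ := T / 2) (k := 0)
    hM0 (fun t ht => ((h3 t (hsub ht)).mono hsub).sub_const _)
    (fun t ht => by simpa using hM t ht) (by simp)
  have b1 := abs_le_of_abs_deriv_le (h := fun t => v1 t - (v1 0 + t * v2 0))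
    (h' := fun t => v2 t - v2 0) (δ := T / 2) (k := 1) hM0
    (fun t ht => ((h2 t (hsub ht)).mono hsub).sub
      (by simpa using ((hasDerivWithinAt_id t _).mul_const (v2 0)).const_add (v1 0)))
    b2 (by simp)
  have b0 := abs_le_of_abs_deriv_le (h := fun t => v t - (v 0 + t * v1 0 + t ^ 2 * (v2 0 / 2)))
    (h' := fun t => v1 t - (v1 0 + t * v2 0)) (δ := T / 2) (k := 2) hM0
    (fun t ht => ((h1 t (hsub ht)).mono hsub).sub (by
      have e1 := ((hasDerivWithinAt_id t (Icc 0 (T / 2))).mul_const (v1 0)).const_add (v 0)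
      have e2 := ((hasDerivAt_pow 2 t).hasDerivWithinAt (s := Icc 0 (T / 2))).mul_const (v2 0 / 2)
      refine (e1.add e2).congr_deriv ?_
      simp; ring))
    b1 (by simp)
  refine IsBigO.of_bound M ?_
  filter_upwards [Ioc_mem_nhdsGT (show (0 : ℝ) < T / 2 by positivity)] with t ht
  rw [Real.norm_eq_abs, Real.norm_eq_abs, abs_of_nonneg (pow_nonneg ht.1.le 3)]
  exact b0 t ⟨ht.1.le, ht.2⟩

end TaylorInTime

end TwoKernel

namespace TwoKernel

/-! ### Motion by mean curvature at a critical point of the initial graph. -/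

section Evolution

variable {n : ℕ} {U : Set (Base n)} {T : ℝ} {g : Base n × ℝ → ℝ}

/-- The `i`-th horizontal unit vector of space-time. -/
noncomputable def hvec (i : Fin n) : Base n × ℝ := (EuclideanSpace.single i 1, 0)

lemma uniqueDiffOn_cylinder (hU : IsOpen U) (T : ℝ) : UniqueDiffOn ℝ (U ×ˢ Ico 0 T) :=
  hU.uniqueDiffOn.prod (uniqueDiffOn_Ico 0 T)

lemma cylinder_subset_closure (U : Set (Base n)) (hT : 0 < T) :
    U ×ˢ Ico 0 T ⊆ closure (U ×ˢ Ioo 0 T) := by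
  rw [closure_prod_eq, closure_Ioo hT.ne]
  exact prod_mono subset_closure Ico_subset_Icc_self

lemma cylinder_subset_closure_interior (hU : IsOpen U) (hT : 0 < T) :
    U ×ˢ Ico 0 T ⊆ closure (interior (U ×ˢ Ico 0 T)) :=
  (cylinder_subset_closure U hT).trans (closure_mono (interior_maximal
    (prod_mono subset_rfl Ioo_subset_Ico_self) (hU.prod isOpen_Ioo)))

/-- A horizontal slice of the cylinder is open in space, so the derivative within the cylinder is an
ordinary partial derivative, even at `t = 0`. As agreement with `φ` is asked only on `U`, the lemma
can be iterated to reach higher derivatives of the initial datum. -/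
lemma dirDeriv_hvec_eq_pd (hU : IsOpen U) (hg : ContDiffOn ℝ ∞ g (U ×ˢ Ico 0 T)) {t : ℝ}
    (ht : t ∈ Ico 0 T) {φ : Base n → ℝ} (hφ : ∀ x ∈ U, g (x, t) = φ x) (i : Fin n) :
    ∀ x ∈ U, dirDeriv (U ×ˢ Ico 0 T) (hvec i) g (x, t) = pd i φ x := by
  intro x hx
  have h1 : HasFDerivWithinAt (fun y : Base n => (y, t))
      ((ContinuousLinearMap.id ℝ (Base n)).prod 0) U x :=
    (hasFDerivWithinAt_id x U).prodMk (hasFDerivWithinAt_const t x U)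
  have hmaps : MapsTo (fun y : Base n => (y, t)) U (U ×ˢ Ico 0 T) := fun y hy => ⟨hy, ht⟩
  have h2 := (hg.differentiableWithinAt_of_infty (q := (x, t)) ⟨hx, ht⟩).hasFDerivWithinAt.comp x h1
    hmaps
  have h3 : HasFDerivAt φ _ x := (h2.congr (fun y hy => (hφ y hy).symm)
    (hφ x hx).symm).hasFDerivAt (hU.mem_nhds hx)
  rw [pd, h3.fderiv]
  simp [dirDeriv, hvec]

lemma hasDerivWithinAt_time (hg : ContDiffOn ℝ ∞ g (U ×ˢ Ico 0 T)) {x : Base n} (hx : x ∈ U)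
    {t : ℝ} (ht : t ∈ Ico 0 T) :
    HasDerivWithinAt (fun t => g (x, t)) (dirDeriv (U ×ˢ Ico 0 T) (0, 1) g (x, t)) (Ico 0 T) t := by
  have h1 : HasDerivWithinAt (fun t : ℝ => (x, t)) ((0, 1) : Base n × ℝ) (Ico 0 T) t :=
    (hasDerivWithinAt_const t _ x).prodMk (hasDerivWithinAt_id t _)
  exact (hg.differentiableWithinAt_of_infty
    (q := (x, t)) ⟨hx, ht⟩).hasFDerivWithinAt.comp_hasDerivWithinAt t h1 (fun y hy => ⟨hx, hy⟩)

/-- The speed of motion by mean curvature is the Laplacian minus a term that is quadratic in the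
gradient. -/
lemma curvatureSpeed_eq (φ : Base n → ℝ) (x : Base n) :
    curvatureSpeed φ x = ∑ i, pd i (pd i φ) x -
      ∑ i, ∑ j, pd i φ x * pd j φ x * (pd i (pd j φ) x / (1 + ∑ k, pd k φ x ^ 2)) := by
  have hp : 1 + ∑ k, pd k φ x ^ 2 ≠ 0 := by positivity
  rw [curvatureSpeed, div_eq_iff hp, sub_mul, Finset.sum_mul, Finset.sum_mul,
    ← Finset.sum_sub_distrib]
  refine Finset.sum_congr rfl fun i _ => ?_
  rw [Finset.sum_mul]
  have e : ∀ j, ((1 + ∑ k, pd k φ x ^ 2) * (if i = j then 1 else 0) - pd i φ x * pd j φ x) *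
      pd i (pd j φ) x = (if i = j then pd i (pd j φ) x * (1 + ∑ k, pd k φ x ^ 2) else 0) -
      pd i φ x * pd j φ x * (pd i (pd j φ) x / (1 + ∑ k, pd k φ x ^ 2)) *
        (1 + ∑ k, pd k φ x ^ 2) := fun j => by
    split_ifs <;> field_simp
    simp
  rw [Finset.sum_congr rfl fun j _ => e j, Finset.sum_sub_distrib]
  simp

variable {f : Base n → ℝ} {u : Base n → ℝ → ℝ}

/-- The partial derivatives of a smooth evolution, up to the initial time. -/
lemma pd_pd_evolution (hU : IsOpen U) (hu : ContDiffOn ℝ ∞ (fun q : Base n × ℝ => u q.1 q.2)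
    (U ×ˢ Ico 0 T)) {t : ℝ} (ht : t ∈ Ico 0 T) (i j : Fin n) {x : Base n} (hx : x ∈ U) :
    pd i (pd j fun y => u y t) x = dirDeriv (U ×ˢ Ico 0 T) (hvec i)
      (dirDeriv (U ×ˢ Ico 0 T) (hvec j) fun q => u q.1 q.2) (x, t) :=
  (dirDeriv_hvec_eq_pd hU (contDiffOn_dirDeriv (uniqueDiffOn_cylinder hU T) hu _) ht
    (dirDeriv_hvec_eq_pd hU hu ht (fun _ _ => rfl) j) i x hx).symm

lemma pd_pd_evolution_comm (hU : IsOpen U) (hT : 0 < T)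
    (hu : ContDiffOn ℝ ∞ (fun q : Base n × ℝ => u q.1 q.2)
    (U ×ˢ Ico 0 T)) {t : ℝ} (ht : t ∈ Ico 0 T) (i j : Fin n) {x : Base n} (hx : x ∈ U) :
    pd i (pd j fun y => u y t) x = pd j (pd i fun y => u y t) x := by
  rw [pd_pd_evolution hU hu ht i j hx, pd_pd_evolution hU hu ht j i hx]
  exact dirDeriv_comm (uniqueDiffOn_cylinder hU T) (cylinder_subset_closure_interior hU hT) hu _ _
    ⟨hx, ht⟩

lemma pd_pd_comm (hf : ContDiff ℝ ∞ f) (i j : Fin n) : pd i (pd j f) = pd j (pd i f) := by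
  ext x
  rw [← fderiv_fderiv_single f hf, ← fderiv_fderiv_single f hf]
  exact (hf.contDiffAt.isSymmSndFDerivAt (by simpa using ENat.LEInfty.out)).eq _ _

lemma lap_lap (hf : ContDiff ℝ ∞ f) (x : Base n) :
    lap (lap f) x = ∑ i, ∑ k, pd k (pd k (pd i (pd i f))) x := by
  have hsum : ∀ (g : Fin n → Base n → ℝ), (∀ i, ContDiff ℝ ∞ (g i)) → ∀ k,
      pd k (fun x => ∑ i, g i x) = fun x => ∑ i, pd k (g i) x := fun g hg k => by
    ext x
    rw [pd, fderiv_fun_sum fun i _ => (hg i).differentiable (by simp) x]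
    simp [pd]
  have h2 := fun i => contDiff_pd (contDiff_pd hf i) i
  have e : lap f = fun x => ∑ i, pd i (pd i f) x := rfl
  rw [lap, e, Finset.sum_comm]
  refine Finset.sum_congr rfl fun k _ => ?_
  rw [hsum _ h2, hsum _ fun i => contDiff_pd (h2 i) k]

/-- The equation in space-time, up to the initial time. -/
lemma dirDeriv_time_eq (hU : IsOpen U) (hT : 0 < T) (hu : IsSmoothEvolution curvatureSpeed f U T u) :
    let S := U ×ˢ Ico 0 T
    let G : Base n × ℝ → ℝ := fun q => u q.1 q.2
    EqOn (dirDeriv S (0, 1) G) (fun q => ∑ i, dirDeriv S (hvec i) (dirDeriv S (hvec i) G) q -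
      ∑ i, ∑ j, dirDeriv S (hvec i) G q * dirDeriv S (hvec j) G q *
        (dirDeriv S (hvec i) (dirDeriv S (hvec j) G) q /
          (1 + ∑ k, dirDeriv S (hvec k) G q ^ 2))) S := by
  intro S G
  have hS : UniqueDiffOn ℝ S := uniqueDiffOn_cylinder hU T
  have hG : ContDiffOn ℝ ∞ G S := hu.smooth
  have hd := fun i => contDiffOn_dirDeriv hS hG (hvec i)
  have hdd := fun i j => contDiffOn_dirDeriv hS (hd j) (hvec i)
  have hp : ContDiffOn ℝ ∞ (fun q => 1 + ∑ k, dirDeriv S (hvec k) G q ^ 2) S :=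
    contDiffOn_const.add (ContDiffOn.sum fun k _ => (hd k).pow 2)
  have hR : ContDiffOn ℝ ∞ (fun q => ∑ i, dirDeriv S (hvec i) (dirDeriv S (hvec i) G) q -
      ∑ i, ∑ j, dirDeriv S (hvec i) G q * dirDeriv S (hvec j) G q *
        (dirDeriv S (hvec i) (dirDeriv S (hvec j) G) q /
          (1 + ∑ k, dirDeriv S (hvec k) G q ^ 2))) S :=
    (ContDiffOn.sum fun i _ => hdd i i).sub (ContDiffOn.sum fun i _ => ContDiffOn.sum fun j _ =>
      ((hd i).mul (hd j)).mul ((hdd i j).div hp fun q _ => by positivity))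
  have hint : EqOn (dirDeriv S (0, 1) G) (fun q =>
      ∑ i, dirDeriv S (hvec i) (dirDeriv S (hvec i) G) q -
      ∑ i, ∑ j, dirDeriv S (hvec i) G q * dirDeriv S (hvec j) G q *
        (dirDeriv S (hvec i) (dirDeriv S (hvec j) G) q /
          (1 + ∑ k, dirDeriv S (hvec k) G q ^ 2))) (U ×ˢ Ioo 0 T) := by
    rintro ⟨x, t⟩ ⟨hx, ht⟩
    have ht' : t ∈ Ico 0 T := Ioo_subset_Ico_self ht
    have h1 := (hasDerivWithinAt_time hG hx ht').hasDerivAt (Ico_mem_nhds ht.1 ht.2)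
    have h2 := h1.unique (hu.equation x hx t ht)
    refine h2.trans ?_
    simp only [curvatureSpeed_eq, pd_pd_evolution hU hu.smooth ht' _ _ hx,
      ← dirDeriv_hvec_eq_pd hU hu.smooth ht' (fun _ _ => rfl) _ x hx]
    rfl
  -- The equation is given only for positive times; both sides are continuous up to `t = 0`, and the
  -- open cylinder is dense.
  refine hint.of_subset_closure (contDiffOn_dirDeriv hS hG _).continuousOn hR.continuousOn
    (prod_mono subset_rfl Ioo_subset_Ico_self) (cylinder_subset_closure U hT)

lemma trace_hessian_pow_three (hf : ContDiff ℝ ∞ f) (x : Base n) :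
    ((hessian f x) ^ 3).trace = ∑ k, ∑ i, ∑ j,
      pd k (pd i f) x * pd k (pd j f) x * pd i (pd j f) x := by
  simp only [Matrix.trace, Matrix.diag, pow_succ, pow_zero, one_mul, Matrix.mul_apply, hessian,
    Matrix.of_apply, Finset.sum_mul]
  refine Finset.sum_congr rfl fun k _ => ?_
  rw [Finset.sum_comm]
  refine Finset.sum_congr rfl fun i _ => Finset.sum_congr rfl fun j _ => ?_
  rw [pd_pd_comm hf j k]
  ring

/-- The expansion of motion by mean curvature. -/
lemma isBigO_evolution (hf : ContDiff ℝ ∞ f) (h0 : f 0 = 0) (h1 : ∀ i, pd i f 0 = 0)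
    (hU : IsOpen U) (h0U : 0 ∈ U) (hT : 0 < T) (hu : IsSmoothEvolution curvatureSpeed f U T u) :
    (fun t : ℝ => u 0 t - (t * lap f 0 + t ^ 2 *
      (1 / 2 * lap (lap f) 0 - ((hessian f 0) ^ 3).trace))) =O[𝓝[>] 0] fun t : ℝ => t ^ 3 := by
  have hev := dirDeriv_time_eq hU hT hu
  simp only at hev
  set S := U ×ˢ Ico 0 T with hSdef
  set G : Base n × ℝ → ℝ := fun q => u q.1 q.2 with hGdef
  have hS : UniqueDiffOn ℝ S := uniqueDiffOn_cylinder hU T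
  have hSc : S ⊆ closure (interior S) := cylinder_subset_closure_interior hU hT
  have hG : ContDiffOn ℝ ∞ G S := hu.smooth
  have ht0 : (0 : ℝ) ∈ Ico 0 T := left_mem_Ico.2 hT
  have hd := fun i => contDiffOn_dirDeriv hS hG (hvec i)
  have hdd := fun i j => contDiffOn_dirDeriv hS (hd j) (hvec i)
  have hddd := fun i j k => contDiffOn_dirDeriv hS (hdd j k) (hvec i)
  have p1 : ∀ i, ∀ x ∈ U, dirDeriv S (hvec i) G (x, 0) = pd i f x := fun i =>
    dirDeriv_hvec_eq_pd hU hG ht0 hu.initial i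
  have p2 : ∀ i j, ∀ x ∈ U, dirDeriv S (hvec i) (dirDeriv S (hvec j) G) (x, 0) =
    pd i (pd j f) x := fun i j => dirDeriv_hvec_eq_pd hU (hd j) ht0 (p1 j) i
  have p4 : ∀ i j, ∀ x ∈ U, dirDeriv S (hvec i) (dirDeriv S (hvec i) (dirDeriv S (hvec j)
    (dirDeriv S (hvec j) G))) (x, 0) = pd i (pd i (pd j (pd j f))) x := fun i j =>
    dirDeriv_hvec_eq_pd hU (hddd i j j) ht0 (dirDeriv_hvec_eq_pd hU (hdd j j) ht0 (p2 j j) i) i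
  have hcrit : ∀ i, dirDeriv S (hvec i) G (0, 0) = 0 := fun i => (p1 i 0 h0U).trans (h1 i)
  have hq : ((0 : Base n), (0 : ℝ)) ∈ S := ⟨h0U, ht0⟩
  have hp : ContDiffOn ℝ ∞ (fun q => 1 + ∑ k, dirDeriv S (hvec k) G q ^ 2) S :=
    contDiffOn_const.add (ContDiffOn.sum fun k _ => (hd k).pow 2)
  have v1 : dirDeriv S (0, 1) G (0, 0) = lap f 0 := by
    rw [hev hq]
    simp only [hcrit, lap]
    simp [p2 _ _ 0 h0U]
  -- The coefficient is `uᵢⱼ / (1 + |∇u|²)`, which reduces to the Hessian at the critical point, so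
  -- the triple sum is the trace of the cubed Hessian.
  have v2 : dirDeriv S (0, 1) (dirDeriv S (0, 1) G) (0, 0) =
      lap (lap f) 0 - 2 * ((hessian f 0) ^ 3).trace := by
    rw [dirDeriv_dirDeriv_of_evolution hS hSc hG
      (fun i j => (hdd i j).div hp fun q _ => by positivity) hev hq hcrit,
      trace_hessian_pow_three hf]
    congr 1
    · rw [lap_lap hf]
      exact Finset.sum_congr rfl fun i _ => Finset.sum_congr rfl fun k _ => p4 k i 0 h0U
    · simp only [Pi.div_apply, hcrit, p2 _ _ 0 h0U]
      simp
  have hτ := contDiffOn_dirDeriv hS hG (0, 1)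
  have hττ := contDiffOn_dirDeriv hS hτ (0, 1)
  have hτττ := contDiffOn_dirDeriv hS hττ (0, 1)
  have htay := isBigO_taylor_two hT (fun t ht => hasDerivWithinAt_time hG h0U ht)
    (fun t ht => hasDerivWithinAt_time hτ h0U ht) (fun t ht => hasDerivWithinAt_time hττ h0U ht)
    (hτττ.continuousOn.comp (by fun_prop : Continuous fun t : ℝ => ((0 : Base n), t)).continuousOn
      fun t ht => ⟨h0U, ht⟩)
  rw [v1, v2] at htay
  refine htay.congr_left fun t => ?_
  have : G (0, 0) = 0 := (hu.initial 0 h0U).trans h0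
  rw [this]
  simp only [G]
  ring

end Evolution

end TwoKernel

namespace TwoKernel

/-! ### The case `n = 2` in coordinates. -/

section DimensionThree

variable {f : Base 2 → ℝ}

/-- The general formula contains both mixed derivatives, while the planar one merges them; equality
of the mixed derivatives is therefore an assumption, supplied for solutions by their smoothness. -/
lemma curvatureSpeed₂_eq {g : Base 2 → ℝ} {x : Base 2}
    (h : pd 0 (pd 1 g) x = pd 1 (pd 0 g) x) : curvatureSpeed₂ g x = curvatureSpeed g x := by
  simp only [curvatureSpeed₂, curvatureSpeed, Fin.sum_univ_two, ← h]
  simp only [Fin.isValue, if_true, zero_ne_one, one_ne_zero, if_false]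
  congr 1 <;> ring

lemma IsSmoothEvolution.curvatureSpeed_of_two {U : Set (Base 2)} {T : ℝ} {u : Base 2 → ℝ → ℝ}
    (hU : IsOpen U) (hT : 0 < T) (hu : IsSmoothEvolution curvatureSpeed₂ f U T u) :
    IsSmoothEvolution curvatureSpeed f U T u :=
  ⟨hu.smooth, hu.initial, fun x hx t ht => by
    rw [← curvatureSpeed₂_eq (pd_pd_evolution_comm hU hT hu.smooth (Ioo_subset_Ico_self ht) 0 1 hx)]
    exact hu.equation x hx t ht⟩

lemma lap_two (x : Base 2) : lap f x = pd 0 (pd 0 f) x + pd 1 (pd 1 f) x := by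
  simp [lap, Fin.sum_univ_two]

lemma lap_lap_two (hf : ContDiff ℝ ∞ f) (x : Base 2) :
    lap (lap f) x = pd 0 (pd 0 (pd 0 (pd 0 f))) x + 2 * pd 0 (pd 0 (pd 1 (pd 1 f))) x +
      pd 1 (pd 1 (pd 1 (pd 1 f))) x := by
  have h : pd 1 (pd 1 (pd 0 (pd 0 f))) = pd 0 (pd 0 (pd 1 (pd 1 f))) := by
    have h0 := contDiff_pd hf 0
    rw [pd_pd_comm h0 1 0, pd_pd_comm (contDiff_pd h0 1) 1 0, pd_pd_comm hf 1 0,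
      pd_pd_comm (contDiff_pd hf 1) 1 0]
  rw [lap_lap hf]
  simp only [Fin.sum_univ_two, h]
  ring

lemma trace_hessian_pow_three_two (hf : ContDiff ℝ ∞ f) (x : Base 2) :
    ((hessian f x) ^ 3).trace = pd 0 (pd 0 f) x ^ 3 +
      3 * pd 0 (pd 0 f) x * pd 0 (pd 1 f) x ^ 2 + 3 * pd 1 (pd 1 f) x * pd 0 (pd 1 f) x ^ 2 +
      pd 1 (pd 1 f) x ^ 3 := by
  rw [trace_hessian_pow_three hf]
  simp only [Fin.sum_univ_two, pd_pd_comm hf 1 0]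
  ring

end DimensionThree

/-- The second-order consistency of the two-kernel extrapolation in every dimension. -/
lemma exists_second_order_expansion {n : ℕ} {f : Base n → ℝ} (hf : ContDiff ℝ ∞ f) (h0 : f 0 = 0)
    (h1 : ∀ i, pd i f 0 = 0) :
    ∃ z : ℝ → ℝ, (∀ᶠ t in 𝓝[>] (0 : ℝ), CrossesAxisAt (twoKernelStep t (subgraph f)) (z t)) ∧
      (fun t : ℝ => z t - (t * lap f 0 + t ^ 2 *
        (1 / 2 * lap (lap f) 0 - ((hessian f 0) ^ 3).trace))) =O[𝓝[>] 0] (fun t : ℝ => t ^ 3) ∧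
      ∀ (U : Set (Base n)) (T : ℝ) (u : Base n → ℝ → ℝ), IsOpen U → 0 ∈ U → 0 < T →
        IsSmoothEvolution curvatureSpeed f U T u →
        (fun t : ℝ => u 0 t - (t * lap f 0 + t ^ 2 *
          (1 / 2 * lap (lap f) 0 - ((hessian f 0) ^ 3).trace))) =O[𝓝[>] 0] (fun t : ℝ => t ^ 3) ∧
        (fun t : ℝ => z t - u 0 t) =O[𝓝[>] 0] (fun t : ℝ => t ^ 3) := by
  obtain ⟨z, hz, hexp⟩ := exists_crossing_expansion hf h0 h1
  refine ⟨z, hz, hexp, fun U T u hU h0U hT hu => ?_⟩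
  have hu' := isBigO_evolution hf h0 h1 hU h0U hT hu
  exact ⟨hu', (hexp.sub hu').congr_left fun t => by ring⟩

end TwoKernel

theorem mainTheorem1 :
    -- Every dimension: interfaces in `ℝⁿ × ℝ` that are graphs over `ℝⁿ`.
    (∀ (n : ℕ) (f : TwoKernel.Base n → ℝ), ContDiff ℝ ∞ f → f 0 = 0 →
      (∀ i, TwoKernel.pd i f 0 = 0) →
      ∃ z : ℝ → ℝ,
        (∀ᶠ t in 𝓝[>] (0 : ℝ),
          TwoKernel.CrossesAxisAt (TwoKernel.twoKernelStep t (TwoKernel.subgraph f)) (z t)) ∧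
        (fun t : ℝ => z t - (t * (Δ f) 0 + t ^ 2 *
            (1 / 2 * (Δ (Δ f)) 0 - ((TwoKernel.hessian f 0) ^ 3).trace)))
          =O[𝓝[>] 0] (fun t : ℝ => t ^ 3) ∧
        ∀ (U : Set (TwoKernel.Base n)) (T : ℝ) (u : TwoKernel.Base n → ℝ → ℝ),
          IsOpen U → 0 ∈ U → 0 < T →
          TwoKernel.IsSmoothEvolution TwoKernel.curvatureSpeed f U T u →
          (fun t : ℝ => u 0 t - (t * (Δ f) 0 + t ^ 2 *
              (1 / 2 * (Δ (Δ f)) 0 - ((TwoKernel.hessian f 0) ^ 3).trace)))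
            =O[𝓝[>] 0] (fun t : ℝ => t ^ 3) ∧
          (fun t : ℝ => z t - u 0 t) =O[𝓝[>] 0] (fun t : ℝ => t ^ 3)) ∧
    -- Dimension three, with all derivatives written out.
    (∀ f : TwoKernel.Base 2 → ℝ, ContDiff ℝ ∞ f → f 0 = 0 →
      TwoKernel.pd 0 f 0 = 0 → TwoKernel.pd 1 f 0 = 0 →
      ∀ fxx fxy fyy fxxxx fxxyy fyyyy : ℝ,
      fxx = TwoKernel.pd 0 (TwoKernel.pd 0 f) 0 →
      fxy = TwoKernel.pd 0 (TwoKernel.pd 1 f) 0 →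
      fyy = TwoKernel.pd 1 (TwoKernel.pd 1 f) 0 →
      fxxxx = TwoKernel.pd 0 (TwoKernel.pd 0 (TwoKernel.pd 0 (TwoKernel.pd 0 f))) 0 →
      fxxyy = TwoKernel.pd 0 (TwoKernel.pd 0 (TwoKernel.pd 1 (TwoKernel.pd 1 f))) 0 →
      fyyyy = TwoKernel.pd 1 (TwoKernel.pd 1 (TwoKernel.pd 1 (TwoKernel.pd 1 f))) 0 →
      ∃ z : ℝ → ℝ,
        (∀ᶠ t in 𝓝[>] (0 : ℝ),
          TwoKernel.CrossesAxisAt (TwoKernel.twoKernelStep t (TwoKernel.subgraph f)) (z t)) ∧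
        (fun t : ℝ => z t - (t * (fxx + fyy) + t ^ 2 *
            (1 / 2 * (fxxxx + 2 * fxxyy + fyyyy)
              - (fxx ^ 3 + 3 * fxx * fxy ^ 2 + 3 * fyy * fxy ^ 2 + fyy ^ 3))))
          =O[𝓝[>] 0] (fun t : ℝ => t ^ 3) ∧
        ∀ (U : Set (TwoKernel.Base 2)) (T : ℝ) (u : TwoKernel.Base 2 → ℝ → ℝ),
          IsOpen U → 0 ∈ U → 0 < T →
          TwoKernel.IsSmoothEvolution TwoKernel.curvatureSpeed₂ f U T u →
          (fun t : ℝ => u 0 t - (t * (fxx + fyy) + t ^ 2 *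
              (1 / 2 * (fxxxx + 2 * fxxyy + fyyyy)
                - (fxx ^ 3 + 3 * fxx * fxy ^ 2 + 3 * fyy * fxy ^ 2 + fyy ^ 3))))
            =O[𝓝[>] 0] (fun t : ℝ => t ^ 3) ∧
          (fun t : ℝ => z t - u 0 t) =O[𝓝[>] 0] (fun t : ℝ => t ^ 3)) := by
  refine ⟨fun n f hf h0 h1 => ?_, ?_⟩
  · rw [TwoKernel.laplacian_eq_lap hf, TwoKernel.laplacian_eq_lap (TwoKernel.contDiff_lap hf)]
    exact TwoKernel.exists_second_order_expansion hf h0 h1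
  · rintro f hf h0 hx hy fxx fxy fyy fxxxx fxxyy fyyyy rfl rfl rfl rfl rfl rfl
    obtain ⟨z, hz, hexp, hu⟩ := TwoKernel.exists_second_order_expansion hf h0
      (Fin.forall_fin_two.2 ⟨hx, hy⟩)
    rw [← TwoKernel.lap_two, ← TwoKernel.lap_lap_two hf,
      ← TwoKernel.trace_hessian_pow_three_two hf]
    exact ⟨z, hz, hexp, fun U T u hU h0U hT hsol =>
      hu U T u hU h0U hT (hsol.curvatureSpeed_of_two hU hT)⟩
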